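/- **Lemma (Shift complexity).** For $a\in\mathbb Z$ let $\mathcal L(a)\ge 1$ be its bitsize, and for $f\in\mathbb Z[x_1,\dots,x_n]$ let $\mathcal L(f)\ge 1$ be the maximum bitsize of its coefficients (including one bit for the sign). Bit complexity is measured on a random access machine with logarithmic cost whose only arithmetic instructions on integers are addition, subtraction and shifts by powers of two, each instruction being charged the number of bits that it handles (addresses included). There is one algorithm that, given integers $s\ge 0$, $n\ge 1$, $d\ge 0$, polynomials $f_1,\dots,f_s\in\mathbb Z[x_1,\dots,x_n]$ of degree at most $d$ in each variable, represented by their coefficient tensors of size $(d+1)^n$, and $\mathbf u=(u_1,\dots,u_n)\in\mathbb Z^n$, computes the coefficient tensors of $f_1(\mathbf x+\mathbf u),\dots,f_s(\mathbf x+\mathbf u)$, and that has the following property. For every $K\in\mathbb N$ there are constants $C,c\in\mathbb N$ such that, whenever $s\le Kn$, $\mathcal L(f_j)\le\tau$ for all $j$ and $\mathcal L(u_k)\le\sigma$ for all $k$, the number $t$ of bit operations satisfies $$t\le C\,\bigl(n^2(d+1)^n\tau+(d+1)^{n+1}n^3\sigma\bigr)\,\lfloor\log_2(n+d+\tau+\sigma+2)\rfloor^{c},$$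 that is, $t=\widetilde{\mathcal O}_B\bigl(n^2(d+1)^n\tau+(d+1)^{n+1}n^3\sigma\bigr)$; moreover, for every $A\in\mathbb N$ with $(d+1)^n\le A\,d^n$, $$t\le C\,A\,\bigl(n^2d^n\tau+d^{n+1}n^3\sigma\bigr)\,\lfloor\log_2(n+d+\tau+\sigma+2)\rfloor^{c}.$$ In particular $t=\widetilde{\mathcal O}_B\bigl(n^2d^n\tau+d^{n+1}n^3\sigma\bigr)$ whenever $d\ge1$ and $(d+1)^n=\mathcal O(d^n)$, for instance for fixed $n$ (with $A=2^n$) or for $n=\mathcal O(d)$. -/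

import Mathlib

/-!
### Cost model

Bit complexity is measured on a random access machine under the logarithmic cost criterion.
The machine has integer registers and integer arrays; a program is a finite text and hence uses
finitely many of them. The only arithmetic primitives are addition, subtraction and shifts by
powers of two (there is no multiplication), and every instruction is charged the number of bits
that it handles, including the bits of the addresses.
-/

namespace BitRAM

/-- Contents of the machine: registers, and arrays indexed by the integers. -/
structure State where
  reg : ℕ → ℤ
  arr : ℕ → ℤ → ℤ

/-- Write an integer into a register. -/
def State.setReg (S : State) (r : ℕ) (v : ℤ) : State :=
  { S with reg := Function.update S.reg r v }

/-- Write an integer into a cell of an array. -/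
def State.setCell (S : State) (a : ℕ) (i v : ℤ) : State :=
  { S with arr := Function.update S.arr a (Function.update (S.arr a) i v) }

/-- Programs. Register names and array names are constants of the program. -/
inductive Prog where
  /-- `r := c` -/
  | const (r : ℕ) (c : ℤ)
  /-- `r := x + y` -/
  | add (r x y : ℕ)
  /-- `r := x - y` -/
  | sub (r x y : ℕ)
  /-- `r := x * 2 ^ y` (nothing is shifted if `y` is negative) -/
  | shl (r x y : ℕ)
  /-- `r := ⌊x / 2 ^ y⌋` (nothing is shifted if `y` is negative) -/
  | shr (r x y : ℕ)
  /-- `r := a[x]` -/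
  | load (r a x : ℕ)
  /-- `a[x] := y` -/
  | store (a x y : ℕ)
  /-- `p; q` -/
  | seq (p q : Prog)
  /-- `if x > 0 then p else q` -/
  | ifPos (x : ℕ) (p q : Prog)
  /-- `while x > 0 do p` -/
  | whilePos (x : ℕ) (p : Prog)

/-- Number of bits of an integer: binary digits of the absolute value and a sign bit. -/
def len (z : ℤ) : ℕ := z.natAbs.size + 1

/-- `Exec P S S' t`: program `P`, started in state `S`, halts in state `S'`, and the run takes `t`
bit operations. -/
inductive Exec : Prog → State → State → ℕ → Prop where
  | const (S : State) (r : ℕ) (c : ℤ) :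
      Exec (.const r c) S (S.setReg r c) (len c)
  | add (S : State) (r x y : ℕ) :
      Exec (.add r x y) S (S.setReg r (S.reg x + S.reg y)) (len (S.reg x) + len (S.reg y))
  | sub (S : State) (r x y : ℕ) :
      Exec (.sub r x y) S (S.setReg r (S.reg x - S.reg y)) (len (S.reg x) + len (S.reg y))
  | shl (S : State) (r x y : ℕ) :
      Exec (.shl r x y) S (S.setReg r (S.reg x * 2 ^ (S.reg y).toNat))
        (len (S.reg x) + len (S.reg y) + (S.reg y).toNat)
  | shr (S : State) (r x y : ℕ) :
      Exec (.shr r x y) S (S.setReg r (S.reg x / 2 ^ (S.reg y).toNat))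
        (len (S.reg x) + len (S.reg y))
  | load (S : State) (r a x : ℕ) :
      Exec (.load r a x) S (S.setReg r (S.arr a (S.reg x)))
        (len (S.reg x) + len (S.arr a (S.reg x)))
  | store (S : State) (a x y : ℕ) :
      Exec (.store a x y) S (S.setCell a (S.reg x) (S.reg y)) (len (S.reg x) + len (S.reg y))
  | seq {p q : Prog} {S S₁ S₂ : State} {t₁ t₂ : ℕ} :
      Exec p S S₁ t₁ → Exec q S₁ S₂ t₂ → Exec (.seq p q) S S₂ (t₁ + t₂)
  | ifPos_true {x : ℕ} {p q : Prog} {S S' : State} {t : ℕ} :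
      0 < S.reg x → Exec p S S' t → Exec (.ifPos x p q) S S' (len (S.reg x) + t)
  | ifPos_false {x : ℕ} {p q : Prog} {S S' : State} {t : ℕ} :
      ¬ 0 < S.reg x → Exec q S S' t → Exec (.ifPos x p q) S S' (len (S.reg x) + t)
  | whilePos_done {x : ℕ} {p : Prog} {S : State} :
      ¬ 0 < S.reg x → Exec (.whilePos x p) S S (len (S.reg x))
  | whilePos_loop {x : ℕ} {p : Prog} {S S₁ S₂ : State} {t₁ t₂ : ℕ} :
      0 < S.reg x → Exec p S S₁ t₁ → Exec (.whilePos x p) S₁ S₂ t₂ →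
      Exec (.whilePos x p) S S₂ (len (S.reg x) + t₁ + t₂)

end BitRAM

/-!
### Polynomials: bitsize, Taylor shift and dense (tensor) representation
-/

namespace TaylorShift

open MvPolynomial

/-- The bitsize of an integer, at least `1`. -/
def intBitsize (a : ℤ) : ℕ := max 1 a.natAbs.size

/-- The bitsize of an integer polynomial: the maximum of the bitsizes of its coefficients,
each with one bit for the sign; at least `1`. -/
noncomputable def polyBitsize {n : ℕ} (f : MvPolynomial (Fin n) ℤ) : ℕ :=
  max 1 (f.support.sup fun m => (coeff m f).natAbs.size + 1)

/-- The polynomial `f(x + u)`. -/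
noncomputable def shift {n : ℕ} (u : Fin n → ℤ) (f : MvPolynomial (Fin n) ℤ) :
    MvPolynomial (Fin n) ℤ :=
  aeval (fun k => X k + C (u k)) f

/-- The exponent vector in `{0, …, d}ⁿ` whose digits in base `d + 1` are the `n` lowest digits
of `i`, the exponent of the first variable being the lowest one. -/
noncomputable def exponent (n d i : ℕ) : Fin n →₀ ℕ :=
  Finsupp.equivFunOnFinite.symm fun k => i / (d + 1) ^ (k : ℕ) % (d + 1)

/-- The array that lists, one after the other, the coefficient tensors of size `(d + 1)ⁿ` of the
polynomials `f₀, …, f_{s-1}`; it is zero outside `{0, …, s (d + 1)ⁿ - 1}`. -/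
noncomputable def coeffArray {n s : ℕ} (d : ℕ) (f : Fin s → MvPolynomial (Fin n) ℤ) (i : ℤ) : ℤ :=
  if h : 0 ≤ i ∧ i.toNat / (d + 1) ^ n < s then
    coeff (exponent n d i.toNat) (f ⟨i.toNat / (d + 1) ^ n, h.2⟩)
  else 0

/-- The array that lists `u₀, …, u_{n-1}`; it is zero elsewhere. -/
def shiftArray {n : ℕ} (u : Fin n → ℤ) (i : ℤ) : ℤ :=
  if h : 0 ≤ i ∧ i.toNat < n then u ⟨i.toNat, h.2⟩ else 0

/-- The initial state: `s`, `n`, `d` in the first three registers, the coefficients in array `0`,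
the shifts in array `1`, and zero everywhere else. -/
noncomputable def inputState {n s : ℕ} (d : ℕ) (f : Fin s → MvPolynomial (Fin n) ℤ)
    (u : Fin n → ℤ) : BitRAM.State where
  reg
    | 0 => s
    | 1 => n
    | 2 => d
    | _ => 0
  arr
    | 0 => coeffArray d f
    | 1 => shiftArray u
    | _ => fun _ => 0

end TaylorShift

/-!
### Taylor shifts in quasi-linear time

Programs are built from expressions, blocks and loops; `Tri P S t Q` bounds their running time.
Integers are multiplied modulo `2 ^ 2 ^ l + 1` by the algorithm of Schönhage and Strassen, carried out
level by level (`mulP`). A univariate polynomial is shifted by divide and conquer after Kronecker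
substitution (`shiftP`), and `taylorShiftP` shifts along all lines of the coefficient tensors, one
variable after the other.
-/

/-! ### Lengths of integers -/

namespace BitRAM

/-! The shift by `u` is the composition of the shifts in the single variables. For one variable the
coefficient tensors fall into `s (d+1)^(n-1)` lines of `d+1` entries, and each line is a univariate
polynomial to be shifted by `u_k` (`coeff_shift_succ`, `partialShift_succ`). Such a shift lengthens
coefficients by `O((d+1)σ)` bits (`abs_taylor_le`), so all intermediate coefficients have `O(τ +
n(d+1)σ)` bits. If a line costs quasi-linear time in `(d+1)(τ + n(d+1)σ)`, then `n` rounds over at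
most `K n (d+1)^(n-1)` lines give the claimed bound.

A line is shifted through a single integer. If `g(x) = f(x+u)`, then `g(B) = f(B+u)`
(`partVal_taylor`). For `B = 2^(2^ω)` with `ω` large enough, the coefficients of `g` are balanced
digits in base `B`, and they can be read off from the integer `f(B+u)`. This integer is computed by
a binary tree that joins neighbouring blocks of coefficients with the powers `(B+u)^(2^t)`; a second
tree halves the result until the digits are isolated. All levels of a tree handle about the same
number of bits, so the cost is that of fast multiplication up to logarithms (`tri_shiftP`).

Multiplication (`tri_mulP`) follows Schönhage and Strassen. A residue modulo `2^(2^ℓ) + 1` is cut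
into `2^k` parts with `k` about `ℓ/2`; products become products of polynomials modulo `X^(2^k) + 1`,
whose coefficients are computed modulo `2^(2^l) + 1` with `l = ℓ - k + 2`. There the power `2^(2^l)`
of `2` is `-1`, so the Fourier transform needs additions and shifts only (`fft_dvd`,
`eval_modEq_of_dvd`, `bwd_modEq`). Programs have no procedure calls; hence all subproblems of one
recursion depth lie in one array and are treated together. Each depth multiplies the amount of data
by four and at least halves `ℓ - 3`, so the data stay below `2^n n^2` (`exists_width_add_level`).

Neither `τ` nor `σ` is an input: the program measures the data and chooses `ω` itself. Running times
are derived in a small program logic in which every block is charged a constant times one bound `b`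
for the lengths of all numbers that it touches. -/

theorem one_le_len (z : ℤ) : 1 ≤ len z := Nat.le_add_left _ _

theorem len_zero : len 0 = 1 := by simp [len]

theorem natAbs_lt_two_pow_len (z : ℤ) : z.natAbs < 2 ^ (len z - 1) := by
  simpa [len] using Nat.lt_size_self z.natAbs

theorem len_le_of_natAbs_lt {z : ℤ} {k : ℕ} (h : z.natAbs < 2 ^ k) : len z ≤ k + 1 := by
  have := Nat.size_le.2 h
  unfold len
  omega

theorem len_le_of_abs_lt {z : ℤ} {k : ℕ} (h : |z| < 2 ^ k) : len z ≤ k + 1 := by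
  apply len_le_of_natAbs_lt
  zify
  exact h

theorem len_le_of_abs_le {z : ℤ} {k : ℕ} (h : |z| ≤ 2 ^ k) : len z ≤ k + 2 :=
  len_le_of_abs_lt (h.trans_lt (by gcongr <;> omega))

theorem len_mono {x y : ℤ} (h : x.natAbs ≤ y.natAbs) : len x ≤ len y :=
  Nat.add_le_add_right (Nat.size_le_size h) 1

theorem len_natCast_mono {x y : ℕ} (h : x ≤ y) : len (x : ℤ) ≤ len (y : ℤ) :=
  len_mono (by simpa using h)

theorem len_neg (x : ℤ) : len (-x) = len x := by simp [len]

theorem len_natCast_le (n : ℕ) : len (n : ℤ) ≤ n + 1 :=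
  len_le_of_natAbs_lt (by simpa using Nat.lt_two_pow_self)

theorem len_add_le (x y : ℤ) : len (x + y) ≤ len x + len y := by
  have h1 := natAbs_lt_two_pow_len x
  have h2 := natAbs_lt_two_pow_len y
  have h3 := one_le_len x
  have h4 := one_le_len y
  have : (x + y).natAbs < 2 ^ (len x + len y - 1) := by
    have e1 : 2 ^ (len x - 1) ≤ 2 ^ (len x + len y - 2) := Nat.pow_le_pow_right (by simp) (by omega)
    have e2 : 2 ^ (len y - 1) ≤ 2 ^ (len x + len y - 2) := Nat.pow_le_pow_right (by simp) (by omega)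
    have e3 : 2 ^ (len x + len y - 1) = 2 ^ (len x + len y - 2) * 2 := by
      rw [← pow_succ]; congr 1; omega
    have := Int.natAbs_add_le x y
    omega
  have := len_le_of_natAbs_lt this
  omega

theorem len_sub_le (x y : ℤ) : len (x - y) ≤ len x + len y := by
  rw [sub_eq_add_neg, ← len_neg y]
  exact len_add_le _ _

theorem len_shl_le (x : ℤ) (k : ℕ) : len (x * 2 ^ k) ≤ len x + k := by
  have h1 := natAbs_lt_two_pow_len x
  have h3 := one_le_len x
  have : (x * 2 ^ k).natAbs < 2 ^ (len x - 1 + k) := by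
    rw [Int.natAbs_mul, pow_add, Int.natAbs_pow]
    exact Nat.mul_lt_mul_of_pos_right h1 (by positivity)
  have := len_le_of_natAbs_lt this
  omega

theorem len_shr_le (x : ℤ) (k : ℕ) : len (x / 2 ^ k) ≤ len x := by
  apply len_mono
  have h : (0 : ℤ) < 2 ^ k := by positivity
  rcases le_or_gt 0 x with hx | hx
  · have h1 := Int.ediv_le_self (2 ^ k) hx
    have h2 := Int.ediv_nonneg hx h.le
    omega
  · have h1 : x ≤ x / 2 ^ k := by
      rw [Int.le_ediv_iff_mul_le h]
      nlinarith
    have h2 := Int.ediv_lt_of_lt_mul h (show x < 0 * 2 ^ k by simpa using hx)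
    omega

/-! ### Expressions

An expression is evaluated by straight-line code that uses the registers from `100` on. -/

inductive Expr where
  | reg (x : ℕ)
  | const (c : ℤ)
  | add (a b : Expr)
  | sub (a b : Expr)
  | shl (a b : Expr)
  | shr (a b : Expr)
  | load (m : ℕ) (a : Expr)
  | ite (c a b : Expr)

namespace Expr

def eval (S : State) : Expr → ℤ
  | reg x => S.reg x
  | const c => c
  | add a b => a.eval S + b.eval S
  | sub a b => a.eval S - b.eval S
  | shl a b => a.eval S * 2 ^ (b.eval S).toNat
  | shr a b => a.eval S / 2 ^ (b.eval S).toNat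
  | load m a => S.arr m (a.eval S)
  | ite c a b => if 0 < c.eval S then a.eval S else b.eval S

def cost (S : State) : Expr → ℕ
  | reg x => len 0 + (len (S.reg x) + len 0)
  | const c => len c
  | add a b => a.cost S + (b.cost S + (len (a.eval S) + len (b.eval S)))
  | sub a b => a.cost S + (b.cost S + (len (a.eval S) + len (b.eval S)))
  | shl a b => a.cost S + (b.cost S + (len (a.eval S) + len (b.eval S) + (b.eval S).toNat))
  | shr a b => a.cost S + (b.cost S + (len (a.eval S) + len (b.eval S)))
  | load m a => a.cost S + (len (a.eval S) + len (S.arr m (a.eval S)))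
  | ite c a b => c.cost S + (len (c.eval S) + if 0 < c.eval S then a.cost S else b.cost S)

/-- Code that puts the value of an expression into register `t`. -/
def compile : Expr → ℕ → Prog
  -- The machine has no move instruction, so a register is copied by adding zero.
  | reg x, t => .seq (.const t 0) (.add t x t)
  | const c, t => .const t c
  | add a b, t => .seq (a.compile t) (.seq (b.compile (t + 1)) (.add t t (t + 1)))
  | sub a b, t => .seq (a.compile t) (.seq (b.compile (t + 1)) (.sub t t (t + 1)))
  | shl a b, t => .seq (a.compile t) (.seq (b.compile (t + 1)) (.shl t t (t + 1)))
  | shr a b, t => .seq (a.compile t) (.seq (b.compile (t + 1)) (.shr t t (t + 1)))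
  | load m a, t => .seq (a.compile t) (.load t m t)
  | ite c a b, t => .seq (c.compile t) (.ifPos t (a.compile t) (b.compile t))

/-- All registers of the expression are below `100`. -/
def ok : Expr → Bool
  | reg x => Nat.blt x 100
  | const _ => true
  | add a b => a.ok && b.ok
  | sub a b => a.ok && b.ok
  | shl a b => a.ok && b.ok
  | shr a b => a.ok && b.ok
  | load _ a => a.ok
  | ite c a b => c.ok && (a.ok && b.ok)

/-- The registers and cells that are read have at most `b` bits, and no shift to the left is by
more than `b`. -/
def Leaf (S : State) (b : ℕ) : Expr → Prop
  | reg x => len (S.reg x) ≤ b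
  | const _ => True
  | add x y => x.Leaf S b ∧ y.Leaf S b
  | sub x y => x.Leaf S b ∧ y.Leaf S b
  | shl x y => x.Leaf S b ∧ y.Leaf S b ∧ (y.eval S).toNat ≤ b
  | shr x y => x.Leaf S b ∧ y.Leaf S b
  | load m x => x.Leaf S b ∧ len (S.arr m (x.eval S)) ≤ b
  | ite c x y => c.Leaf S b ∧ (0 < c.eval S → x.Leaf S b) ∧ (¬ 0 < c.eval S → y.Leaf S b)

/-- Factor by which values may be longer than the leaves. -/
def growth : Expr → ℕ
  | reg _ => 1
  | const c => len c
  | add a b => a.growth + b.growth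
  | sub a b => a.growth + b.growth
  | shl a _ => a.growth + 1
  | shr a _ => a.growth
  | load _ _ => 1
  | ite _ a b => a.growth + b.growth

/-- Factor by which the cost may exceed the length of the leaves. -/
def weight : Expr → ℕ
  | reg _ => 3
  | const c => len c
  | add a b => a.weight + b.weight + a.growth + b.growth
  | sub a b => a.weight + b.weight + a.growth + b.growth
  | shl a b => a.weight + b.weight + a.growth + b.growth + 1
  | shr a b => a.weight + b.weight + a.growth + b.growth
  | load _ a => a.weight + a.growth + 1
  | ite c a b => c.weight + c.growth + a.weight + b.weight

/-- Lengths are subadditive and a left shift adds at most `b` bits, so an expression of fixed shape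
exceeds its leaves by a fixed factor. Together with `cost_le` this reduces the running time of
straight-line code to a single bound `b`. -/
theorem len_eval_le {S : State} {b : ℕ} (hb : 1 ≤ b) (e : Expr) (h : e.Leaf S b) :
    len (e.eval S) ≤ e.growth * b := by
  induction e with
  | reg x => simpa [growth, eval, Leaf] using h
  | const c => exact Nat.le_mul_of_pos_right _ hb
  | add x y hx hy =>
    have h1 := hx h.1
    have h2 := hy h.2
    have := len_add_le (x.eval S) (y.eval S)
    simp only [growth, eval, add_mul]
    omega
  | sub x y hx hy =>
    have h1 := hx h.1
    have h2 := hy h.2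
    have := len_sub_le (x.eval S) (y.eval S)
    simp only [growth, eval, add_mul]
    omega
  | shl x y hx hy =>
    have h1 := hx h.1
    have h3 := h.2.2
    have := len_shl_le (x.eval S) (y.eval S).toNat
    simp only [growth, eval, add_mul]
    omega
  | shr x y hx hy => exact (len_shr_le _ _).trans (hx h.1)
  | load m x hx => simpa [growth, eval] using h.2
  | ite c x y hc hx hy =>
    simp only [growth, eval, add_mul]
    split_ifs with h1
    · exact (hx (h.2.1 h1)).trans (Nat.le_add_right _ _)
    · exact (hy (h.2.2 h1)).trans (Nat.le_add_left _ _)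

theorem cost_le {S : State} {b : ℕ} (hb : 1 ≤ b) (e : Expr) (h : e.Leaf S b) :
    e.cost S ≤ e.weight * b := by
  induction e with
  | reg x =>
    have : len (S.reg x) ≤ b := h
    simp only [weight, cost, len_zero]
    omega
  | const c => exact Nat.le_mul_of_pos_right _ hb
  | add x y hx hy =>
    have h1 := hx h.1
    have h2 := hy h.2
    have h3 := len_eval_le hb x h.1
    have h4 := len_eval_le hb y h.2
    simp only [weight, cost, add_mul]
    omega
  | sub x y hx hy =>
    have h1 := hx h.1
    have h2 := hy h.2
    have h3 := len_eval_le hb x h.1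
    have h4 := len_eval_le hb y h.2
    simp only [weight, cost, add_mul]
    omega
  | shl x y hx hy =>
    have h1 := hx h.1
    have h2 := hy h.2.1
    have h3 := len_eval_le hb x h.1
    have h4 := len_eval_le hb y h.2.1
    have h5 := h.2.2
    simp only [weight, cost, add_mul]
    omega
  | shr x y hx hy =>
    have h1 := hx h.1
    have h2 := hy h.2
    have h3 := len_eval_le hb x h.1
    have h4 := len_eval_le hb y h.2
    simp only [weight, cost, add_mul]
    omega
  | load m x hx =>
    have h1 := hx h.1
    have h3 := len_eval_le hb x h.1
    have h5 := h.2
    simp only [weight, cost, add_mul]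
    omega
  | ite c x y hc hx hy =>
    have h1 := hc h.1
    have h2 := len_eval_le hb c h.1
    simp only [weight, cost, add_mul]
    split_ifs with h3
    · have := hx (h.2.1 h3)
      omega
    · have := hy (h.2.2 h3)
      omega

end Expr

/-! ### Agreement of states -/

/-- The machine state `M` agrees with `S` up to the registers from `100` on. -/
def Sim (M S : State) : Prop := (∀ r < 100, M.reg r = S.reg r) ∧ M.arr = S.arr

theorem Sim.refl (S : State) : Sim S S := ⟨fun _ _ => rfl, rfl⟩

@[simp] theorem State.setReg_reg (S : State) (r : ℕ) (v : ℤ) (x : ℕ) :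
    (S.setReg r v).reg x = if x = r then v else S.reg x := by
  simp [State.setReg, Function.update_apply]

@[simp] theorem State.setReg_arr (S : State) (r : ℕ) (v : ℤ) : (S.setReg r v).arr = S.arr := rfl

@[simp] theorem State.setCell_reg (S : State) (a : ℕ) (i v : ℤ) : (S.setCell a i v).reg = S.reg :=
  rfl

@[simp] theorem State.setCell_arr (S : State) (a : ℕ) (i v : ℤ) (b : ℕ) :
    (S.setCell a i v).arr b = if b = a then Function.update (S.arr a) i v else S.arr b := by
  simp only [State.setCell, Function.update_apply]

theorem Expr.congr {M S : State} (h : Sim M S) (e : Expr) (he : e.ok = true) :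
    e.eval M = e.eval S ∧ e.cost M = e.cost S := by
  induction e with
  | reg x =>
    have : M.reg x = S.reg x := h.1 x (by simpa [ok] using he)
    simp [eval, cost, this]
  | const c => simp [eval, cost]
  | add x y hx hy | sub x y hx hy | shl x y hx hy | shr x y hx hy =>
    simp only [ok, Bool.and_eq_true] at he
    simp only [eval, cost, hx he.1, hy he.2, and_self]
  | load m x hx => simp only [eval, cost, hx he, h.2, and_self]
  | ite c x y hc hx hy =>
    simp only [ok, Bool.and_eq_true] at he
    simp only [eval, cost, hc he.1, hx he.2.1, hy he.2.2, and_self]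

/-- The registers from `t` on serve as a stack: the second operand is computed in `t + 1`, which
leaves the first one in `t` intact. -/
theorem Expr.exec_compile (e : Expr) (he : e.ok = true) (t : ℕ) (ht : 100 ≤ t) (M : State) :
    ∃ M', Exec (e.compile t) M M' (e.cost M) ∧ M'.reg t = e.eval M ∧
      (∀ r < t, M'.reg r = M.reg r) ∧ M'.arr = M.arr := by
  have binary : ∀ x y : Expr,
      (∀ t, 100 ≤ t → ∀ M, ∃ M', Exec (x.compile t) M M' (x.cost M) ∧ M'.reg t = x.eval M ∧
        (∀ r < t, M'.reg r = M.reg r) ∧ M'.arr = M.arr) →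
      (∀ t, 100 ≤ t → ∀ M, ∃ M', Exec (y.compile t) M M' (y.cost M) ∧ M'.reg t = y.eval M ∧
        (∀ r < t, M'.reg r = M.reg r) ∧ M'.arr = M.arr) → y.ok = true →
      ∀ t, 100 ≤ t → ∀ M, ∃ M₁ M₂, Exec (x.compile t) M M₁ (x.cost M) ∧
        Exec (y.compile (t + 1)) M₁ M₂ (y.cost M) ∧ M₂.reg t = x.eval M ∧
        M₂.reg (t + 1) = y.eval M ∧ (∀ r < t, M₂.reg r = M.reg r) ∧ M₂.arr = M.arr := by
    intro x y hx hy hyo t ht M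
    obtain ⟨M₁, e1, v1, r1, a1⟩ := hx t ht M
    obtain ⟨M₂, e2, v2, r2, a2⟩ := hy (t + 1) (by omega) M₁
    have hc := y.congr (M := M₁) (S := M) ⟨fun r hr => r1 r (by omega), a1⟩ hyo
    refine ⟨M₁, M₂, e1, hc.2 ▸ e2, ?_, v2.trans hc.1, fun r hr => ?_, a2.trans a1⟩
    · rw [r2 t (by omega), v1]
    · rw [r2 r (by omega), r1 r hr]
  induction e generalizing t M with
  | reg x =>
    have hx : x < 100 := by simpa [ok] using he
    refine ⟨(M.setReg t 0).setReg t (M.reg x), .seq (.const M t 0) ?_, ?_, ?_, ?_⟩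
    · have h := Exec.add (M.setReg t 0) t x t
      simpa [show x ≠ t by omega] using h
    · simp [eval]
    · intro r hr
      simp [show r ≠ t by omega]
    · simp
  | const c =>
    refine ⟨_, .const M t c, ?_, ?_, ?_⟩
    · simp [eval]
    · intro r hr
      simp [show r ≠ t by omega]
    · simp
  | add x y hx hy =>
    simp only [ok, Bool.and_eq_true] at he
    obtain ⟨M₁, M₂, e1, e2, v1, v2, r2, a2⟩ := binary x y (hx he.1) (hy he.2) he.2 t ht M
    have := Exec.add M₂ t t (t + 1)
    rw [v1, v2] at this
    refine ⟨_, .seq e1 (.seq e2 this), by simp [eval], fun r hr => ?_, by simpa using a2⟩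
    rw [← r2 r hr]
    simp [show r ≠ t by omega]
  | sub x y hx hy =>
    simp only [ok, Bool.and_eq_true] at he
    obtain ⟨M₁, M₂, e1, e2, v1, v2, r2, a2⟩ := binary x y (hx he.1) (hy he.2) he.2 t ht M
    have := Exec.sub M₂ t t (t + 1)
    rw [v1, v2] at this
    refine ⟨_, .seq e1 (.seq e2 this), by simp [eval], fun r hr => ?_, by simpa using a2⟩
    rw [← r2 r hr]
    simp [show r ≠ t by omega]
  | shl x y hx hy =>
    simp only [ok, Bool.and_eq_true] at he
    obtain ⟨M₁, M₂, e1, e2, v1, v2, r2, a2⟩ := binary x y (hx he.1) (hy he.2) he.2 t ht M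
    have := Exec.shl M₂ t t (t + 1)
    rw [v1, v2] at this
    refine ⟨_, .seq e1 (.seq e2 this), by simp [eval], fun r hr => ?_, by simpa using a2⟩
    rw [← r2 r hr]
    simp [show r ≠ t by omega]
  | shr x y hx hy =>
    simp only [ok, Bool.and_eq_true] at he
    obtain ⟨M₁, M₂, e1, e2, v1, v2, r2, a2⟩ := binary x y (hx he.1) (hy he.2) he.2 t ht M
    have := Exec.shr M₂ t t (t + 1)
    rw [v1, v2] at this
    refine ⟨_, .seq e1 (.seq e2 this), by simp [eval], fun r hr => ?_, by simpa using a2⟩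
    rw [← r2 r hr]
    simp [show r ≠ t by omega]
  | load m x hx =>
    obtain ⟨M₁, e1, v1, r1, a1⟩ := hx he t ht M
    have := Exec.load M₁ t m t
    rw [v1, a1] at this
    refine ⟨_, .seq e1 this, by simp [eval], fun r hr => ?_, by simpa using a1⟩
    rw [← r1 r hr]
    simp [show r ≠ t by omega]
  | ite c x y hc hx hy =>
    simp only [ok, Bool.and_eq_true] at he
    obtain ⟨M₁, e1, v1, r1, a1⟩ := hc he.1 t ht M
    have hs : Sim M₁ M := ⟨fun r hr => r1 r (by omega), a1⟩
    by_cases h : 0 < c.eval M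
    · obtain ⟨M₂, e2, v2, r2, a2⟩ := hx he.2.1 t ht M₁
      have hxc := x.congr hs he.2.1
      have := Exec.ifPos_true (q := y.compile t) (v1 ▸ h) e2
      rw [v1, hxc.2] at this
      refine ⟨M₂, ?_, ?_, fun r hr => (r2 r hr).trans (r1 r hr), a2.trans a1⟩
      · simpa [cost, compile, h] using Exec.seq e1 this
      · simp [eval, h, v2, hxc.1]
    · obtain ⟨M₂, e2, v2, r2, a2⟩ := hy he.2.2 t ht M₁
      have hyc := y.congr hs he.2.2
      have := Exec.ifPos_false (p := x.compile t) (v1 ▸ h) e2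
      rw [v1, hyc.2] at this
      refine ⟨M₂, ?_, ?_, fun r hr => (r2 r hr).trans (r1 r hr), a2.trans a1⟩
      · simpa [cost, compile, h] using Exec.seq e1 this
      · simp [eval, h, v2, hyc.1]

/-! ### Registers and arrays that a program may change -/

namespace Prog

/-- Purely syntactic and Boolean, so that for a concrete program the frame conditions are settled by
computation. -/
def writes : Prog → ℕ → Bool
  | const r _, x => x == r
  | add r _ _, x => x == r
  | sub r _ _, x => x == r
  | shl r _ _, x => x == r
  | shr r _ _, x => x == r
  | load r _ _, x => x == r
  | store _ _ _, _ => false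
  | seq p q, x => p.writes x || q.writes x
  | ifPos _ p q, x => p.writes x || q.writes x
  | whilePos _ p, x => p.writes x

def arrWrites : Prog → ℕ → Bool
  | store a _ _, x => x == a
  | seq p q, x => p.arrWrites x || q.arrWrites x
  | ifPos _ p q, x => p.arrWrites x || q.arrWrites x
  | whilePos _ p, x => p.arrWrites x
  | _, _ => false

end Prog

theorem Exec.reg_eq {P : Prog} {S S' : State} {t : ℕ} (h : Exec P S S' t) {r : ℕ}
    (hr : P.writes r = false) : S'.reg r = S.reg r := by
  induction h <;> simp_all [Prog.writes]

theorem Exec.arr_eq {P : Prog} {S S' : State} {t : ℕ} (h : Exec P S S' t) {a : ℕ}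
    (ha : P.arrWrites a = false) : S'.arr a = S.arr a := by
  induction h <;> simp_all [Prog.arrWrites]

/-- `S'` differs from `S` at most in what `P` may change. -/
structure Keep (P : Prog) (S S' : State) : Prop where
  reg : ∀ r < 100, P.writes r = false → S'.reg r = S.reg r
  arr : ∀ a, P.arrWrites a = false → S'.arr a = S.arr a

/-! ### Program logic -/

/-- Started in `S`, the program halts within `t` bit operations in a state that satisfies `Q`; the
registers from `100` on are ignored. -/
def Tri (P : Prog) (S : State) (t : ℕ) (Q : State → Prop) : Prop :=
  ∀ M, Sim M S → ∃ M' S' t', Exec P M M' t' ∧ t' ≤ t ∧ Sim M' S' ∧ Q S'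

theorem Tri.mono {P : Prog} {S : State} {t t' : ℕ} {Q Q' : State → Prop} (h : Tri P S t Q)
    (ht : t ≤ t') (hQ : ∀ S', Q S' → Q' S') : Tri P S t' Q' := by
  intro M hM
  obtain ⟨M', S', s, h1, h2, h3, h4⟩ := h M hM
  exact ⟨M', S', s, h1, h2.trans ht, h3, hQ _ h4⟩

/-- What is not written is unchanged, and this comes for free with every specification.
Postconditions therefore need only speak of results. -/
theorem Tri.keep {P : Prog} {S : State} {t : ℕ} {Q : State → Prop} (h : Tri P S t Q) :
    Tri P S t (fun S' => Q S' ∧ Keep P S S') := by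
  intro M hM
  obtain ⟨M', S', s, h1, h2, h3, h4⟩ := h M hM
  refine ⟨M', S', s, h1, h2, h3, h4, fun r hr hw => ?_, fun a ha => ?_⟩
  · rw [← h3.1 r hr, h1.reg_eq hw, hM.1 r hr]
  · rw [← h3.2, h1.arr_eq ha, hM.2]

theorem Tri.post {P : Prog} {S : State} {t t' : ℕ} {Q Q' : State → Prop} (h : Tri P S t Q)
    (ht : t ≤ t') (hQ : ∀ S', Keep P S S' → Q S' → Q' S') : Tri P S t' Q' :=
  h.keep.mono ht fun S' h => hQ S' h.2 h.1

theorem Tri.seq {p q : Prog} {S : State} {t₁ t₂ : ℕ} {Q₁ Q : State → Prop} (hp : Tri p S t₁ Q₁)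
    (hq : ∀ S', Keep p S S' → Q₁ S' → Tri q S' t₂ Q) : Tri (.seq p q) S (t₁ + t₂) Q := by
  intro M hM
  obtain ⟨M₁, S₁, s₁, h1, h2, h3, h4⟩ := hp.keep M hM
  obtain ⟨M₂, S₂, s₂, g1, g2, g3, g4⟩ := hq S₁ h4.2 h4.1 M₁ h3
  exact ⟨M₂, S₂, _, .seq h1 g1, by omega, g3, g4⟩

/-- Register `101` is set to zero in order to move the value from `100` to `r`. -/
def assign (r : ℕ) (e : Expr) : Prog :=
  .seq (e.compile 100) (.seq (.const 101 0) (.add r 100 101))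

def storeE (a : ℕ) (i e : Expr) : Prog :=
  .seq (i.compile 100) (.seq (e.compile 101) (.store a 100 101))

def ifE (e : Expr) (p q : Prog) : Prog := .seq (e.compile 100) (.ifPos 100 p q)

def whileE (e : Expr) (p : Prog) : Prog :=
  .seq (e.compile 100) (.whilePos 100 (.seq p (e.compile 100)))

theorem Tri.assign_eq {r : ℕ} {e : Expr} {S : State} (he : e.ok = true) :
    Tri (assign r e) S (e.cost S + len (e.eval S) + 2) (fun S' => S' = S.setReg r (e.eval S)) := by
  intro M hM
  obtain ⟨M₁, e1, v1, r1, a1⟩ := e.exec_compile he 100 le_rfl M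
  have hc := e.congr hM he
  have e3 := Exec.add (M₁.setReg 101 0) r 100 101
  refine ⟨_, _, _, .seq e1 (.seq (.const M₁ 101 0) e3), ?_, ⟨fun x hx => ?_, ?_⟩, rfl⟩
  · simp [v1, hc.1, hc.2, len_zero]
    omega
  · by_cases h : x = r
    · simp [h, v1, hc.1]
    · simp [h, show x ≠ 101 by omega, r1 x hx, hM.1 x hx]
  · simp [a1, hM.2]

theorem Tri.assign {r : ℕ} {e : Expr} {S : State} {b t : ℕ} {Q : State → Prop} (hb : 1 ≤ b)
    (hl : e.Leaf S b) (ht : (e.weight + e.growth + 2) * b ≤ t) (hQ : Q (S.setReg r (e.eval S)))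
    (he : e.ok = true := by rfl) :
    Tri (assign r e) S t Q := by
  refine (Tri.assign_eq he).mono ?_ (fun S' h => h ▸ hQ)
  have h1 := e.cost_le hb hl
  have h2 := e.len_eval_le hb hl
  refine le_trans ?_ ht
  rw [add_mul, add_mul]
  omega

theorem Tri.storeE {a : ℕ} {i e : Expr} {S : State} {b t : ℕ} {Q : State → Prop} (hb : 1 ≤ b)
    (hi : i.Leaf S b) (hl : e.Leaf S b)
    (ht : (i.weight + i.growth + (e.weight + e.growth)) * b ≤ t)
    (hQ : Q (S.setCell a (i.eval S) (e.eval S)))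
    (hio : i.ok = true := by rfl) (he : e.ok = true := by rfl) :
    Tri (storeE a i e) S t Q := by
  intro M hM
  obtain ⟨M₁, e1, v1, r1, a1⟩ := i.exec_compile hio 100 le_rfl M
  obtain ⟨M₂, e2, v2, r2, a2⟩ := e.exec_compile he 101 (by omega) M₁
  have hs : Sim M₁ S := ⟨fun r hr => (r1 r hr).trans (hM.1 r hr), a1.trans hM.2⟩
  have hc := i.congr hM hio
  have hd := e.congr hs he
  have e3 := Exec.store M₂ a 100 101
  rw [r2 100 (by omega), v1, v2, hc.1, hd.1] at e3
  have h1 := i.cost_le hb hi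
  have h2 := i.len_eval_le hb hi
  have h3 := e.cost_le hb hl
  have h4 := e.len_eval_le hb hl
  refine ⟨_, _, _, .seq e1 (.seq e2 e3), ?_, ⟨fun x hx => ?_, ?_⟩, hQ⟩
  · refine le_trans ?_ ht
    rw [hc.2, hd.2]
    simp only [add_mul]
    omega
  · simp [r2 x (by omega), r1 x hx, hM.1 x hx]
  · simp [State.setCell, a2, a1, hM.2]

theorem Tri.ifE {e : Expr} {p q : Prog} {S : State} {b t : ℕ} {Q : State → Prop} (hb : 1 ≤ b)
    (hl : e.Leaf S b) (hp : 0 < e.eval S → Tri p S t Q) (hq : ¬ 0 < e.eval S → Tri q S t Q)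
    (he : e.ok = true := by rfl) :
    Tri (ifE e p q) S ((e.weight + e.growth) * b + t) Q := by
  intro M hM
  obtain ⟨M₁, e1, v1, r1, a1⟩ := e.exec_compile he 100 le_rfl M
  have hs : Sim M₁ S := ⟨fun r hr => (r1 r hr).trans (hM.1 r hr), a1.trans hM.2⟩
  have hc := e.congr hM he
  have h1 := e.cost_le hb hl
  have h2 := e.len_eval_le hb hl
  rw [add_mul]
  by_cases h : 0 < e.eval S
  · obtain ⟨M₂, S₂, s, g1, g2, g3, g4⟩ := hp h M₁ hs
    refine ⟨M₂, S₂, _, .seq e1 (.ifPos_true (by rw [v1, hc.1]; exact h) g1), ?_, g3, g4⟩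
    rw [hc.2, v1, hc.1]
    omega
  · obtain ⟨M₂, S₂, s, g1, g2, g3, g4⟩ := hq h M₁ hs
    refine ⟨M₂, S₂, _, .seq e1 (.ifPos_false (by rw [v1, hc.1]; exact h) g1), ?_, g3, g4⟩
    rw [hc.2, v1, hc.1]
    omega

theorem Tri.whileE {e : Expr} {p : Prog} {S : State} (Inv : ℕ → State → Prop) (N : ℕ) {b t : ℕ}
    (hb : 1 ≤ b) (h0 : Inv 0 S)
    (hstep : ∀ j < N, ∀ S', Inv j S' → e.Leaf S' b ∧ 0 < e.eval S' ∧ Tri p S' t (Inv (j + 1)))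
    (hend : ∀ S', Inv N S' → e.Leaf S' b ∧ ¬ 0 < e.eval S') (he : e.ok = true := by rfl) :
    Tri (whileE e p) S ((N + 1) * ((e.weight + e.growth) * b + t)) (Inv N) := by
  intro M hM
  obtain ⟨M₁, e1, v1, r1, a1⟩ := e.exec_compile he 100 le_rfl M
  have hs : Sim M₁ S := ⟨fun r hr => (r1 r hr).trans (hM.1 r hr), a1.trans hM.2⟩
  have hc := e.congr hM he
  -- Induction on the number `m` of remaining iterations. The test register `100` already holds the
  -- value of `e`; computing it anew belongs to the end of the preceding body.
  have key : ∀ m j, j + m = N → ∀ M₁ S₁, Sim M₁ S₁ → Inv j S₁ → M₁.reg 100 = e.eval S₁ →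
      ∃ M' S' t', Exec (.whilePos 100 (.seq p (e.compile 100))) M₁ M' t' ∧
        t' ≤ m * ((e.weight + e.growth) * b + t) + e.growth * b ∧ Sim M' S' ∧ Inv N S' := by
    intro m
    induction m with
    | zero =>
      intro j hj M₁ S₁ hs hI hv
      obtain rfl : j = N := hj
      obtain ⟨hl, hn⟩ := hend S₁ hI
      refine ⟨M₁, S₁, _, .whilePos_done (by rwa [hv]), ?_, hs, hI⟩
      rw [hv]
      have := e.len_eval_le hb hl
      omega
    | succ m ih =>
      intro j hj M₁ S₁ hs hI hv
      obtain ⟨hl, hn, hp⟩ := hstep j (by omega) S₁ hI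
      obtain ⟨M₂, S₂, s₂, g1, g2, g3, g4⟩ := hp M₁ hs
      obtain ⟨M₃, e3, v3, r3, a3⟩ := e.exec_compile he 100 le_rfl M₂
      have hs3 : Sim M₃ S₂ := ⟨fun r hr => (r3 r hr).trans (g3.1 r hr), a3.trans g3.2⟩
      have hc3 := e.congr g3 he
      obtain ⟨M₄, S₄, s₄, k1, k2, k3, k4⟩ := ih (j + 1) (by omega) M₃ S₂ hs3 g4 (v3.trans hc3.1)
      refine ⟨M₄, S₄, _, .whilePos_loop (by rwa [hv]) (.seq g1 e3) k1, ?_, k3, k4⟩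
      have hl2 : e.Leaf S₂ b := by
        rcases Nat.lt_or_ge (j + 1) N with h | h
        · exact (hstep _ h S₂ g4).1
        · obtain rfl : N = j + 1 := by omega
          exact (hend _ g4).1
      have h1 := e.len_eval_le hb hl
      have h2 := e.cost_le hb hl2
      rw [hv, hc3.2]
      simp only [add_mul, one_mul, mul_add] at *
      omega
  obtain ⟨M', S', s, k1, k2, k3, k4⟩ := key N 0 (by omega) M₁ S hs h0 (v1.trans hc.1)
  refine ⟨M', S', _, .seq e1 k1, ?_, k3, k4⟩
  have hl : e.Leaf S b := by
    rcases Nat.eq_zero_or_pos N with h | h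
    · subst h
      exact (hend _ h0).1
    · exact (hstep _ h S h0).1
  have h2 := e.cost_le hb hl
  rw [hc.2]
  simp only [add_mul, one_mul, mul_add] at *
  omega

/-- `for i = 0, …, n - 1 do p`; the number `n` is in a register. -/
def forLoop (i n : ℕ) (p : Prog) : Prog :=
  .seq (assign i (.const 0))
    (whileE (.sub (.reg n) (.reg i)) (.seq p (assign i (.add (.reg i) (.const 1)))))

theorem Keep.trans {P : Prog} {S S₁ S₂ : State} (h : Keep P S S₁) (h' : Keep P S₁ S₂) :
    Keep P S S₂ :=
  ⟨fun r hr hw => (h'.reg r hr hw).trans (h.reg r hr hw), fun a ha => (h'.arr a ha).trans (h.arr a ha)⟩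

/-- The invariant is carried along with the value of the counter and with the frame relative to the
state before the loop. The body may thus rely on anything that the loop does not write without
listing it in `Inv`. -/
theorem Tri.forLoop {i n : ℕ} {p : Prog} {S : State} {N t : ℕ} (hn : S.reg n = N)
    (Inv : ℕ → State → Prop) (h0 : Inv 0 (S.setReg i 0))
    (hstep : ∀ j < N, ∀ S', S'.reg i = (j : ℤ) → Keep (forLoop i n p) S S' → Inv j S' →
      Tri p S' t (fun S'' => Inv (j + 1) (S''.setReg i ((j : ℤ) + 1))))
    (hi : i < 100 := by decide) (hn' : n < 100 := by decide) (hni : n ≠ i := by decide)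
    (hpi : p.writes i = false := by rfl) (hpn : p.writes n = false := by rfl) :
    Tri (forLoop i n p) S ((N + 1) * (t + 40 * len (N : ℤ)))
      (fun S' => Inv N S' ∧ S'.reg i = (N : ℤ)) := by
  have hL := one_le_len (N : ℤ)
  have l1 : len 1 = 2 := by decide
  have hwn : (BitRAM.forLoop i n p).writes n = false := by
    simp [BitRAM.forLoop, BitRAM.assign, BitRAM.whileE, Expr.compile, Prog.writes, hpn, hni]
    omega
  have h1 : Tri (BitRAM.assign i (.const 0)) S (10 * len (N : ℤ)) (fun S' => S' = S.setReg i 0) := by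
    refine Tri.assign hL trivial ?_ rfl
    simp [Expr.weight, Expr.growth, len_zero]
    omega
  have e1 : (N + 1) * (t + 40 * len (N : ℤ)) =
      10 * len (N : ℤ) + ((N + 1) * (t + 40 * len (N : ℤ)) - 10 * len (N : ℤ)) := by
    have : 1 * (40 * len (N : ℤ)) ≤ (N + 1) * (t + 40 * len (N : ℤ)) := by gcongr <;> omega
    omega
  rw [e1]
  refine h1.seq fun S₁ _ hS₁ => ?_
  subst hS₁
  have hk0 : Keep (BitRAM.forLoop i n p) S (S.setReg i 0) := by
    refine ⟨fun r hr hw => ?_, fun a ha => rfl⟩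
    have : r ≠ i := by
      rintro rfl
      simp [BitRAM.forLoop, BitRAM.assign, BitRAM.whileE, Expr.compile, Prog.writes] at hw
    simp [this]
  have h2 := Tri.whileE (e := .sub (.reg n) (.reg i))
    (p := .seq p (BitRAM.assign i (.add (.reg i) (.const 1)))) (S := S.setReg i 0)
    (fun j S' => Inv j S' ∧ S'.reg i = (j : ℤ) ∧ Keep (BitRAM.forLoop i n p) S S') N (b := len (N : ℤ))
    (t := t + 15 * len (N : ℤ)) hL
    ⟨h0, by simp, hk0⟩
    (by
      rintro j hj S' ⟨hI, hij, hk⟩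
      have hSn : S'.reg n = N := (hk.reg n hn' hwn).trans hn
      have hjN : len (j : ℤ) ≤ len (N : ℤ) := len_natCast_mono hj.le
      refine ⟨?_, ?_, ?_⟩
      · simp [Expr.Leaf, hSn, hij, hjN]
      · simp [Expr.eval, hSn, hij, hj]
      · refine (hstep j hj S' hij hk hI).seq fun S'' hk' hI' => ?_
        have hi2 : S''.reg i = j := (hk'.reg i hi hpi).trans hij
        refine Tri.assign hL ?_ ?_ ?_ (by simpa [Expr.ok] using hi)
        · simp [Expr.Leaf, hi2, hjN]
        · simp [Expr.weight, Expr.growth, l1]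
          omega
        · refine ⟨by simpa [Expr.eval, hi2] using hI', by simp [Expr.eval, hi2], ?_⟩
          refine hk.trans ⟨fun r hr hw => ?_, fun a ha => ?_⟩
          · simp [BitRAM.forLoop, BitRAM.assign, BitRAM.whileE, Expr.compile, Prog.writes] at hw
            simp only [State.setReg_reg, show r ≠ i by tauto, if_false]
            exact hk'.reg r hr (by tauto)
          · simp [BitRAM.forLoop, BitRAM.assign, BitRAM.whileE, Expr.compile, Prog.arrWrites] at ha
            simp only [State.setReg_arr]
            exact hk'.arr a ha)
    (by
      rintro S' ⟨hI, hij, hk⟩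
      have hSn : S'.reg n = N := (hk.reg n hn' hwn).trans hn
      simp [Expr.Leaf, Expr.eval, hSn, hij])
    (by simp [Expr.ok, hi, hn'])
  refine h2.mono ?_ (fun S' h => ⟨h.1, h.2.1⟩)
  simp [Expr.weight, Expr.growth]
  have : (N + 1) * (t + 40 * len (N : ℤ)) =
    (N + 1) * (10 * len (N : ℤ) + (t + 15 * len (N : ℤ))) + (N + 1) * (15 * len (N : ℤ)) := by ring
  have h3 : 1 * (15 * len (N : ℤ)) ≤ (N + 1) * (15 * len (N : ℤ)) := by gcongr; omega
  omega

end BitRAM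

/-! ### Balanced division with remainder by a power of two, and reduction modulo `2 ^ L + 1` -/

namespace SSA

open Polynomial

/-- Nearest integer to `x / 2 ^ e`. -/
def hi (e : ℕ) (x : ℤ) : ℤ := (x + 2 ^ (e - 1)) / 2 ^ e

/-- Balanced remainder of `x` modulo `2 ^ e`. -/
def lo (e : ℕ) (x : ℤ) : ℤ := x - hi e x * 2 ^ e

theorem lo_add_hi (e : ℕ) (x : ℤ) : lo e x + hi e x * 2 ^ e = x := by simp [lo]

theorem lo_mem {e : ℕ} (he : 1 ≤ e) (x : ℤ) : -2 ^ (e - 1) ≤ lo e x ∧ lo e x < 2 ^ (e - 1) := by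
  have h2 : (2 : ℤ) ^ e = 2 * 2 ^ (e - 1) := by rw [← pow_succ']; congr 1; omega
  have hpos : (0 : ℤ) < 2 ^ e := by positivity
  have h := Int.emod_add_mul_ediv (x + 2 ^ (e - 1)) (2 ^ e)
  have h3 := Int.emod_nonneg (x + 2 ^ (e - 1)) hpos.ne'
  have h4 := Int.emod_lt_of_pos (x + 2 ^ (e - 1)) hpos
  have : lo e x = (x + 2 ^ (e - 1)) % 2 ^ e - 2 ^ (e - 1) := by
    unfold lo hi
    linarith [mul_comm ((x + 2 ^ (e - 1)) / 2 ^ e) (2 ^ e)]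
  constructor <;> linarith

theorem abs_lo_le {e : ℕ} (he : 1 ≤ e) (x : ℤ) : |lo e x| ≤ 2 ^ (e - 1) :=
  abs_le.2 ⟨(lo_mem he x).1, (lo_mem he x).2.le⟩

/-- Rounding to the nearest integer moves `x / 2 ^ e` by at most one half, so an integral bound `A`
is not exceeded. This keeps the parts of a number balanced however often it is halved. -/
theorem abs_hi_le {e : ℕ} (he : 1 ≤ e) {x A : ℤ} (h : |x| ≤ A * 2 ^ e) : |hi e x| ≤ A := by
  have h2 : (2 : ℤ) ^ e = 2 * 2 ^ (e - 1) := by rw [← pow_succ']; congr 1; omega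
  have hpos : (0 : ℤ) < 2 ^ (e - 1) := by positivity
  have h1 := lo_add_hi e x
  have h3 := lo_mem he x
  obtain ⟨h4, h5⟩ := abs_le.1 h
  rw [h2] at *
  refine abs_le.2 ⟨?_, ?_⟩
  · by_contra! hc
    nlinarith
  · by_contra! hc
    nlinarith

/-- A split into parts is balanced as soon as the lower part is small. -/
theorem hi_add_mul {e : ℕ} (he : 1 ≤ e) {a : ℤ} (b : ℤ) (h1 : |a| < 2 ^ (e - 1)) :
    hi e (a + b * 2 ^ e) = b := by
  have h2 : (2 : ℤ) ^ e = 2 * 2 ^ (e - 1) := by rw [← pow_succ']; congr 1; omega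
  obtain ⟨h3, h4⟩ := abs_lt.1 h1
  have hpos : (0 : ℤ) < 2 ^ e := by positivity
  unfold hi
  rw [show a + b * 2 ^ e + 2 ^ (e - 1) = (a + 2 ^ (e - 1)) + b * 2 ^ e by ring,
    Int.add_mul_ediv_right _ _ hpos.ne', Int.ediv_eq_zero_of_lt (by linarith) (by linarith), zero_add]

/-- Modulo `2 ^ L + 1` the factor `2 ^ L` of the upper part is `-1`. -/
def redStep (L : ℕ) (x : ℤ) : ℤ := lo L x - hi L x

def red (L : ℕ) (x : ℤ) : ℤ := (redStep L)^[6] x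

theorem redStep_modEq (L : ℕ) (x : ℤ) : redStep L x ≡ x [ZMOD 2 ^ L + 1] := by
  rw [Int.modEq_iff_dvd]
  exact ⟨hi L x, by rw [redStep, lo]; ring⟩

theorem red_modEq (L : ℕ) (x : ℤ) : red L x ≡ x [ZMOD 2 ^ L + 1] := by
  have : ∀ n, (redStep L)^[n] x ≡ x [ZMOD 2 ^ L + 1] := by
    intro n
    induction n with
    | zero => rfl
    | succ n ih =>
      rw [Function.iterate_succ_apply']
      exact (redStep_modEq L _).trans ih
  exact this 6

theorem abs_redStep_le {L : ℕ} (hL : 1 ≤ L) {x A : ℤ} (h : |x| ≤ A * 2 ^ L) :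
    |redStep L x| ≤ A + 2 ^ (L - 1) := by
  have h1 := abs_hi_le hL h
  have h2 := abs_lo_le hL x
  have := abs_sub (lo L x) (hi L x)
  unfold redStep
  linarith

/-- Each step removes about `L` bits. With `Q = 2 ^ L` and `P = 2 ^ (L - 1)` the successive bounds
are `Q^5`, `Q^4 + P`, `Q^3 + 1 + P`, `Q^2 + 1 + P`, `Q + 1 + P`, `2 + P`, `1 + P`; the last one is
stable, which explains the six steps of `red`. The bound for all iterates is needed for the running
time. -/
theorem abs_iterate_redStep_le {L : ℕ} (hL : 2 ≤ L) {x : ℤ} (h : |x| ≤ 2 ^ (5 * L)) :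
    (∀ n, |(redStep L)^[n] x| ≤ 2 ^ (5 * L)) ∧ |red L x| ≤ 2 ^ (L - 1) + 1 := by
  have hL1 : 1 ≤ L := by omega
  have h2 : (2 : ℤ) ^ L = 2 * 2 ^ (L - 1) := by rw [← pow_succ']; congr 1; omega
  have hP : (2 : ℤ) ≤ 2 ^ (L - 1) := by
    calc (2 : ℤ) = 2 ^ 1 := by norm_num
      _ ≤ _ := by gcongr <;> omega
  have e5 : (2 : ℤ) ^ (5 * L) = (2 ^ L) ^ 5 := by rw [← pow_mul, mul_comm]
  rw [e5] at h ⊢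
  set P : ℤ := 2 ^ (L - 1)
  set Q : ℤ := 2 ^ L
  have hQ : 4 ≤ Q := by linarith
  have q2 : 4 * Q ≤ Q ^ 2 := by nlinarith
  have q3 : 4 * Q ^ 2 ≤ Q ^ 3 := by nlinarith [pow_nonneg (by linarith : 0 ≤ Q) 2]
  have q4 : 4 * Q ^ 3 ≤ Q ^ 4 := by nlinarith [pow_nonneg (by linarith : 0 ≤ Q) 3]
  have q5 : 4 * Q ^ 4 ≤ Q ^ 5 := by nlinarith [pow_nonneg (by linarith : 0 ≤ Q) 4]
  have s1 := abs_redStep_le hL1 (x := x) (A := Q ^ 4) (by linarith [show Q ^ 4 * Q = Q ^ 5 by ring])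
  have s2 := abs_redStep_le hL1 (x := redStep L x) (A := Q ^ 3 + 1)
    (by linarith [show (Q ^ 3 + 1) * Q = Q ^ 4 + Q by ring])
  have s3 := abs_redStep_le hL1 (x := redStep L (redStep L x)) (A := Q ^ 2 + 1)
    (by linarith [show (Q ^ 2 + 1) * Q = Q ^ 3 + Q by ring])
  have s4 := abs_redStep_le hL1 (x := redStep L (redStep L (redStep L x))) (A := Q + 1)
    (by linarith [show (Q + 1) * Q = Q ^ 2 + Q by ring])
  have s5 := abs_redStep_le hL1 (x := redStep L (redStep L (redStep L (redStep L x)))) (A := 2)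
    (by linarith)
  have s6 : ∀ y, |y| ≤ 2 + P → |redStep L y| ≤ 1 + P := fun y hy =>
    abs_redStep_le hL1 (x := y) (A := 1) (by linarith)
  have s7 : |red L x| ≤ 1 + P := s6 _ s5
  refine ⟨fun n => ?_, by linarith⟩
  match n with
  | 0 => exact h
  | 1 => exact s1.trans (by linarith)
  | 2 => exact s2.trans (by linarith)
  | 3 => exact s3.trans (by linarith)
  | 4 => exact s4.trans (by linarith)
  | 5 => exact s5.trans (by linarith)
  | n + 6 =>
    suffices ∀ n, |(redStep L)^[n + 6] x| ≤ 1 + P from (this n).trans (by linarith)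
    intro n
    induction n with
    | zero => exact s7
    | succ n ih =>
      rw [show n + 1 + 6 = (n + 6) + 1 by ring, Function.iterate_succ_apply']
      exact s6 _ (by linarith)

theorem abs_red_le {L : ℕ} (hL : 2 ≤ L) {x : ℤ} (h : |x| ≤ 2 ^ (5 * L)) :
    |red L x| ≤ 2 ^ (L - 1) + 1 := (abs_iterate_redStep_le hL h).2

/-- Small integers are determined by their residues. -/
theorem eq_of_modEq_of_abs_lt {N x y : ℤ} (h : x ≡ y [ZMOD N]) (hlt : |x| + |y| < N) : x = y := by
  have h1 := (Int.modEq_iff_dvd.1 h)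
  have h2 : |y - x| < N := (abs_sub y x).trans_lt (by linarith)
  linarith [Int.eq_zero_of_abs_lt_dvd h1 h2]

/-! ### Polynomials from arrays in bit-reversed order -/

section Pol

variable {R : Type*} [CommRing R]

/-- The polynomial whose `2 ^ j` coefficients are the values of `y` in bit-reversed order. -/
noncomputable def pol : ℕ → (ℕ → R) → R[X]
  | 0, y => C (y 0)
  | j + 1, y => pol j (fun h => y (2 * h)) + X ^ 2 ^ j * pol j (fun h => y (2 * h + 1))

theorem pol_congr {j : ℕ} {y z : ℕ → R} (h : ∀ i < 2 ^ j, y i = z i) : pol j y = pol j z := by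
  induction j generalizing y z with
  | zero => simp [pol, h 0]
  | succ j ih =>
    rw [pow_succ] at h
    have h0 : pol j (fun i => y (2 * i)) = pol j (fun i => z (2 * i)) :=
      ih fun i hi => h _ (by omega)
    have h1 : pol j (fun i => y (2 * i + 1)) = pol j (fun i => z (2 * i + 1)) :=
      ih fun i hi => h _ (by omega)
    rw [pol, pol, h0, h1]

theorem pol_linear (j : ℕ) (y z : ℕ → R) (v w : R) :
    pol j (fun i => y i * v + z i * w) = pol j y * C v + pol j z * C w := by
  induction j generalizing y z with
  | zero => simp [pol]
  | succ j ih =>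
    rw [pol, ih (fun i => y (2 * i)) (fun i => z (2 * i)),
      ih (fun i => y (2 * i + 1)) (fun i => z (2 * i + 1)), pol, pol]
    ring

theorem degree_pol_lt [Nontrivial R] (j : ℕ) (y : ℕ → R) : (pol j y).degree < (2 ^ j : ℕ) := by
  induction j generalizing y with
  | zero => exact (degree_C_le).trans_lt (by norm_num)
  | succ j ih =>
    have h1 := ih (fun i => y (2 * i))
    have h2 := ih (fun i => y (2 * i + 1))
    rw [pol]
    refine (degree_add_le _ _).trans_lt (max_lt (h1.trans ?_) ?_)
    · exact_mod_cast (by rw [pow_succ]; have := Nat.two_pow_pos j; omega : 2 ^ j < 2 ^ (j + 1))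
    · rw [X_pow_mul, degree_lt_iff_coeff_zero] at *
      intro m hm
      rw [coeff_mul_X_pow', if_pos (by rw [pow_succ] at hm; omega)]
      exact h2 _ (by rw [pow_succ] at hm; omega)

/-- Carries bounds from the entries of an array over to the coefficients; for this it does not
matter which index belongs to `q`. -/
theorem coeff_pol_eq [Nontrivial R] (j : ℕ) (y : ℕ → R) (q : ℕ) (hq : q < 2 ^ j) :
    ∃ i < 2 ^ j, (pol j y).coeff q = y i := by
  induction j generalizing y q with
  | zero => exact ⟨0, by simp, by simp [pol, show q = 0 by simpa using hq]⟩
  | succ j ih =>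
    rw [pow_succ] at hq
    rw [pol, coeff_add, coeff_X_pow_mul']
    rcases Nat.lt_or_ge q (2 ^ j) with h | h
    · obtain ⟨i, hi, e⟩ := ih (fun i => y (2 * i)) q h
      exact ⟨2 * i, by rw [pow_succ]; omega, by simp [e, h]⟩
    · obtain ⟨i, hi, e⟩ := ih (fun i => y (2 * i + 1)) (q - 2 ^ j) (by omega)
      refine ⟨2 * i + 1, by rw [pow_succ]; omega, ?_⟩
      rw [if_pos h, e, (degree_lt_iff_coeff_zero _ _).1 (degree_pol_lt j _) q h, zero_add]

theorem map_pol {S : Type*} [CommRing S] (f : R →+* S) (j : ℕ) (y : ℕ → R) :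
    (pol j y).map f = pol j (fun i => f (y i)) := by
  induction j generalizing y with
  | zero => simp [pol]
  | succ j ih => simp [pol, ih]

/-- Evaluation at a power of two, level by level. -/
theorem eval_pol_of_step {c k ℓ : ℕ} (hk : k ≤ ℓ) (X : ℕ → ℕ → ℤ)
    (h : ∀ t < k, ∀ r < 2 ^ (c + t),
      X t r = X (t + 1) r + X (t + 1) (r + 2 ^ (c + t)) * 2 ^ 2 ^ (ℓ - 1 - t))
    (j : ℕ) : ∀ t, t + j = k → ∀ g < 2 ^ (c + t),
      X t g = (pol j (fun i => X k (g + 2 ^ (c + t) * i))).eval (2 ^ 2 ^ (ℓ - k)) := by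
  induction j with
  | zero =>
    rintro t rfl g hg
    simp [pol]
  | succ j ih =>
    intro t ht g hg
    have e1 : 2 ^ (c + (t + 1)) = 2 * 2 ^ (c + t) := by rw [← pow_succ']; rfl
    rw [h t (by omega) g hg, ih (t + 1) (by omega) g (by omega),
      ih (t + 1) (by omega) (g + 2 ^ (c + t)) (by omega), pol]
    have e2 : ((2 : ℤ) ^ 2 ^ (ℓ - k)) ^ 2 ^ j = 2 ^ 2 ^ (ℓ - 1 - t) := by
      rw [← pow_mul, ← pow_add]
      congr 2
      omega
    have e3 : ∀ i, g + 2 ^ (c + (t + 1)) * i = g + 2 ^ (c + t) * (2 * i) := by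
      intro i; rw [e1]; ring
    have e4 : ∀ i, g + 2 ^ (c + t) + 2 ^ (c + (t + 1)) * i = g + 2 ^ (c + t) * (2 * i + 1) := by
      intro i; rw [e1]; ring
    simp only [e3, e4, eval_add, eval_mul, eval_pow, eval_X, e2]
    ring

/-- Chinese remaindering for `X^(2h) - w² = (X^h - w)(X^h + w)`, whose factors are coprime because
`2` and `w` are units. Modulo the first factor `X^h` becomes `w`, and both the product and the
interpolated polynomial reduce to `Z₀`; modulo the second one `X^h` becomes `-w`, and both reduce to
`Z₁`. -/
theorem butterfly_dvd {h : ℕ} {A₁ A₂ B₁ B₂ Z₀ Z₁ : R[X]} {w w' v : R} (hw : w * w' = 1)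
    (hv : 2 * v = 1)
    (h0 : X ^ h - C w ∣ (A₁ + A₂ * C w) * (B₁ + B₂ * C w) - Z₀)
    (h1 : X ^ h + C w ∣ (A₁ - A₂ * C w) * (B₁ - B₂ * C w) - Z₁) :
    X ^ (h * 2) - C (w ^ 2) ∣ (A₁ + X ^ h * A₂) * (B₁ + X ^ h * B₂) -
      ((Z₀ + Z₁) * C v + X ^ h * ((Z₀ - Z₁) * C (v * w'))) := by
  have cw : C w * C w' = (1 : R[X]) := by rw [← C_mul, hw, C_1]
  have cv : 2 * C v = (1 : R[X]) := by
    rw [show (2 : R[X]) = C 2 from (C_ofNat 2).symm, ← C_mul, hv, C_1]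
  have hc : IsCoprime (X ^ h - C w : R[X]) (X ^ h + C w) := by
    -- The difference of the two factors is `2w`, with inverse `v w'`.
    refine ⟨-(C v * C w'), C v * C w', ?_⟩
    linear_combination cv * (C w * C w') + cw
  have e : (X ^ (h * 2) - C (w ^ 2) : R[X]) = (X ^ h - C w) * (X ^ h + C w) := by
    rw [pow_mul, C_pow]; ring
  rw [e, C_mul]
  refine hc.mul_dvd ?_ ?_
  · have : X ^ h - C w ∣ ((A₁ + A₂ * C w) * (B₁ + B₂ * C w) - Z₀) + (X ^ h - C w) *
        (A₁ * B₂ + A₂ * B₁ + A₂ * B₂ * (X ^ h + C w) - (Z₀ - Z₁) * (C v * C w')) :=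
      dvd_add h0 (dvd_mul_right _ _)
    convert this using 1
    linear_combination (-Z₀) * cv - (Z₀ - Z₁) * C v * cw
  · have : X ^ h + C w ∣ ((A₁ - A₂ * C w) * (B₁ - B₂ * C w) - Z₁) + (X ^ h + C w) *
        (A₁ * B₂ + A₂ * B₁ + A₂ * B₂ * (X ^ h - C w) - (Z₀ - Z₁) * (C v * C w')) :=
      dvd_add h1 (dvd_mul_right _ _)
    convert this using 1
    linear_combination (-Z₁) * cv + (Z₀ - Z₁) * C v * cw

/-- The transform, the pointwise products and the inverse transform multiply polynomials modulo
`X ^ 2 ^ k + 1`. -/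
theorem fft_dvd {c k l : ℕ} (hk : k ≤ l) {a v : R} (ha : a ^ 2 ^ l = -1) (hv : 2 * v = 1)
    (A B Z : ℕ → ℕ → R)
    (hA : ∀ t < k, ∀ g < 2 ^ (c + t), ∀ i < 2 ^ (k - t - 1),
      A (t + 1) (g + 2 ^ (c + t) * (2 * i)) = A t (g + 2 ^ (c + t) * (2 * i)) +
        A t (g + 2 ^ (c + t) * (2 * i + 1)) * a ^ ((2 * (g / 2 ^ c) + 1) * 2 ^ (l - t - 1)) ∧
      A (t + 1) (g + 2 ^ (c + t) * (2 * i + 1)) = A t (g + 2 ^ (c + t) * (2 * i)) -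
        A t (g + 2 ^ (c + t) * (2 * i + 1)) * a ^ ((2 * (g / 2 ^ c) + 1) * 2 ^ (l - t - 1)))
    (hB : ∀ t < k, ∀ g < 2 ^ (c + t), ∀ i < 2 ^ (k - t - 1),
      B (t + 1) (g + 2 ^ (c + t) * (2 * i)) = B t (g + 2 ^ (c + t) * (2 * i)) +
        B t (g + 2 ^ (c + t) * (2 * i + 1)) * a ^ ((2 * (g / 2 ^ c) + 1) * 2 ^ (l - t - 1)) ∧
      B (t + 1) (g + 2 ^ (c + t) * (2 * i + 1)) = B t (g + 2 ^ (c + t) * (2 * i)) -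
        B t (g + 2 ^ (c + t) * (2 * i + 1)) * a ^ ((2 * (g / 2 ^ c) + 1) * 2 ^ (l - t - 1)))
    (hZ : ∀ t < k, ∀ g < 2 ^ (c + t), ∀ i < 2 ^ (k - t - 1),
      Z t (g + 2 ^ (c + t) * (2 * i)) =
        (Z (t + 1) (g + 2 ^ (c + t) * (2 * i)) + Z (t + 1) (g + 2 ^ (c + t) * (2 * i + 1))) * v ∧
      Z t (g + 2 ^ (c + t) * (2 * i + 1)) * a ^ ((2 * (g / 2 ^ c) + 1) * 2 ^ (l - t - 1)) =
        (Z (t + 1) (g + 2 ^ (c + t) * (2 * i)) - Z (t + 1) (g + 2 ^ (c + t) * (2 * i + 1))) * v)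
    (hAB : ∀ r < 2 ^ (c + k), Z k r = A k r * B k r) (j : ℕ) :
    ∀ t, t + j = k → ∀ g < 2 ^ (c + t),
      X ^ 2 ^ j - C (a ^ ((2 * (g / 2 ^ c) + 1) * 2 ^ (l - t))) ∣
        pol j (fun i => A t (g + 2 ^ (c + t) * i)) * pol j (fun i => B t (g + 2 ^ (c + t) * i)) -
          pol j (fun i => Z t (g + 2 ^ (c + t) * i)) := by
  have hau : ∀ e, ∃ a', a ^ e * a' = 1 := fun e => by
    have : IsUnit a := IsUnit.of_mul_eq_one (-a ^ (2 ^ l - 1)) (by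
      have h2 : 2 ^ l = (2 ^ l - 1) + 1 := by have := Nat.two_pow_pos l; omega
      have : a * a ^ (2 ^ l - 1) = -1 := by rw [← pow_succ', ← h2, ha]
      linear_combination -this)
    exact (this.pow e).exists_right_inv
  induction j with
  | zero =>
    rintro t rfl g hg
    have := hAB g hg
    simp only [add_zero] at this
    simp [pol, this]
  | succ j ih =>
    intro t ht g hg
    have hj : k - t - 1 = j := by omega
    set G := 2 ^ (c + t) with hG
    have e1 : 2 ^ (c + (t + 1)) = 2 * G := by rw [hG, ← pow_succ']; rfl
    have e3 : ∀ i, g + 2 ^ (c + (t + 1)) * i = g + G * (2 * i) := by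
      intro i; rw [e1]; ring
    have e4 : ∀ i, g + G + 2 ^ (c + (t + 1)) * i = g + G * (2 * i + 1) := by
      intro i; rw [e1]; ring
    -- The node `g` of level `t` has the children `g` and `g + G` on the next level, for the factors
    -- `X ^ 2 ^ j - w` and `X ^ 2 ^ j + w`.
    have h0 := ih (t + 1) (by omega) g (by omega)
    have h1 := ih (t + 1) (by omega) (g + G) (by omega)
    have e5 : (g + G) / 2 ^ c = g / 2 ^ c + 2 ^ t := by
      rw [hG, pow_add, Nat.add_mul_div_left _ _ (Nat.two_pow_pos c)]
    set w := a ^ ((2 * (g / 2 ^ c) + 1) * 2 ^ (l - t - 1)) with hw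
    -- Passing to the second child adds `2 ^ l` to the exponent, that is, multiplies the root by `a
    -- ^ 2 ^ l = -1`.
    have e6 : a ^ ((2 * ((g + G) / 2 ^ c) + 1) * 2 ^ (l - (t + 1))) = -w := by
      have : (2 * ((g + G) / 2 ^ c) + 1) * 2 ^ (l - (t + 1)) =
          (2 * (g / 2 ^ c) + 1) * 2 ^ (l - t - 1) + 2 ^ l := by
        rw [e5, Nat.sub_sub]
        have : 2 ^ l = 2 ^ (t + 1) * 2 ^ (l - (t + 1)) := by
          rw [← pow_add]; congr 1; omega
        rw [this]
        ring
      rw [this, pow_add, ha, hw]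
      ring
    have e7 : a ^ ((2 * (g / 2 ^ c) + 1) * 2 ^ (l - t)) = w ^ 2 := by
      rw [hw, ← pow_mul]
      congr 1
      rw [mul_assoc, ← pow_succ]
      congr 2
      omega
    rw [show l - (t + 1) = l - t - 1 by omega] at h0
    rw [e6] at h1
    simp only [e3, e4, C_neg, sub_neg_eq_add] at h0 h1
    obtain ⟨w', hw'⟩ := hau ((2 * (g / 2 ^ c) + 1) * 2 ^ (l - t - 1))
    rw [← hw] at hw' h0
    have lin : ∀ Y : ℕ → ℕ → R, (∀ t < k, ∀ g < 2 ^ (c + t), ∀ i < 2 ^ (k - t - 1),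
        Y (t + 1) (g + 2 ^ (c + t) * (2 * i)) = Y t (g + 2 ^ (c + t) * (2 * i)) +
          Y t (g + 2 ^ (c + t) * (2 * i + 1)) * a ^ ((2 * (g / 2 ^ c) + 1) * 2 ^ (l - t - 1)) ∧
        Y (t + 1) (g + 2 ^ (c + t) * (2 * i + 1)) = Y t (g + 2 ^ (c + t) * (2 * i)) -
          Y t (g + 2 ^ (c + t) * (2 * i + 1)) * a ^ ((2 * (g / 2 ^ c) + 1) * 2 ^ (l - t - 1))) →
        pol j (fun i => Y (t + 1) (g + G * (2 * i))) = pol j (fun i => Y t (g + G * (2 * i))) +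
          pol j (fun i => Y t (g + G * (2 * i + 1))) * C w ∧
        pol j (fun i => Y (t + 1) (g + G * (2 * i + 1))) = pol j (fun i => Y t (g + G * (2 * i))) -
          pol j (fun i => Y t (g + G * (2 * i + 1))) * C w := by
      intro Y hY
      have l1 := pol_linear j (fun i => Y t (g + G * (2 * i))) (fun i => Y t (g + G * (2 * i + 1)))
        1 w
      have l2 := pol_linear j (fun i => Y t (g + G * (2 * i))) (fun i => Y t (g + G * (2 * i + 1)))
        1 (-w)
      rw [C_1, mul_one] at l1 l2
      rw [C_neg, mul_neg, ← sub_eq_add_neg] at l2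
      rw [← l1, ← l2]
      constructor
      · apply pol_congr
        intro i hi
        rw [(hY t (by omega) g hg i (by rwa [hj])).1]
        ring
      · apply pol_congr
        intro i hi
        rw [(hY t (by omega) g hg i (by rwa [hj])).2]
        ring
    rw [(lin A hA).1, (lin B hB).1] at h0
    rw [(lin A hA).2, (lin B hB).2] at h1
    have z0 : pol j (fun i => Z t (g + G * (2 * i))) =
        (pol j (fun i => Z (t + 1) (g + G * (2 * i))) +
          pol j (fun i => Z (t + 1) (g + G * (2 * i + 1)))) * C v := by
      rw [add_mul, ← pol_linear]
      apply pol_congr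
      intro i hi
      rw [(hZ t (by omega) g hg i (by rwa [hj])).1]
      ring
    have z1 : pol j (fun i => Z t (g + G * (2 * i + 1))) =
        (pol j (fun i => Z (t + 1) (g + G * (2 * i))) -
          pol j (fun i => Z (t + 1) (g + G * (2 * i + 1)))) * C (v * w') := by
      rw [sub_eq_add_neg, add_mul, neg_mul, ← mul_neg, ← C_neg, ← pol_linear]
      apply pol_congr
      intro i hi
      have := (hZ t (by omega) g hg i (by rwa [hj])).2
      rw [← hw] at this
      linear_combination w' * this - Z t (g + G * (2 * i + 1)) * hw'
    have := butterfly_dvd hw' hv h0 h1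
    rw [← z0, ← z1] at this
    rw [e7, pow_succ 2 j]
    simpa only [pol] using this

end Pol

/-! ### From residues of coefficients to residues of integers -/

theorem coeff_sum_monomial {R : Type*} [CommRing R] (D : ℕ) (f : ℕ → R) (q : ℕ) :
    (∑ i ∈ Finset.range D, monomial i (f i)).coeff q = if q < D then f q else 0 := by
  simp [coeff_monomial]

theorem abs_coeff_mul_le {A B : ℤ[X]} {D : ℕ} {β : ℤ} (hβ : 0 ≤ β) (hA : ∀ q, |A.coeff q| ≤ β)
    (hB : ∀ q, |B.coeff q| ≤ β) {q : ℕ} (hq : q < 2 * D) :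
    |(A * B).coeff q| ≤ 2 * D * β ^ 2 := by
  rw [coeff_mul]
  refine (Finset.abs_sum_le_sum_abs _ _).trans ?_
  refine (Finset.sum_le_card_nsmul _ _ (β ^ 2) fun x _ => ?_).trans ?_
  · rw [abs_mul, sq]
    exact mul_le_mul (hA _) (hB _) (abs_nonneg _) hβ
  · rw [Finset.Nat.card_antidiagonal, nsmul_eq_mul]
    have : ((q + 1 : ℕ) : ℤ) ≤ 2 * D := by exact_mod_cast hq
    exact mul_le_mul_of_nonneg_right this (by positivity)

/-- Write `A B = Q₀ + X^D Q₁` with `Q₀`, `Q₁` of degree below `D`. Modulo `X^D + 1` the product is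
`Q₀ - Q₁`, with coefficients of size at most `4 D β²`. It agrees with `Z` modulo `N`, and by the
size condition it equals `Z` over the integers. Evaluating at `x` replaces `X^D + 1` by `x^D + 1`.
-/
theorem eval_modEq_of_dvd {A B Z : ℤ[X]} {D : ℕ} {β γ : ℤ} {N : ℕ} (hD : 1 ≤ D)
    (hN : 1 < N) (hβ : 0 ≤ β)
    (hA : ∀ q, |A.coeff q| ≤ β) (hB : ∀ q, |B.coeff q| ≤ β) (hZ : ∀ q, |Z.coeff q| ≤ γ)
    (dA : A.degree < D) (dB : B.degree < D) (dZ : Z.degree < D) (hlt : 4 * D * β ^ 2 + γ < N)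
    (h : X ^ D + 1 ∣ (A * B - Z).map (Int.castRingHom (ZMod N))) (x : ℤ) :
    Z.eval x ≡ A.eval x * B.eval x [ZMOD x ^ D + 1] := by
  have : Fact (1 < N) := ⟨hN⟩
  set Q := A * B with hQ
  set Q₀ : ℤ[X] := ∑ i ∈ Finset.range D, monomial i (Q.coeff i) with hQ0
  set Q₁ : ℤ[X] := ∑ i ∈ Finset.range D, monomial i (Q.coeff (i + D)) with hQ1
  have dQ : ∀ q, 2 * D ≤ q → Q.coeff q = 0 := by
    intro q hq
    by_cases hA0 : A = 0
    · simp [hQ, hA0]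
    by_cases hB0 : B = 0
    · simp [hQ, hB0]
    apply coeff_eq_zero_of_natDegree_lt
    rw [hQ]
    have h1 := natDegree_mul_le (p := A) (q := B)
    rw [degree_eq_natDegree hA0] at dA
    rw [degree_eq_natDegree hB0] at dB
    norm_cast at dA dB
    omega
  have split : Q = Q₀ + X ^ D * Q₁ := by
    ext q
    rw [coeff_add, coeff_X_pow_mul', hQ0, hQ1, coeff_sum_monomial, coeff_sum_monomial]
    rcases Nat.lt_or_ge q D with h | h
    · simp [h]
    · by_cases h' : q < 2 * D
      · simp [h, show ¬ q < D by omega, show q - D < D by omega, show q - D + D = q by omega]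
      · simp [h, show ¬ q < D by omega, show ¬ q - D < D by omega, dQ q (by omega)]
  have hmonic : (X ^ D + 1 : (ZMod N)[X]).Monic := by
    simpa using monic_X_pow_add_C (1 : ZMod N) (by omega : D ≠ 0)
  have hdeg : (X ^ D + 1 : (ZMod N)[X]).degree = D := by
    simpa using degree_X_pow_add_C (by omega : 0 < D) (1 : ZMod N)
  -- A polynomial of degree below `D` that is divisible by the monic `X^D + 1` vanishes.
  have hzero : (Q₀ - Q₁ - Z).map (Int.castRingHom (ZMod N)) = 0 := by
    by_contra hne
    refine hmonic.not_dvd_of_degree_lt hne ?_ ?_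
    swap
    · have : (Q₀ - Q₁ - Z) = (Q - Z) - (X ^ D + 1) * Q₁ := by rw [split]; ring
      rw [this, Polynomial.map_sub _ (p := Q - Z), Polynomial.map_mul]
      refine dvd_sub h (Dvd.dvd.mul_right ?_ _)
      simp
    · rw [hdeg]
      refine (degree_map_le).trans_lt ?_
      rw [degree_lt_iff_coeff_zero] at dZ ⊢
      intro m hm
      rw [coeff_sub, coeff_sub, dZ m hm, hQ0, hQ1, coeff_sum_monomial,
        coeff_sum_monomial, if_neg (by omega), if_neg (by omega)]
      simp
  have hZe : Z = Q₀ - Q₁ := by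
    ext q
    rcases Nat.lt_or_ge q D with hq | hq
    · have h1 : (((Q₀ - Q₁ - Z).coeff q : ℤ) : ZMod N) = 0 := by
        have := congrArg (fun p => p.coeff q) hzero
        simpa using this
      have h2 := (ZMod.intCast_zmod_eq_zero_iff_dvd _ _).1 h1
      have h3 : |(Q₀ - Q₁ - Z).coeff q| < (N : ℤ) := by
        have b0 := abs_coeff_mul_le (D := D) hβ hA hB (q := q) (by omega)
        have b1 := abs_coeff_mul_le (D := D) hβ hA hB (q := q + D) (by omega)
        have b2 := hZ q
        rw [coeff_sub, coeff_sub, hQ0, hQ1, coeff_sum_monomial, coeff_sum_monomial, if_pos hq,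
          if_pos hq]
        rw [abs_le] at b0 b1 b2
        rw [abs_lt]
        constructor <;> linarith
      have h4 := Int.eq_zero_of_abs_lt_dvd h2 h3
      rw [coeff_sub] at h4
      linarith
    · rw [(degree_lt_iff_coeff_zero _ _).1 dZ q hq, coeff_sub, hQ0, hQ1, coeff_sum_monomial,
        coeff_sum_monomial, if_neg (by omega), if_neg (by omega), sub_zero]
  rw [Int.modEq_iff_dvd]
  have e : A.eval x * B.eval x = Q₀.eval x + x ^ D * Q₁.eval x := by
    rw [← eval_mul, ← hQ, split]; simp
  rw [e, hZe, eval_sub]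
  exact ⟨Q₁.eval x, by ring⟩

end SSA

/-! ### One level of the Schönhage–Strassen recursion

At a level there are `2 ^ c` residues modulo `2 ^ 2 ^ ℓ + 1`. Each of them is cut into `2 ^ k`
parts, and the transform of the parts yields `2 ^ (c + k)` residues modulo `2 ^ 2 ^ l + 1`. -/

namespace SSA

open Polynomial

def chopStep (e G : ℕ) (X : ℕ → ℤ) (r : ℕ) : ℤ := if r < G then lo e (X r) else hi e (X (r - G))

/-- The lower half of entry `r` stays at `r`, the upper half goes to `r + 2 ^ (c + t)`. The `c`
lowest bits of an index thus always name the residue, and the higher bits name the part in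
bit-reversed order, as `pol` expects. -/
def chop (c ℓ : ℕ) : ℕ → (ℕ → ℤ) → ℕ → ℤ
  | 0, X => X
  | t + 1, X => chopStep (2 ^ (ℓ - 1 - t)) (2 ^ (c + t)) (chop c ℓ t X)

def clearBit (b r : ℕ) : ℕ := r - r / 2 ^ b % 2 * 2 ^ b

/-- Exponent of the twiddle factor. -/
def twist (c l t r : ℕ) : ℕ := (2 * (r / 2 ^ c % 2 ^ (t + 1)) + 1) * 2 ^ (l - t - 1)

/-- One formula serves both outputs of a butterfly: if bit `c + t` of `r` is set, the twist is
larger by `2 ^ l`, and `2 ^ 2 ^ l ≡ -1` supplies the minus sign. -/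
def fftArg (c l t : ℕ) (Y : ℕ → ℤ) (r : ℕ) : ℤ :=
  Y (clearBit (c + t) r) + Y (clearBit (c + t) r + 2 ^ (c + t)) * 2 ^ twist c l t r

def fft (c l : ℕ) : ℕ → (ℕ → ℤ) → ℕ → ℤ
  | 0, Y => Y
  | t + 1, Y => fun r => red (2 ^ l) (fftArg c l t (fft c l t Y) r)

/-- Since `2 ^ (2 * 2 ^ l) ≡ 1`, division by `2` and by the twiddle factor are left shifts by the
complementary exponents. -/
def ifftArg (c l t : ℕ) (Z : ℕ → ℤ) (r : ℕ) : ℤ :=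
  if r / 2 ^ (c + t) % 2 = 0 then (Z (clearBit (c + t) r) + Z (clearBit (c + t) r + 2 ^ (c + t))) *
    2 ^ (2 * 2 ^ l - 1)
  else (Z (clearBit (c + t) r) - Z (clearBit (c + t) r + 2 ^ (c + t))) *
    2 ^ (2 * 2 ^ l - 1 - twist c l t (clearBit (c + t) r))

def ifft (c l k : ℕ) : ℕ → (ℕ → ℤ) → ℕ → ℤ
  | 0, Z => Z
  | s + 1, Z => fun r => red (2 ^ l) (ifftArg c l (k - 1 - s) (ifft c l k s Z) r)

def unchop (c ℓ k : ℕ) : ℕ → (ℕ → ℤ) → ℕ → ℤ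
  | 0, W => W
  | s + 1, W => fun r => unchop c ℓ k s W r +
      unchop c ℓ k s W (r + 2 ^ (c + (k - 1 - s))) * 2 ^ 2 ^ (ℓ - 1 - (k - 1 - s))

/-- Logarithm of the number of parts. -/
def parts (ℓ : ℕ) : ℕ := (ℓ + 2) / 2

/-- The next level. -/
def next (ℓ : ℕ) : ℕ := ℓ - parts ℓ + 2

def fwd (c ℓ : ℕ) (X : ℕ → ℤ) : ℕ → ℤ :=
  fft c (next ℓ) (parts ℓ) (chop c ℓ (parts ℓ) X)

def bwd (c ℓ : ℕ) (Z : ℕ → ℤ) (r : ℕ) : ℤ :=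
  red (2 ^ ℓ) (unchop c ℓ (parts ℓ) (parts ℓ) (ifft c (next ℓ) (parts ℓ) (parts ℓ) Z) r)

theorem two_pow_succ_split {c t r : ℕ} (h : r < 2 ^ (c + (t + 1))) (h' : ¬ r < 2 ^ (c + t)) :
    r - 2 ^ (c + t) < 2 ^ (c + t) := by
  rw [← add_assoc, pow_succ] at h
  omega

theorem abs_chop_le {c ℓ : ℕ} {X : ℕ → ℤ} (hX : ∀ r < 2 ^ c, |X r| ≤ 2 ^ 2 ^ ℓ) {t : ℕ}
    (ht : t ≤ ℓ) : ∀ r < 2 ^ (c + t), |chop c ℓ t X r| ≤ 2 ^ 2 ^ (ℓ - t) := by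
  induction t with
  | zero => simpa [chop] using hX
  | succ t ih =>
    intro r hr
    have ih := ih (by omega)
    have e : ℓ - (t + 1) = ℓ - 1 - t := by omega
    have e1 : (2 : ℤ) ^ 2 ^ (ℓ - t) = 2 ^ 2 ^ (ℓ - 1 - t) * 2 ^ 2 ^ (ℓ - 1 - t) := by
      rw [← pow_add, ← two_mul, ← pow_succ', show ℓ - 1 - t + 1 = ℓ - t by omega]
    have e2 : 1 ≤ 2 ^ (ℓ - 1 - t) := Nat.one_le_two_pow
    rw [e, chop, chopStep]
    split_ifs with h
    · refine (abs_lo_le e2 _).trans ?_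
      gcongr
      · norm_num
      · omega
    · exact abs_hi_le e2 ((ih _ (two_pow_succ_split hr h)).trans_eq e1)

theorem chop_step (c ℓ : ℕ) (X : ℕ → ℤ) (t r : ℕ) (hr : r < 2 ^ (c + t)) :
    chop c ℓ t X r = chop c ℓ (t + 1) X r +
      chop c ℓ (t + 1) X (r + 2 ^ (c + t)) * 2 ^ 2 ^ (ℓ - 1 - t) := by
  simp [chop, chopStep, hr, lo_add_hi]

theorem clearBit_le (b r : ℕ) : clearBit b r ≤ r := Nat.sub_le _ _

theorem clearBit_add_lt {b r n : ℕ} (hb : b < n) (hr : r < 2 ^ n) :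
    clearBit b r + 2 ^ b < 2 ^ n := by
  obtain ⟨m, rfl⟩ := Nat.exists_eq_add_of_lt hb
  rw [show b + m + 1 = b + 1 + m by omega, pow_add, pow_succ] at *
  set B := 2 ^ b with hB
  have hB0 : 0 < B := Nat.two_pow_pos b
  have h1 := Nat.div_add_mod r B
  have h2 := Nat.div_add_mod (r / B) 2
  have h3 := Nat.mod_lt r hB0
  set q := r / B / 2
  have e : clearBit b r = B * (2 * q) + r % B := by
    unfold clearBit
    rw [← hB]
    have : r = B * (2 * q) + (r / B % 2) * B + r % B := by
      conv_lhs => rw [← h1, ← h2]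
      ring
    omega
  have hq : q < 2 ^ m := by
    by_contra! hc
    have := Nat.mul_le_mul_left (B * 2) hc
    have : B * (2 * q) ≤ B * (r / B) := Nat.mul_le_mul_left _ (by omega)
    have : B * (2 * q) = B * 2 * q := by ring
    omega
  have := Nat.mul_le_mul_left (B * 2) (Nat.succ_le_of_lt hq)
  rw [e]
  nlinarith

theorem twist_lt {c l t r : ℕ} (ht : t < l) : twist c l t r < 2 * 2 ^ l := by
  have h1 := Nat.mod_lt (r / 2 ^ c) (Nat.two_pow_pos (t + 1))
  have h2 : 2 ^ l = 2 ^ (t + 1) * 2 ^ (l - t - 1) := by rw [← pow_add]; congr 1; omega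
  unfold twist
  rw [h2, ← mul_assoc]
  exact Nat.mul_lt_mul_of_pos_right (by omega) (Nat.two_pow_pos _)

/-- This lemma and the next translate the operations on the bits of an index, with which the program
works, into the form `g + 2 ^ (c + t) * m` of `fft_dvd`. -/
theorem block_even {c t g : ℕ} (hg : g < 2 ^ (c + t)) (i : ℕ) :
    (g + 2 ^ (c + t) * (2 * i)) / 2 ^ (c + t) % 2 = 0 ∧
      clearBit (c + t) (g + 2 ^ (c + t) * (2 * i)) = g + 2 ^ (c + t) * (2 * i) ∧
      (g + 2 ^ (c + t) * (2 * i)) / 2 ^ c % 2 ^ (t + 1) = g / 2 ^ c := by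
  have h1 : (g + 2 ^ (c + t) * (2 * i)) / 2 ^ (c + t) = 2 * i := by
    rw [Nat.add_mul_div_left _ _ (Nat.two_pow_pos _), Nat.div_eq_of_lt hg, zero_add]
  have h2 : g / 2 ^ c < 2 ^ t := Nat.div_lt_of_lt_mul (by rwa [← pow_add])
  refine ⟨by rw [h1]; omega, by rw [clearBit, h1]; simp, ?_⟩
  rw [show g + 2 ^ (c + t) * (2 * i) = g + 2 ^ c * (2 ^ (t + 1) * i) by rw [pow_add, pow_succ]; ring,
    Nat.add_mul_div_left _ _ (Nat.two_pow_pos _), Nat.add_mul_mod_self_left]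
  exact Nat.mod_eq_of_lt (by rw [pow_succ]; omega)

theorem block_odd {c t g : ℕ} (hg : g < 2 ^ (c + t)) (i : ℕ) :
    (g + 2 ^ (c + t) * (2 * i + 1)) / 2 ^ (c + t) % 2 = 1 ∧
      clearBit (c + t) (g + 2 ^ (c + t) * (2 * i + 1)) = g + 2 ^ (c + t) * (2 * i) ∧
      (g + 2 ^ (c + t) * (2 * i + 1)) / 2 ^ c % 2 ^ (t + 1) = g / 2 ^ c + 2 ^ t := by
  have h1 : (g + 2 ^ (c + t) * (2 * i + 1)) / 2 ^ (c + t) = 2 * i + 1 := by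
    rw [Nat.add_mul_div_left _ _ (Nat.two_pow_pos _), Nat.div_eq_of_lt hg, zero_add]
  have h2 : g / 2 ^ c < 2 ^ t := Nat.div_lt_of_lt_mul (by rwa [← pow_add])
  have h3 : (2 * i + 1) % 2 = 1 := by omega
  refine ⟨by rw [h1, h3], ?_, ?_⟩
  · rw [clearBit, h1, h3, mul_add]; omega
  rw [show g + 2 ^ (c + t) * (2 * i + 1) = g + 2 ^ c * (2 ^ t + 2 ^ (t + 1) * i) by
      rw [pow_add, pow_succ]; ring,
    Nat.add_mul_div_left _ _ (Nat.two_pow_pos _), ← add_assoc, Nat.add_mul_mod_self_left]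
  exact Nat.mod_eq_of_lt (by rw [pow_succ]; omega)

theorem two_le_two_pow {l : ℕ} (hl : 1 ≤ l) : 2 ≤ 2 ^ l := by
  calc 2 = 2 ^ 1 := rfl
    _ ≤ _ := Nat.pow_le_pow_right (by omega) hl

/-- A twist is less than `2 * 2 ^ l`, so about `3 * 2 ^ l` bits occur; this lies in the range for
which `red` is designed. -/
theorem abs_fftArg_le {c l t : ℕ} {Y : ℕ → ℤ} {r : ℕ} (htl : t < l) {n : ℕ} (hn : c + t < n)
    (hY : ∀ r < 2 ^ n, |Y r| ≤ 2 ^ 2 ^ l) (hr : r < 2 ^ n) :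
    |fftArg c l t Y r| ≤ 2 ^ (5 * 2 ^ l) := by
  have h1 := hY _ ((clearBit_le (c + t) r).trans_lt hr)
  have h2 := hY _ (clearBit_add_lt hn hr)
  have h3 := twist_lt (c := c) (r := r) htl
  have h4 : (2 : ℤ) ^ twist c l t r ≤ 2 ^ (2 * 2 ^ l) := by gcongr; norm_num
  have h5 := Nat.one_le_two_pow (n := l)
  calc |fftArg c l t Y r| ≤ 2 ^ 2 ^ l + 2 ^ 2 ^ l * 2 ^ (2 * 2 ^ l) := by
        unfold fftArg
        refine (abs_add_le _ _).trans (add_le_add h1 ?_)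
        rw [abs_mul, abs_of_pos (by positivity : (0 : ℤ) < 2 ^ twist c l t r)]
        gcongr
    _ ≤ 2 ^ (3 * 2 ^ l) + 2 ^ (3 * 2 ^ l) := by
        rw [← pow_add]
        exact add_le_add (pow_le_pow_right₀ (by norm_num) (by omega))
          (pow_le_pow_right₀ (by norm_num) (by omega))
    _ = 2 ^ (3 * 2 ^ l + 1) := by ring
    _ ≤ _ := by gcongr <;> norm_num

theorem abs_ifftArg_le {c l t : ℕ} {Z : ℕ → ℤ} {r : ℕ} {n : ℕ} (hn : c + t < n)
    (hZ : ∀ r < 2 ^ n, |Z r| ≤ 2 ^ 2 ^ l) (hr : r < 2 ^ n) :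
    |ifftArg c l t Z r| ≤ 2 ^ (5 * 2 ^ l) := by
  have h1 := hZ _ ((clearBit_le (c + t) r).trans_lt hr)
  have h2 := hZ _ (clearBit_add_lt hn hr)
  have h5 := Nat.one_le_two_pow (n := l)
  have key : ∀ a : ℤ, ∀ e, |a| ≤ 2 ^ 2 ^ l + 2 ^ 2 ^ l → e ≤ 2 * 2 ^ l →
      |a * 2 ^ e| ≤ 2 ^ (5 * 2 ^ l) := by
    intro a e ha he
    rw [abs_mul, abs_of_pos (by positivity : (0 : ℤ) < 2 ^ e)]
    calc |a| * 2 ^ e ≤ (2 ^ 2 ^ l + 2 ^ 2 ^ l) * 2 ^ (2 * 2 ^ l) := by gcongr; norm_num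
      _ = 2 ^ (3 * 2 ^ l + 1) := by rw [pow_succ, show 3 * 2 ^ l = 2 ^ l + 2 * 2 ^ l by ring]; ring
      _ ≤ _ := by gcongr <;> norm_num
  unfold ifftArg
  split_ifs
  · exact key _ _ ((abs_add_le _ _).trans (add_le_add h1 h2)) (by omega)
  · exact key _ _ ((abs_sub _ _).trans (add_le_add h1 h2)) (by omega)

theorem abs_red_le_pow {l : ℕ} (hl : 1 ≤ l) {x : ℤ} (h : |x| ≤ 2 ^ (5 * 2 ^ l)) :
    |red (2 ^ l) x| ≤ 2 ^ 2 ^ l := by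
  have h2 := two_le_two_pow hl
  refine (abs_red_le h2 h).trans ?_
  have : (2 : ℤ) ^ 2 ^ l = 2 ^ (2 ^ l - 1) + 2 ^ (2 ^ l - 1) := by
    rw [← two_mul, ← pow_succ']; congr 1; omega
  have : (1 : ℤ) ≤ 2 ^ (2 ^ l - 1) := one_le_pow₀ (by norm_num)
  linarith

theorem abs_fft_le {c l k : ℕ} {Y : ℕ → ℤ} (hl : 1 ≤ l) (hk : k ≤ l)
    (hY : ∀ r < 2 ^ (c + k), |Y r| ≤ 2 ^ 2 ^ l) {t : ℕ} (ht : t ≤ k) :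
    ∀ r < 2 ^ (c + k), |fft c l t Y r| ≤ 2 ^ 2 ^ l := by
  induction t with
  | zero => simpa [fft] using hY
  | succ t ih =>
    intro r hr
    exact abs_red_le_pow hl (abs_fftArg_le (by omega) (by omega) (ih (by omega)) hr)

theorem abs_ifft_le {c l k : ℕ} {Z : ℕ → ℤ} (hl : 1 ≤ l)
    (hZ : ∀ r < 2 ^ (c + k), |Z r| ≤ 2 ^ 2 ^ l) {s : ℕ} (hs : s ≤ k) :
    ∀ r < 2 ^ (c + k), |ifft c l k s Z r| ≤ 2 ^ 2 ^ l := by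
  induction s with
  | zero => simpa [ifft] using hZ
  | succ s ih =>
    intro r hr
    exact abs_red_le_pow hl (abs_ifftArg_le (by omega) (ih (by omega)) hr)

/-- The parts overlap when they are joined, as coefficients of a product are longer than parts.
Joining at distance `a` adds at most `a + 1` bits, while the term `2 * a` of the exponent grows by
`2 * a`. -/
theorem abs_unchop_le {c ℓ k l : ℕ} {W : ℕ → ℤ} (hk : k ≤ ℓ)
    (hW : ∀ r < 2 ^ (c + k), |W r| ≤ 2 ^ 2 ^ l) {s : ℕ} (hs : s ≤ k) :
    ∀ r < 2 ^ (c + (k - s)), |unchop c ℓ k s W r| ≤ 2 ^ (2 * 2 ^ (ℓ - (k - s)) + 2 ^ l) := by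
  induction s with
  | zero =>
    intro r hr
    refine (hW r hr).trans ?_
    gcongr <;> norm_num
  | succ s ih =>
    intro r hr
    have ih := ih (by omega)
    have e0 : c + (k - s) = c + (k - 1 - s) + 1 := by omega
    have e1 : ℓ - (k - s) = ℓ - 1 - (k - 1 - s) := by omega
    have e2 : ℓ - (k - (s + 1)) = ℓ - 1 - (k - 1 - s) + 1 := by omega
    have e3 : k - (s + 1) = k - 1 - s := by omega
    rw [e0, e1, pow_succ] at ih
    rw [e2, unchop, pow_succ]
    rw [e3] at hr
    have h1 := ih r (by omega)
    have h2 := ih (r + 2 ^ (c + (k - 1 - s))) (by omega)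
    set a := 2 ^ (ℓ - 1 - (k - 1 - s))
    have ha : 1 ≤ a := Nat.one_le_two_pow
    calc _ ≤ (2 : ℤ) ^ (2 * a + 2 ^ l) + 2 ^ (2 * a + 2 ^ l) * 2 ^ a := by
          refine (abs_add_le _ _).trans (add_le_add h1 ?_)
          rw [abs_mul, abs_of_pos (by positivity : (0 : ℤ) < 2 ^ a)]
          gcongr
      _ ≤ 2 ^ (3 * a + 2 ^ l) + 2 ^ (3 * a + 2 ^ l) := by
          rw [← pow_add]
          exact add_le_add (pow_le_pow_right₀ (by norm_num) (by omega))
            (pow_le_pow_right₀ (by norm_num) (by omega))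
      _ = 2 ^ (3 * a + 2 ^ l + 1) := by ring
      _ ≤ _ := pow_le_pow_right₀ (by norm_num) (by omega)

/-- With `k = parts ℓ` and `l = next ℓ`, the inequality `k ≤ l` provides roots of unity of
sufficient order among the powers of `2`, and `l + k = ℓ + 2` makes the new modulus four times as
long as a part: twice for a product of parts, the rest for the sum of such products and its sign. -/
theorem parts_facts {ℓ : ℕ} (hℓ : 5 ≤ ℓ) :
    2 ≤ parts ℓ ∧ parts ℓ < ℓ ∧ parts ℓ ≤ next ℓ ∧ next ℓ ≤ ℓ ∧ 4 ≤ next ℓ ∧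
      next ℓ + parts ℓ = ℓ + 2 := by
  unfold next parts
  omega

theorem two_mul_two_pow_sub_one {R : Type*} [CommRing R] {l : ℕ} :
    (2 : R) * 2 ^ (2 * 2 ^ l - 1) = 2 ^ (2 * 2 ^ l) := by
  rw [← pow_succ']
  congr 1
  have := Nat.two_pow_pos l
  omega

/-- Products on the lower level yield products on the higher level. -/
theorem bwd_modEq {c ℓ : ℕ} (hℓ : 5 ≤ ℓ) {A B Z : ℕ → ℤ}
    (hA : ∀ r < 2 ^ c, |A r| ≤ 2 ^ 2 ^ ℓ) (hB : ∀ r < 2 ^ c, |B r| ≤ 2 ^ 2 ^ ℓ)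
    (hZ : ∀ r < 2 ^ (c + parts ℓ), |Z r| ≤ 2 ^ 2 ^ next ℓ)
    (hAB : ∀ r < 2 ^ (c + parts ℓ),
      Z r ≡ fwd c ℓ A r * fwd c ℓ B r [ZMOD 2 ^ 2 ^ next ℓ + 1]) :
    ∀ i < 2 ^ c, bwd c ℓ Z i ≡ A i * B i [ZMOD 2 ^ 2 ^ ℓ + 1] := by
  intro i hi
  obtain ⟨k2, kℓ, kl, lℓ, l4, hlk⟩ := parts_facts hℓ
  unfold fwd at hAB
  unfold bwd
  refine (red_modEq _ _).trans ?_
  set k := parts ℓ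
  set l := next ℓ
  set N : ℕ := 2 ^ 2 ^ l + 1 with hN
  have hN' : (N : ℤ) = 2 ^ 2 ^ l + 1 := by rw [hN]; push_cast; rfl
  have hN1 : 1 < N := by rw [hN]; have := Nat.two_pow_pos (2 ^ l); omega
  have : Fact (1 < N) := ⟨hN1⟩
  have redc : ∀ x : ℤ, ((red (2 ^ l) x : ℤ) : ZMod N) = x := by
    intro x
    rw [ZMod.intCast_eq_intCast_iff, hN']
    exact red_modEq _ _
  have ha : (2 : ZMod N) ^ 2 ^ l = -1 := by
    have : ((N : ℕ) : ZMod N) = 0 := ZMod.natCast_self N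
    rw [hN] at this
    push_cast at this
    linear_combination this
  have ha2 : (2 : ZMod N) ^ (2 * 2 ^ l) = 1 := by rw [mul_comm, pow_mul, ha]; ring
  have hv : (2 : ZMod N) * 2 ^ (2 * 2 ^ l - 1) = 1 := by
    rw [two_mul_two_pow_sub_one, ha2]
  have hY : ∀ Y : ℕ → ℤ, ∀ t < k, ∀ g < 2 ^ (c + t), ∀ i < 2 ^ (k - t - 1),
      ((fft c l (t + 1) Y (g + 2 ^ (c + t) * (2 * i)) : ℤ) : ZMod N) =
        (fft c l t Y (g + 2 ^ (c + t) * (2 * i)) : ℤ) +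
        (fft c l t Y (g + 2 ^ (c + t) * (2 * i + 1)) : ℤ) *
          2 ^ ((2 * (g / 2 ^ c) + 1) * 2 ^ (l - t - 1)) ∧
      ((fft c l (t + 1) Y (g + 2 ^ (c + t) * (2 * i + 1)) : ℤ) : ZMod N) =
        (fft c l t Y (g + 2 ^ (c + t) * (2 * i)) : ℤ) -
        (fft c l t Y (g + 2 ^ (c + t) * (2 * i + 1)) : ℤ) *
          2 ^ ((2 * (g / 2 ^ c) + 1) * 2 ^ (l - t - 1)) := by
    intro Y t ht g hg i _
    obtain ⟨-, e2, e3⟩ := block_even hg i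
    obtain ⟨-, o2, o3⟩ := block_odd hg i
    have e4 : g + 2 ^ (c + t) * (2 * i) + 2 ^ (c + t) = g + 2 ^ (c + t) * (2 * i + 1) := by ring
    simp only [fft, redc, fftArg, e2, o2, twist, e3, o3, e4]
    push_cast
    refine ⟨rfl, ?_⟩
    have : (2 * (g / 2 ^ c + 2 ^ t) + 1) * 2 ^ (l - t - 1) =
        (2 * (g / 2 ^ c) + 1) * 2 ^ (l - t - 1) + 2 ^ l := by
      have : 2 ^ l = 2 ^ (t + 1) * 2 ^ (l - t - 1) := by
        rw [← pow_add]; congr 1; omega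
      rw [this]
      ring
    rw [this, pow_add (2 : ZMod N) (_ * _), ha]
    ring
  set PZ := ifft c l k k Z
  -- The inverse transform starts on level `k` and ends on level `0`, hence the index `k - t`.
  have dv := fft_dvd (c := c) (k := k) kl ha hv
    (fun t r => ((fft c l t (chop c ℓ k A) r : ℤ) : ZMod N))
    (fun t r => ((fft c l t (chop c ℓ k B) r : ℤ) : ZMod N))
    (fun t r => ((ifft c l k (k - t) Z r : ℤ) : ZMod N)) (hY _) (hY _)
    (by
      intro t ht g hg i _
      obtain ⟨e1, e2, e3⟩ := block_even hg i
      obtain ⟨o1, o2, o3⟩ := block_odd hg i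
      have e4 : g + 2 ^ (c + t) * (2 * i) + 2 ^ (c + t) = g + 2 ^ (c + t) * (2 * i + 1) := by ring
      have e5 : k - t = (k - 1 - t) + 1 := by omega
      have e6 : k - 1 - (k - 1 - t) = t := by omega
      have e7 : k - (t + 1) = k - 1 - t := by omega
      simp only [e5, e7, ifft, redc, e6, ifftArg, e1, e2, o1, o2, e4, twist, e3, if_true]
      push_cast
      refine ⟨by simp, ?_⟩
      have htw : (2 * (g / 2 ^ c) + 1) * 2 ^ (l - t - 1) ≤ 2 * 2 ^ l - 1 := by
        have := twist_lt (c := c) (l := l) (t := t) (r := g + 2 ^ (c + t) * (2 * i)) (by omega)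
        rw [twist, e3] at this
        omega
      rw [mul_assoc, ← pow_add, Nat.sub_add_cancel htw])
    (by
      intro r hr
      have := hAB r hr
      rw [← hN', ← ZMod.intCast_eq_intCast_iff] at this
      push_cast at this
      simpa [ifft] using this)
    k 0 (by omega) i (by simpa using hi)
  -- At the root of the tree the twiddle factor is `2 ^ 2 ^ l = -1`, so the modulus is `X ^ 2 ^ k +
  -- 1`.
  rw [add_zero, Nat.sub_zero, Nat.div_eq_of_lt hi, mul_zero, zero_add, one_mul, ha] at dv
  have hW : unchop c ℓ k k PZ i = (pol k (fun j => PZ (i + 2 ^ c * j))).eval (2 ^ 2 ^ (ℓ - k)) := by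
    have := eval_pol_of_step (c := c) (k := k) (ℓ := ℓ) kℓ.le (fun t r => unchop c ℓ k (k - t) PZ r)
      (by
        intro t ht r hr
        have e5 : k - t = (k - 1 - t) + 1 := by omega
        have e6 : k - 1 - (k - 1 - t) = t := by omega
        have e7 : k - (t + 1) = k - 1 - t := by omega
        simp only [e5, e7, unchop, e6]) k 0 (by omega) i (by simpa using hi)
    simpa [unchop] using this
  have hX : ∀ X : ℕ → ℤ,
      X i = (pol k (fun j => chop c ℓ k X (i + 2 ^ c * j))).eval (2 ^ 2 ^ (ℓ - k)) := by
    intro X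
    have := eval_pol_of_step (c := c) (k := k) (ℓ := ℓ) kℓ.le (fun t r => chop c ℓ t X r)
      (fun t _ r hr => chop_step c ℓ X t r hr) k 0 (by omega) i (by simpa using hi)
    simpa [chop] using this
  have idx : ∀ j < 2 ^ k, i + 2 ^ c * j < 2 ^ (c + k) := by
    intro j hj
    rw [pow_add]
    nlinarith [Nat.two_pow_pos c]
  have bound : ∀ (y : ℕ → ℤ) (β : ℤ), 0 ≤ β → (∀ j < 2 ^ k, |y j| ≤ β) →
      ∀ q, |(pol k y).coeff q| ≤ β := by
    intro y β hβ hy q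
    rcases Nat.lt_or_ge q (2 ^ k) with h | h
    · obtain ⟨j, hj, e⟩ := coeff_pol_eq k y q h
      rw [e]
      exact hy j hj
    · rw [(degree_lt_iff_coeff_zero _ _).1 (degree_pol_lt k y) q h]
      simpa using hβ
  have main := eval_modEq_of_dvd (A := pol k (fun j => chop c ℓ k A (i + 2 ^ c * j)))
    (B := pol k (fun j => chop c ℓ k B (i + 2 ^ c * j))) (Z := pol k (fun j => PZ (i + 2 ^ c * j)))
    (D := 2 ^ k) (β := 2 ^ 2 ^ (ℓ - k)) (γ := 2 ^ (2 ^ l - 1) + 1) (N := N) Nat.one_le_two_pow hN1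
    (by positivity)
    (bound _ _ (by positivity) fun j hj => abs_chop_le hA kℓ.le _ (idx j hj))
    (bound _ _ (by positivity) fun j hj => abs_chop_le hB kℓ.le _ (idx j hj))
    (bound _ _ (by positivity) fun j hj => by
      -- The last inverse step ends with a reduction, so the entries are bounded by about half of
      -- the modulus and not merely by `2 ^ 2 ^ l`.
      have e5 : k = (k - 1) + 1 := by omega
      have : PZ (i + 2 ^ c * j) =
          red (2 ^ l) (ifftArg c l 0 (ifft c l k (k - 1) Z) (i + 2 ^ c * j)) := by
        change ifft c l k k Z _ = _
        conv_lhs => rw [show ifft c l k k Z = ifft c l k ((k - 1) + 1) Z by rw [← e5]]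
        rw [ifft, Nat.sub_self]
      rw [this]
      exact abs_red_le (two_le_two_pow (by omega))
        (abs_ifftArg_le (by omega) (abs_ifft_le (by omega) hZ (by omega)) (idx j hj)))
    (degree_pol_lt _ _) (degree_pol_lt _ _) (degree_pol_lt _ _)
    (by
      rw [hN']
      -- With `m = ℓ - k`, the bound for the product coefficients is `2 ^ (k + 2 + 2 * 2 ^ m)`,
      -- while `2 ^ l = 4 * 2 ^ m`. By `k ≤ m + 2` and `m + 6 ≤ 2 * 2 ^ m` the former is at most a
      -- quarter of `2 ^ 2 ^ l`; the bound for `Z` is one half plus one.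
      have hm : k ≤ ℓ - k + 2 := by omega
      have hl : l = ℓ - k + 2 := by omega
      set m := ℓ - k
      have hm2 : 2 ≤ m := by omega
      have h1 : m + 6 ≤ 2 * 2 ^ m := by
        clear_value m
        clear * - hm2
        induction m, hm2 using Nat.le_induction with
        | base => norm_num
        | succ m h ih => rw [pow_succ]; omega
      have e1 : (4 * ((2 ^ k : ℕ) : ℤ) * (2 ^ 2 ^ m) ^ 2) = 2 ^ (k + 2 + 2 * 2 ^ m) := by
        push_cast
        rw [← pow_mul, pow_add, pow_add, mul_comm (2 ^ m) 2]
        ring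
      have e2 : 2 ^ l = 4 * 2 ^ m := by rw [hl, pow_add]; ring
      have e3 : (2 : ℤ) ^ (k + 2 + 2 * 2 ^ m) ≤ 2 ^ (2 ^ l - 2) := by
        gcongr
        · norm_num
        · omega
      have e4 : (2 : ℤ) ^ (2 ^ l - 1) = 2 * 2 ^ (2 ^ l - 2) := by
        rw [← pow_succ']; congr 1; omega
      have e5 : (2 : ℤ) ^ 2 ^ l = 4 * 2 ^ (2 ^ l - 2) := by
        rw [show (4 : ℤ) = 2 ^ 2 by norm_num, ← pow_add]; congr 1; omega
      have e6 : (0 : ℤ) < 2 ^ (2 ^ l - 2) := by positivity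
      rw [e1, e4, e5]
      linarith)
    (by
      rw [Polynomial.map_sub, Polynomial.map_mul, map_pol, map_pol, map_pol]
      simpa [fft] using dv)
    (2 ^ 2 ^ (ℓ - k))
  rw [hW, hX A, hX B]
  convert main using 2
  rw [← pow_mul, ← pow_add, show ℓ - k + k = ℓ by omega]

end SSA

/-! ### Straight-line blocks and loops that fill arrays -/

namespace BitRAM

def block : List (ℕ × Expr) → Prog
  | [] => .const 100 0
  | (r, e) :: l => .seq (assign r e) (block l)

def blockRun (S : State) : List (ℕ × Expr) → State
  | [] => S
  | (r, e) :: l => blockRun (S.setReg r (e.eval S)) l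

def BlockLeaf (b : ℕ) (S : State) : List (ℕ × Expr) → Prop
  | [] => True
  | (r, e) :: l => e.Leaf S b ∧ BlockLeaf b (S.setReg r (e.eval S)) l

def blockWeight : List (ℕ × Expr) → ℕ
  | [] => 1
  | (_, e) :: l => e.weight + e.growth + 2 + blockWeight l

def blockOk : List (ℕ × Expr) → Bool
  | [] => true
  | (r, e) :: l => Nat.blt r 100 && (e.ok && blockOk l)

theorem Tri.block {l : List (ℕ × Expr)} {S : State} {b t : ℕ} {Q : State → Prop} (hb : 1 ≤ b)
    (hl : BlockLeaf b S l) (ht : blockWeight l * b ≤ t) (hQ : Q (blockRun S l))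
    (hok : blockOk l = true := by rfl) : Tri (block l) S t Q := by
  induction l generalizing S t with
  | nil =>
    intro M hM
    refine ⟨_, S, _, .const M 100 0, ?_, ⟨fun r hr => ?_, hM.2⟩, hQ⟩
    · rw [len_zero]
      simp only [blockWeight] at ht
      omega
    · simp [hM.1 r hr, show r ≠ 100 by omega]
  | cons a l ih =>
    obtain ⟨r, e⟩ := a
    simp only [blockOk, Bool.and_eq_true, Nat.blt_eq] at hok
    simp only [blockWeight, add_mul] at ht
    have h1 : Tri (BitRAM.assign r e) S ((e.weight + e.growth + 2) * b)
        (fun S' => S' = S.setReg r (e.eval S)) :=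
      Tri.assign hb hl.1 le_rfl rfl hok.2.1
    refine (h1.seq (t₂ := blockWeight l * b) fun S' _ hS' => ?_).mono ?_ fun _ h => h
    · subst hS'
      exact ih hl.2 le_rfl hQ hok.2.2
    · simp only [add_mul]
      omega

theorem Expr.writes_compile (e : Expr) {t r : ℕ} (h : r < t) : (e.compile t).writes r = false := by
  induction e generalizing t with
  | reg x => simp [compile, Prog.writes]; omega
  | const c => simp [compile, Prog.writes]; omega
  | add x y hx hy | sub x y hx hy | shl x y hx hy | shr x y hx hy =>
    simp [compile, Prog.writes, hx h, hy (show r < t + 1 by omega)]; omega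
  | load m x hx => simp [compile, Prog.writes, hx h]; omega
  | ite c x y hc hx hy => simp [compile, Prog.writes, hx h, hy h, hc h]

@[simp] theorem Expr.arrWrites_compile (e : Expr) (t a : ℕ) :
    (e.compile t).arrWrites a = false := by
  induction e generalizing t <;> simp_all [compile, Prog.arrWrites]

@[simp] theorem arrWrites_assign (r : ℕ) (e : Expr) (a : ℕ) :
    (assign r e).arrWrites a = false := by simp [assign, Prog.arrWrites]

@[simp] theorem arrWrites_storeE (m : ℕ) (i e : Expr) (a : ℕ) :
    (storeE m i e).arrWrites a = (a == m) := by simp [storeE, Prog.arrWrites]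

@[simp] theorem arrWrites_seq (p q : Prog) (a : ℕ) :
    (Prog.seq p q).arrWrites a = (p.arrWrites a || q.arrWrites a) := rfl

@[simp] theorem arrWrites_forLoop (i n : ℕ) (p : Prog) (a : ℕ) :
    (forLoop i n p).arrWrites a = p.arrWrites a := by
  simp [forLoop, whileE, Prog.arrWrites]

@[simp] theorem arrWrites_block (l : List (ℕ × Expr)) (a : ℕ) :
    (block l).arrWrites a = false := by
  induction l with
  | nil => rfl
  | cons x l ih => simp [block, ih]

/-- `for i = 0, …, n - 1 do dst[i] := o`, where `p` computes `o`. -/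
def mapLoop (i n o dst : ℕ) (p : Prog) : Prog :=
  forLoop i n (.seq p (storeE dst (.reg i) (.reg o)))

@[simp] theorem arrWrites_mapLoop (i n o dst : ℕ) (p : Prog) (a : ℕ) :
    (mapLoop i n o dst p).arrWrites a = (p.arrWrites a || a == dst) := by
  simp [mapLoop]

theorem Tri.mapLoop {i n o dst : ℕ} {p : Prog} {S : State} {N t b : ℕ} (F : ℕ → ℤ)
    (hn : S.reg n = N) (hN : len (N : ℤ) ≤ b) (hF : ∀ j < N, len (F j) ≤ b)
    (hstep : ∀ j < N, ∀ S', S'.reg i = (j : ℤ) → Keep (mapLoop i n o dst p) S S' →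
      Tri p S' t (fun S'' => S''.reg o = F j))
    (hd : p.arrWrites dst = false)
    (hi : i < 100 := by decide) (hn' : n < 100 := by decide) (hni : n ≠ i := by decide)
    (ho : o < 100 := by decide)
    (hpi : p.writes i = false := by rfl) (hpn : p.writes n = false := by rfl) :
    Tri (mapLoop i n o dst p) S ((N + 1) * (t + 60 * b))
      (fun S' => ∀ j < N, S'.arr dst (j : ℤ) = F j) := by
  have hb : 1 ≤ b := (one_le_len _).trans hN
  have hw : ∀ r < 100, (BitRAM.storeE dst (.reg i) (.reg o)).writes r = false := by
    intro r hr
    simp only [BitRAM.storeE, Prog.writes, Expr.writes_compile _ hr,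
      Expr.writes_compile _ (show r < 101 by omega), Bool.or_self]
  refine (Tri.forLoop (t := t + 8 * b) hn
    (fun j S' => ∀ m < j, S'.arr dst (m : ℤ) = F m) (by simp) ?_ hi hn' hni ?_ ?_).mono ?_
    fun S' h => h.1
  · intro j hj S' hij hk hI
    refine (hstep j hj S' hij hk).seq fun S'' hk' ho' => ?_
    have hi2 : S''.reg i = j := (hk'.reg i hi hpi).trans hij
    have hlj : len (j : ℤ) ≤ b := (len_natCast_mono hj.le).trans hN
    refine Tri.storeE hb (by simpa [Expr.Leaf, hi2] using hlj)
      (by simpa [Expr.Leaf, ho'] using hF j hj) (by simp [Expr.weight, Expr.growth]) ?_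
      (by simpa [Expr.ok] using hi) (by simpa [Expr.ok] using ho)
    intro m hm
    simp only [Expr.eval, hi2, ho', State.setReg_arr, State.setCell_arr, if_true]
    rcases Nat.lt_succ_iff_lt_or_eq.1 hm with h | rfl
    · rw [Function.update_of_ne (by exact_mod_cast h.ne), hk'.arr dst hd]
      exact hI m h
    · simp
  · simp only [Prog.writes, hpi, hw i hi, Bool.or_self]
  · simp only [Prog.writes, hpn, hw n hn', Bool.or_self]
  · exact Nat.mul_le_mul_left _ (by omega)

/-- `for i = 0, …, n - 1 do a[i] := o` at the same time for all `i`, where `p` computes `o`. -/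
def stage (i n o tmp a : ℕ) (p : Prog) : Prog :=
  .seq (mapLoop i n o tmp p) (mapLoop i n o a (assign o (.load tmp (.reg i))))

theorem Tri.stage {i n o tmp a : ℕ} {p : Prog} {S : State} {N t b : ℕ} (F : ℕ → ℤ)
    (hn : S.reg n = N) (hN : len (N : ℤ) ≤ b) (hF : ∀ j < N, len (F j) ≤ b)
    (hstep : ∀ j < N, ∀ S', S'.reg i = (j : ℤ) → Keep (BitRAM.mapLoop i n o tmp p) S S' →
      Tri p S' t (fun S'' => S''.reg o = F j))
    (hd : p.arrWrites tmp = false) (hta : tmp ≠ a)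
    (hi : i < 100 := by decide) (hn' : n < 100 := by decide) (hni : n ≠ i := by decide)
    (hoi : o ≠ i := by decide) (hno : n ≠ o := by decide)
    (ho : o < 100 := by decide)
    (hpi : p.writes i = false := by rfl) (hpn : p.writes n = false := by rfl) :
    Tri (BitRAM.stage i n o tmp a p) S ((N + 1) * (t + 150 * b))
      (fun S' => ∀ j < N, S'.arr a (j : ℤ) = F j) := by
  have hb : 1 ≤ b := (one_le_len _).trans hN
  have wassign : ∀ r < 100, r ≠ o → (BitRAM.assign o (.load tmp (.reg i))).writes r = false := by
    intro r hr hro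
    simp [BitRAM.assign, Prog.writes, Expr.writes_compile _ hr]
    omega
  have hwn : (BitRAM.mapLoop i n o tmp p).writes n = false := by
    simp [BitRAM.mapLoop, BitRAM.forLoop, BitRAM.assign, BitRAM.whileE, BitRAM.storeE, Expr.compile,
      Prog.writes, hpn, hni]
    omega
  have h1 := Tri.mapLoop F hn hN hF hstep hd hi hn' hni ho hpi hpn
  refine (h1.seq (t₂ := (N + 1) * (10 * b + 60 * b)) fun S₁ hk hS => ?_).mono ?_ fun _ h => h
  · refine Tri.mapLoop F ((hk.reg n hn' hwn).trans hn) hN hF ?_ (by simp) hi hn' hni ho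
      (wassign i hi hoi.symm) (wassign n hn' hno)
    intro j hj S' hij hk'
    have hc : S'.arr tmp j = F j := by
      rw [hk'.arr tmp (by simpa using hta), hS j hj]
    have hlj : len (j : ℤ) ≤ b := (len_natCast_mono hj.le).trans hN
    refine Tri.assign hb ?_ (by simp [Expr.weight, Expr.growth]; omega) ?_
      (by simpa [Expr.ok] using hi)
    · simp [Expr.Leaf, Expr.eval, hij, hc, hF j hj, hlj]
    · simp [Expr.eval, hij, hc]
  · rw [← mul_add]
    exact Nat.mul_le_mul_left _ (by omega)

@[simp] theorem arrWrites_stage (i n o tmp x : ℕ) (p : Prog) (a : ℕ) :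
    (stage i n o tmp x p).arrWrites a = (p.arrWrites a || a == tmp || a == x) := by
  simp [stage]

/-- Arithmetic of the costs of loops. -/
theorem loop_cost_le {N t b K l : ℕ} (hN : 1 ≤ N) (hl : l ≤ b) (ht : t ≤ K * b) :
    (N + 1) * (t + 40 * l) ≤ 2 * (K + 40) * (N * b) := by
  calc (N + 1) * (t + 40 * l) ≤ (2 * N) * (K * b + 40 * b) := by gcongr; omega
    _ = _ := by ring

theorem stage_cost_le {N t b K : ℕ} (hN : 1 ≤ N) (ht : t ≤ K * b) :
    (N + 1) * (t + 150 * b) ≤ 2 * (K + 150) * (N * b) := by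
  calc (N + 1) * (t + 150 * b) ≤ (2 * N) * (K * b + 150 * b) := by gcongr; omega
    _ = _ := by ring

/-! ### Evaluation of expressions, with a bound for the leaves -/

/-- The value of `e` is `v`, and its leaves are bounded by `b`. -/
structure Expr.Val (e : Expr) (S : State) (b : ℕ) (v : ℤ) : Prop where
  eval : e.eval S = v
  leaf : e.Leaf S b

namespace Expr.Val

variable {S : State} {b : ℕ} {x y : Expr} {v w : ℤ} {m n : ℕ}

theorem reg {r : ℕ} (h : S.reg r = v) (hv : len v ≤ b) : (Expr.reg r).Val S b v :=
  ⟨h, by simpa [Leaf, h] using hv⟩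

theorem regN {r : ℕ} (h : S.reg r = (n : ℤ)) (hn : n + 1 ≤ b) : (Expr.reg r).Val S b n :=
  reg h ((len_natCast_le n).trans hn)

theorem const (c : ℤ) : (Expr.const c).Val S b c := ⟨rfl, trivial⟩

theorem one : (Expr.const 1).Val S b ((1 : ℕ) : ℤ) := ⟨rfl, trivial⟩

theorem two : (Expr.const 2).Val S b ((2 : ℕ) : ℤ) := ⟨rfl, trivial⟩

theorem add (hx : x.Val S b v) (hy : y.Val S b w) : (Expr.add x y).Val S b (v + w) :=
  ⟨by simp [Expr.eval, hx.eval, hy.eval], hx.leaf, hy.leaf⟩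

theorem sub (hx : x.Val S b v) (hy : y.Val S b w) : (Expr.sub x y).Val S b (v - w) :=
  ⟨by simp [Expr.eval, hx.eval, hy.eval], hx.leaf, hy.leaf⟩

theorem shl (hx : x.Val S b v) (hy : y.Val S b n) (hn : n ≤ b) :
    (Expr.shl x y).Val S b (v * 2 ^ n) :=
  ⟨by simp [Expr.eval, hx.eval, hy.eval], hx.leaf, hy.leaf, by simpa [hy.eval] using hn⟩

theorem shr (hx : x.Val S b v) (hy : y.Val S b n) : (Expr.shr x y).Val S b (v / 2 ^ n) :=
  ⟨by simp [Expr.eval, hx.eval, hy.eval], hx.leaf, hy.leaf⟩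

theorem addN (hx : x.Val S b m) (hy : y.Val S b n) : (Expr.add x y).Val S b (m + n : ℕ) := by
  simpa using add hx hy

theorem subN (hx : x.Val S b m) (hy : y.Val S b n) (h : n ≤ m) :
    (Expr.sub x y).Val S b (m - n : ℕ) := by
  simpa [h] using sub hx hy

theorem shlN (hx : x.Val S b m) (hy : y.Val S b n) (hn : n ≤ b) :
    (Expr.shl x y).Val S b (m * 2 ^ n : ℕ) := by
  simpa using shl hx hy hn

theorem pow2 (hy : y.Val S b n) (hn : n ≤ b) :
    (Expr.shl (.const 1) y).Val S b (2 ^ n : ℕ) := by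
  simpa using shl (const 1) hy hn

theorem shrN (hx : x.Val S b m) (hy : y.Val S b n) : (Expr.shr x y).Val S b (m / 2 ^ n : ℕ) := by
  simpa using shr hx hy

/-- The `n` lowest bits. -/
theorem modN (hx : x.Val S b m) (hy : y.Val S b n) (hn : n ≤ b) :
    (Expr.sub x (.shl (.shr x y) y)).Val S b (m % 2 ^ n : ℕ) := by
  have := (hx.subN ((hx.shrN hy).shlN hy hn) (Nat.div_mul_le_self _ _))
  rwa [Nat.mod_eq_sub_div_mul]

theorem load {a : ℕ} (hx : x.Val S b w) (h : S.arr a w = v) (hv : len v ≤ b) :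
    (Expr.load a x).Val S b v :=
  ⟨by simp [Expr.eval, hx.eval, h], hx.leaf, by simpa [hx.eval, h] using hv⟩

theorem ite {c : Expr} {u : ℤ} (hc : c.Val S b u) (hx : 0 < u → x.Val S b v)
    (hy : ¬ 0 < u → y.Val S b w) : (Expr.ite c x y).Val S b (if 0 < u then v else w) := by
  refine ⟨?_, hc.leaf, fun h => (hx (hc.eval ▸ h)).leaf, fun h => (hy (hc.eval ▸ h)).leaf⟩
  simp only [Expr.eval, hc.eval]
  split_ifs with h
  · exact (hx h).eval
  · exact (hy h).eval

theorem cast (hx : x.Val S b v) (h : v = w) : x.Val S b w := h ▸ hx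

end Expr.Val

theorem Tri.block_nil {S : State} {b : ℕ} {Q : State → Prop} (hb : 1 ≤ b) (hQ : Q S) :
    Tri (BitRAM.block []) S (blockWeight [] * b) Q := Tri.block hb trivial le_rfl hQ

/-- Symbolic execution of one assignment. The value `v` is stated in mathematical terms, and its
`Val` certificate follows the syntax of the expression, so that correctness and length bounds are
checked together. -/
theorem Tri.block_cons {r : ℕ} {e : Expr} {l : List (ℕ × Expr)} {S : State} {v : ℤ} {b : ℕ}
    {Q : State → Prop} (hv : e.Val S b v) (hb : 1 ≤ b)
    (hl : Tri (BitRAM.block l) (S.setReg r v) (blockWeight l * b) Q)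
    (he : e.ok = true := by rfl) :
    Tri (BitRAM.block ((r, e) :: l)) S (blockWeight ((r, e) :: l) * b) Q := by
  have h1 : Tri (BitRAM.assign r e) S ((e.weight + e.growth + 2) * b)
      (fun S' => S' = S.setReg r v) := Tri.assign hb hv.leaf le_rfl (by rw [hv.eval]) he
  rw [blockWeight, add_mul]
  exact h1.seq fun S' _ h => h ▸ hl

/-- The array `a` of `S` starts with the first `N` values of `X`. -/
def Holds (S : State) (a N : ℕ) (X : ℕ → ℤ) : Prop := ∀ j < N, S.arr a (j : ℤ) = X j

theorem Holds.keep {S S' : State} {a N : ℕ} {X : ℕ → ℤ} {P : Prog} (h : Holds S a N X)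
    (hk : Keep P S S') (ha : P.arrWrites a = false) : Holds S' a N X :=
  fun j hj => (congrFun (hk.arr a ha) _).trans (h j hj)

theorem len_le_of_lt_two_pow {j g : ℕ} (h : j < 2 ^ g) : len (j : ℤ) ≤ g + 1 :=
  len_le_of_natAbs_lt (by simpa using h)

end BitRAM

/-! ### Programs for the stages of the multiplication -/

namespace BitRAM

open SSA

/-- Conventions for the multiplication: registers `16`, `17`, `18`, `19`, `30` hold `c`, `ℓ`, `k`,
`t`, `l`; `20` and `21` are the bound and the counter of a `stage`, whose result is in `22`. Array
`4` is scratch space. Here `23` receives the quotient. -/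
def redStepCode : List (ℕ × Expr) :=
  [(23, .shr (.add (.reg 22) (.shl (.const 1) (.sub (.reg 26) (.const 1)))) (.reg 26)),
   (22, .sub (.sub (.reg 22) (.shl (.reg 23) (.reg 26))) (.reg 23))]

def redIter : ℕ → Prog
  | 0 => block []
  | n + 1 => .seq (redIter n) (block redStepCode)

/-- Reduce register `22` modulo `2 ^ L + 1`, where `L` is in register `26`. -/
def redP : Prog := redIter 6

/-- The constant `K` depends on the program text alone and precedes all other quantifiers; the
running times of the larger programs have the same form. -/
theorem tri_redP : ∃ K, ∀ (S : State) (L b : ℕ) (x : ℤ), S.reg 22 = x → S.reg 26 = L → 2 ≤ L →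
    |x| ≤ 2 ^ (5 * L) → 5 * L + 2 ≤ b → Tri redP S (K * b) (fun S' => S'.reg 22 = red L x) := by
  refine ⟨1 + 6 * blockWeight redStepCode, fun S L b x hx hL hL2 hb hLb => ?_⟩
  have key : ∀ n, Tri (redIter n) S ((1 + n * blockWeight redStepCode) * b)
      (fun S' => S'.reg 22 = (redStep L)^[n] x ∧ S'.reg 26 = L) := by
    intro n
    induction n with
    | zero => exact Tri.block (b := b) (by omega) trivial (by simp [blockWeight]) ⟨hx, hL⟩
    | succ n ih =>
      rw [show (1 + (n + 1) * blockWeight redStepCode) * b =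
        (1 + n * blockWeight redStepCode) * b + blockWeight redStepCode * b by ring]
      refine ih.seq fun S' _ hS' => ?_
      have hy := (abs_iterate_redStep_le hL2 hb).1 n
      rw [Function.iterate_succ_apply']
      obtain ⟨h22, h26⟩ := hS'
      set y := (redStep L)^[n] x
      have l1 : len y ≤ b := (len_le_of_abs_le hy).trans hLb
      have e1 : (2 : ℤ) ^ (5 * L) = 2 ^ (4 * L) * 2 ^ L := by rw [← pow_add]; congr 1; omega
      have l3 : len (hi L y) ≤ b :=
        (len_le_of_abs_le (abs_hi_le (by omega) (hy.trans_eq e1))).trans (by omega)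
      have r26 : (Expr.reg 26).Val S' b (L : ℕ) := .regN h26 (by omega)
      refine Tri.block_cons (v := hi L y) (((Expr.Val.reg h22 l1).add
        ((r26.subN .one (by omega)).pow2 (by omega))).shr r26 |>.cast (by simp [hi])) (by omega) ?_
      have q26 : (Expr.reg 26).Val (S'.setReg 23 (hi L y)) b (L : ℕ) := .regN (by simp [h26]) (by omega)
      refine Tri.block_cons (v := redStep L y) (((Expr.Val.reg (by simpa using h22) l1).sub
        ((Expr.Val.reg (by simp) l3).shl q26 (by omega))).sub (.reg (by simp) l3)) (by omega) ?_
      exact Tri.block_nil (by omega) (by simp [h26])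
  exact (key 6).mono le_rfl fun S' h => h.1

/-- Parameters of a step that cuts residues into parts. -/
def chopPre : List (ℕ × Expr) :=
  [(27, .add (.reg 16) (.reg 19)),
   (20, .shl (.const 1) (.add (.reg 27) (.const 1))),
   (28, .shl (.const 1) (.sub (.sub (.reg 17) (.const 1)) (.reg 19)))]

def chopBody (a : ℕ) : List (ℕ × Expr) :=
  [(24, .shr (.reg 21) (.reg 27)),
   (22, .load a (.sub (.reg 21) (.shl (.reg 24) (.reg 27)))),
   (23, .shr (.add (.reg 22) (.shl (.const 1) (.sub (.reg 28) (.const 1)))) (.reg 28)),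
   (22, .ite (.reg 24) (.reg 23) (.sub (.reg 22) (.shl (.reg 23) (.reg 28))))]

def chopP (a : ℕ) : Prog := .seq (block chopPre) (stage 21 20 22 4 a (block (chopBody a)))

/-- The step yields `2 ^ (c + t + 1)` numbers of about `2 ^ (ℓ - 1 - t)` bits, which is `2 ^ (c +
ℓ)` bits for every `t`. The factor `c + ℓ + 1` pays for the addresses. -/
theorem tri_chopP : ∃ K, ∀ (S : State) (a c ℓ t : ℕ) (X : ℕ → ℤ), a ≠ 4 → S.reg 16 = c →
    S.reg 17 = ℓ → S.reg 19 = t → t < ℓ → Holds S a (2 ^ (c + t)) X →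
    (∀ r < 2 ^ (c + t), |X r| ≤ 2 ^ 2 ^ (ℓ - t)) →
    Tri (chopP a) S (K * (2 ^ (c + ℓ) * (c + ℓ + 1))) (fun S' =>
      Holds S' a (2 ^ (c + t + 1)) (chopStep (2 ^ (ℓ - 1 - t)) (2 ^ (c + t)) X)) := by
  refine ⟨10 * (blockWeight chopPre + 2 * (blockWeight (chopBody 0) + 150)), ?_⟩
  intro S a c ℓ t X ha h16 h17 h19 ht hX hXb
  obtain ⟨d, rfl⟩ : ∃ d, ℓ = d + 1 + t := ⟨ℓ - 1 - t, by omega⟩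
  rw [show d + 1 + t - t = d + 1 by omega] at hXb
  rw [show d + 1 + t - 1 - t = d by omega]
  set e := 2 ^ d with he
  have he1 : 1 ≤ e := Nat.one_le_two_pow
  have he2 : (2 : ℤ) ^ 2 ^ (d + 1) = 2 ^ e * 2 ^ e := by rw [← pow_add, pow_succ, mul_two]
  set N := 2 ^ (c + t + 1) with hNdef
  have hN1 : 1 ≤ N := Nat.one_le_two_pow
  set b := c + d + t + 5 + 2 * e with hb
  have hb1 : 1 ≤ b := by omega
  have hNlt : N < 2 ^ (c + t + 2) := Nat.pow_lt_pow_right (by omega) (by omega)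
  have hNl : len (N : ℤ) ≤ b := (len_le_of_lt_two_pow hNlt).trans (by omega)
  have hloop : (N + 1) * (blockWeight (chopBody a) * b + 150 * b) ≤
      2 * (blockWeight (chopBody 0) + 150) * (N * b) := stage_cost_le hN1 le_rfl
  have hNb : N * b ≤ 10 * (2 ^ (c + (d + 1 + t)) * (c + (d + 1 + t) + 1)) := by
    have h1 : N * e = 2 ^ (c + (d + 1 + t)) := by rw [hNdef, he, ← pow_add]; congr 1; omega
    rw [← h1]
    calc N * b = N * (c + d + t + 5) + 2 * (N * e) := by rw [hb]; ring
      _ ≤ N * e * (c + d + t + 5) + 2 * (N * e) := by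
        gcongr; exact Nat.le_mul_of_pos_right _ he1
      _ = N * e * (c + d + t + 7) := by ring
      _ ≤ N * e * (10 * (c + (d + 1 + t) + 1)) := by gcongr; omega
      _ = _ := by ring
  have hbN : b ≤ N * b := Nat.le_mul_of_pos_left _ hN1
  refine Tri.mono (t := blockWeight chopPre * b +
    (N + 1) * (blockWeight (chopBody a) * b + 150 * b)) (Tri.seq (Q₁ := fun S' =>
      S'.reg 27 = ((c + t : ℕ) : ℤ) ∧ S'.reg 20 = (N : ℤ) ∧ S'.reg 28 = (e : ℤ)) ?_ ?_) ?_
      fun _ h => h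
  · refine Tri.block_cons (.addN (.regN h16 (by omega)) (.regN h19 (by omega))) hb1 ?_
    refine Tri.block_cons (.pow2 (.addN (.regN rfl (by omega)) .one) (by omega)) hb1 ?_
    refine Tri.block_cons (.pow2 (.subN (.subN (.regN h17 (by omega)) .one (by omega))
      (.regN h19 (by omega)) (by omega)) (by omega)) hb1 ?_
    refine Tri.block_nil hb1 ⟨rfl, rfl, ?_⟩
    rw [show d + 1 + t - 1 - t = d by omega]
    rfl
  · rintro S₁ hk ⟨h27, h20, h28⟩
    have hX1 := hX.keep hk (by simp)
    have hlo : ∀ x, len (lo e x) ≤ b := fun x => (len_le_of_abs_le (abs_lo_le he1 x)).trans (by omega)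
    have hhi : ∀ r < 2 ^ (c + t), len (hi e (X r)) ≤ b := fun r hr =>
      (len_le_of_abs_le (abs_hi_le he1 ((hXb r hr).trans_eq he2))).trans (by omega)
    have hXl : ∀ r < 2 ^ (c + t), len (X r) ≤ b := fun r hr =>
      (len_le_of_abs_le (hXb r hr)).trans (by rw [pow_succ]; omega)
    refine Tri.stage _ h20 hNl (fun j hj => ?_) ?_ (by simp) (by omega)
    · rw [chopStep]
      split_ifs with h
      · exact hlo _
      · exact hhi _ (two_pow_succ_split (t := t) hj h)
    intro j hj S' hij hk'
    have g27 : S'.reg 27 = ((c + t : ℕ) : ℤ) := (hk'.reg 27 (by decide) rfl).trans h27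
    have g28 : S'.reg 28 = (e : ℤ) := (hk'.reg 28 (by decide) rfl).trans h28
    have gX := hX1.keep hk' (by simpa using ha)
    have hlj : len (j : ℤ) ≤ b := (len_natCast_mono hj.le).trans hNl
    have hq : j / 2 ^ (c + t) < 2 := by
      apply Nat.div_lt_of_lt_mul
      rwa [← pow_succ]
    have hm : j % 2 ^ (c + t) < 2 ^ (c + t) := Nat.mod_lt _ (Nat.two_pow_pos _)
    refine Tri.block_cons (.shrN (.reg hij hlj) (.regN g27 (by omega))) hb1 ?_
    refine Tri.block_cons (v := X (j % 2 ^ (c + t))) (.load (.subN (.reg hij hlj)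
      (.shlN (.regN rfl (by omega)) (.regN g27 (by omega)) (by omega))
        (Nat.div_mul_le_self _ _)) ?_ (hXl _ hm)) hb1 ?_
    · rw [← gX _ hm, Nat.mod_eq_sub_div_mul]
      rfl
    refine Tri.block_cons (v := hi e (X (j % 2 ^ (c + t)))) (.cast (.shr (.add (.reg rfl (hXl _ hm))
      (.pow2 (.subN (.regN g28 (by omega)) .one he1) (by omega))) (.regN g28 (by omega)))
        (by simp [hi])) hb1 ?_
    refine Tri.block_cons (.ite (.regN rfl (by omega)) (fun _ => .reg rfl (hhi _ hm))
      fun _ => .sub (.reg rfl (hXl _ hm)) (.shl (.reg rfl (hhi _ hm)) (.regN g28 (by omega))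
          (by omega))) hb1 ?_
    refine Tri.block_nil hb1 ?_
    rw [chopStep]
    by_cases h : j < 2 ^ (c + t)
    · simp [h, Nat.div_eq_of_lt h, Nat.mod_eq_of_lt h, lo]
    · have h1 : j / 2 ^ (c + t) = 1 := by
        have := (Nat.one_le_div_iff (Nat.two_pow_pos (c + t))).2 (by omega : 2 ^ (c + t) ≤ j)
        omega
      simp [h, h1, Nat.mod_eq_sub_div_mul]
  · refine (add_le_add (Nat.mul_le_mul_left _ hbN) hloop).trans ?_
    rw [← add_mul]
    refine (Nat.mul_le_mul_left _ hNb).trans_eq ?_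
    ring

end BitRAM

/-! ### Butterflies of the transform and recombination of the parts -/

namespace BitRAM

open SSA

/-- Parameters of a butterfly step. -/
def fftPre : List (ℕ × Expr) :=
  [(27, .add (.reg 16) (.reg 19)),
   (20, .shl (.const 1) (.add (.reg 16) (.reg 18))),
   (26, .shl (.const 1) (.reg 30)),
   (31, .sub (.sub (.reg 30) (.reg 19)) (.const 1))]

/-- Register `24` becomes bit `c + t` of the index, `25` the index with this bit cleared, and `28`
the twist. -/
def fftBody (a : ℕ) : List (ℕ × Expr) :=
  [(24, .shr (.reg 21) (.reg 27)),
   (24, .sub (.reg 24) (.shl (.shr (.reg 24) (.const 1)) (.const 1))),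
   (25, .sub (.reg 21) (.shl (.reg 24) (.reg 27))),
   (29, .shr (.reg 21) (.reg 16)),
   (37, .add (.reg 19) (.const 1)),
   (29, .sub (.reg 29) (.shl (.shr (.reg 29) (.reg 37)) (.reg 37))),
   (28, .shl (.add (.shl (.reg 29) (.const 1)) (.const 1)) (.reg 31)),
   (22, .add (.load a (.reg 25)) (.shl (.load a (.add (.reg 25) (.shl (.const 1) (.reg 27))))
      (.reg 28)))]

/-- The twist is taken at the cleared index, because the minus sign of the difference is explicit
here. -/
def ifftBody (a : ℕ) : List (ℕ × Expr) :=
  [(24, .shr (.reg 21) (.reg 27)),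
   (24, .sub (.reg 24) (.shl (.shr (.reg 24) (.const 1)) (.const 1))),
   (25, .sub (.reg 21) (.shl (.reg 24) (.reg 27))),
   (29, .shr (.reg 25) (.reg 16)),
   (37, .add (.reg 19) (.const 1)),
   (29, .sub (.reg 29) (.shl (.shr (.reg 29) (.reg 37)) (.reg 37))),
   (28, .shl (.add (.shl (.reg 29) (.const 1)) (.const 1)) (.reg 31)),
   (32, .load a (.reg 25)),
   (33, .load a (.add (.reg 25) (.shl (.const 1) (.reg 27)))),
   (37, .sub (.shl (.const 2) (.reg 30)) (.const 1)),
   (22, .ite (.reg 24) (.shl (.sub (.reg 32) (.reg 33)) (.sub (.reg 37) (.reg 28)))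
      (.shl (.add (.reg 32) (.reg 33)) (.reg 37)))]

def fftP (a : ℕ) : Prog :=
  .seq (block fftPre) (stage 21 20 22 4 a (.seq (block (fftBody a)) redP))

def ifftP (a : ℕ) : Prog :=
  .seq (block fftPre) (stage 21 20 22 4 a (.seq (block (ifftBody a)) redP))

theorem arrWrites_redIter (n a : ℕ) : (redIter n).arrWrites a = false := by
  induction n with
  | zero => simp [redIter]
  | succ n ih => simp [redIter, ih]

@[simp] theorem arrWrites_redP (a : ℕ) : redP.arrWrites a = false := arrWrites_redIter 6 a

theorem tri_fftPre {S : State} {c k l t b : ℕ} (h16 : S.reg 16 = c) (h18 : S.reg 18 = k)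
    (h19 : S.reg 19 = t) (h30 : S.reg 30 = l) (htk : t < k) (hkl : k ≤ l)
    (hb : b = 10 * 2 ^ l + (c + k + l) + 10) :
    Tri (block fftPre) S (blockWeight fftPre * b) (fun S' => S'.reg 27 = ((c + t : ℕ) : ℤ) ∧
      S'.reg 20 = ((2 ^ (c + k) : ℕ) : ℤ) ∧ S'.reg 26 = ((2 ^ l : ℕ) : ℤ) ∧
      S'.reg 31 = ((l - t - 1 : ℕ) : ℤ)) := by
  have hb1 : 1 ≤ b := by omega
  refine Tri.block_cons (.addN (.regN h16 (by omega)) (.regN h19 (by omega))) hb1 ?_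
  refine Tri.block_cons (.pow2 (.addN (.regN h16 (by omega)) (.regN h18 (by omega))) (by omega)) hb1 ?_
  refine Tri.block_cons (.pow2 (.regN h30 (by omega)) (by omega)) hb1 ?_
  refine Tri.block_cons (.subN (.subN (.regN h30 (by omega)) (.regN h19 (by omega)) (by omega)) .one
    (by omega)) hb1 ?_
  exact Tri.block_nil hb1 ⟨rfl, rfl, rfl, rfl⟩

/-- There are `2 ^ (c + k)` entries of `O(2 ^ l)` bits each, plus addresses. With `k = 0` the
estimate also serves the final reduction. -/
theorem fft_cost_le {c k l b N : ℕ} (hN : N = 2 ^ (c + k)) (hb : b = 10 * 2 ^ l + (c + k + l) + 10)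
    (K₁ K₂ : ℕ) :
    K₁ * b + (N + 1) * (K₂ * b + 150 * b) ≤
      20 * (K₁ + 2 * (K₂ + 150)) * (2 ^ (c + k + l) * (c + k + l + 1)) := by
  have hN1 : 1 ≤ N := by rw [hN]; exact Nat.one_le_two_pow
  have hNb : N * b ≤ 20 * (2 ^ (c + k + l) * (c + k + l + 1)) := by
    have h1 : N * 2 ^ l = 2 ^ (c + k + l) := by rw [hN, ← pow_add]
    rw [← h1]
    calc N * b = N * (c + k + l + 10) + 10 * (N * 2 ^ l) := by rw [hb]; ring
      _ ≤ N * 2 ^ l * (c + k + l + 10) + 10 * (N * 2 ^ l) := by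
        gcongr; exact Nat.le_mul_of_pos_right _ (Nat.two_pow_pos _)
      _ = N * 2 ^ l * (c + k + l + 20) := by ring
      _ ≤ N * 2 ^ l * (20 * (c + k + l + 1)) := by gcongr; omega
      _ = _ := by ring
  have hbN : b ≤ N * b := Nat.le_mul_of_pos_left _ hN1
  refine (add_le_add (Nat.mul_le_mul_left _ hbN)
    (stage_cost_le (K := K₂) hN1 le_rfl)).trans ?_
  rw [← add_mul]
  refine (Nat.mul_le_mul_left _ hNb).trans_eq ?_
  ring

theorem tri_fftP : ∃ K, ∀ (S : State) (a c k l t : ℕ) (X : ℕ → ℤ), a ≠ 4 → S.reg 16 = c →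
    S.reg 18 = k → S.reg 19 = t → S.reg 30 = l → t < k → k ≤ l → 1 ≤ l →
    Holds S a (2 ^ (c + k)) X → (∀ r < 2 ^ (c + k), |X r| ≤ 2 ^ 2 ^ l) →
    Tri (fftP a) S (K * (2 ^ (c + k + l) * (c + k + l + 1))) (fun S' =>
      Holds S' a (2 ^ (c + k)) (fun r => red (2 ^ l) (fftArg c l t X r))) := by
  obtain ⟨Kr, hred⟩ := tri_redP
  refine ⟨20 * (blockWeight fftPre + 2 * (blockWeight (fftBody 0) + Kr + 150)), ?_⟩
  intro S a c k l t X ha h16 h18 h19 h30 htk hkl hl hX hXb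
  obtain ⟨b, hb⟩ : ∃ b, b = 10 * 2 ^ l + (c + k + l) + 10 := ⟨_, rfl⟩
  obtain ⟨N, hN⟩ : ∃ N, N = 2 ^ (c + k) := ⟨_, rfl⟩
  have hb1 : 1 ≤ b := by omega
  have hL := two_le_two_pow hl
  rw [← hN]
  refine Tri.mono (t := blockWeight fftPre * b + (N + 1) *
    ((blockWeight (fftBody 0) + Kr) * b + 150 * b)) (Tri.seq
    (tri_fftPre h16 h18 h19 h30 htk hkl hb) ?_) (fft_cost_le hN hb _ _) fun _ h => h
  rintro S₁ hk ⟨h27, h20, h26, h31⟩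
  have hX1 := hX.keep hk (by simp)
  have hNl : len (N : ℤ) ≤ b := (len_le_of_lt_two_pow (g := c + k + 1)
    (hN ▸ Nat.pow_lt_pow_right (by omega) (by omega))).trans (by omega)
  have hXl : ∀ r < 2 ^ (c + k), len (X r) ≤ b := fun r hr =>
    (len_le_of_abs_le (hXb r hr)).trans (by omega)
  have harg : ∀ j < 2 ^ (c + k), |fftArg c l t X j| ≤ 2 ^ (5 * 2 ^ l) := fun j hj =>
    abs_fftArg_le (by omega) (by omega) hXb hj
  refine Tri.stage _ (hN ▸ h20) hNl (fun j hj => (len_le_of_abs_le (abs_red_le_pow hl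
    (harg j (hN ▸ hj)))).trans (by omega)) ?_ (by simp) (by omega)
  intro j hj S' hij hk'
  have g16 : S'.reg 16 = c := (hk'.reg 16 (by decide) rfl).trans
    ((hk.reg 16 (by decide) rfl).trans h16)
  have g19 : S'.reg 19 = t := (hk'.reg 19 (by decide) rfl).trans
    ((hk.reg 19 (by decide) rfl).trans h19)
  have g27 : S'.reg 27 = ((c + t : ℕ) : ℤ) := (hk'.reg 27 (by decide) rfl).trans h27
  have g26 : S'.reg 26 = ((2 ^ l : ℕ) : ℤ) := (hk'.reg 26 (by decide) rfl).trans h26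
  have g31 : S'.reg 31 = ((l - t - 1 : ℕ) : ℤ) := (hk'.reg 31 (by decide) rfl).trans h31
  have gX := hX1.keep hk' (by simpa using ha)
  have hlj : len (j : ℤ) ≤ b := (len_natCast_mono hj.le).trans hNl
  rw [hN] at hj
  have hr0 : clearBit (c + t) j < 2 ^ (c + k) := (clearBit_le _ _).trans_lt hj
  have hr1 : clearBit (c + t) j + 2 ^ (c + t) < 2 ^ (c + k) := clearBit_add_lt (by omega) hj
  have hlr : len (clearBit (c + t) j : ℤ) ≤ b := (len_natCast_mono (clearBit_le _ _)).trans hlj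
  have htw := twist_lt (c := c) (l := l) (t := t) (r := j) (by omega)
  have hdiv : ∀ m, len ((j / m : ℕ) : ℤ) ≤ b := fun m =>
    (len_natCast_mono (Nat.div_le_self _ _)).trans hlj
  have hmod : ∀ m m', len ((j / m % m' : ℕ) : ℤ) ≤ b := fun m m' =>
    (len_natCast_mono (Nat.mod_le _ _)).trans (hdiv m)
  rw [add_mul]
  refine Tri.seq (t₁ := blockWeight (fftBody 0) * b) (Q₁ := fun S'' => S''.reg 22 = fftArg c l t X j)
    ?_ fun S'' hk'' h22 => hred S'' (2 ^ l) b _ h22 ((hk''.reg 26 (by decide) rfl).trans g26) hL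
      (harg j hj) (by omega)
  refine Tri.block_cons (.shrN (.reg hij hlj) (.regN g27 (by omega))) hb1 ?_
  refine Tri.block_cons (.modN (n := 1) (.reg rfl (hdiv _)) .one (by omega)) hb1 ?_
  refine Tri.block_cons (.cast (w := (clearBit (c + t) j : ℕ)) (.subN (.reg hij hlj)
    (.shlN (.reg rfl (hmod _ _)) (.regN g27 (by omega)) (by omega)) ?_) ?_) hb1 ?_
  · exact (Nat.mul_le_mul_right _ (Nat.mod_le _ _)).trans (Nat.div_mul_le_self _ _)
  · rfl
  refine Tri.block_cons (.shrN (.reg hij hlj) (.regN g16 (by omega))) hb1 ?_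
  refine Tri.block_cons (.addN (.regN g19 (by omega)) .one) hb1 ?_
  refine Tri.block_cons (.modN (.reg rfl (hdiv _)) (.regN rfl (by omega)) (by omega)) hb1 ?_
  refine Tri.block_cons (.cast (w := (twist c l t j : ℕ)) (.shlN (.addN (.shlN (n := 1)
    (.reg rfl (hmod _ _)) .one (by omega)) .one) (.regN g31 (by omega)) (by omega)) ?_) hb1 ?_
  · rw [twist, pow_one, mul_comm 2]
  refine Tri.block_cons (v := fftArg c l t X j) (.add (.load (.reg rfl hlr) (gX _ hr0) (hXl _ hr0))
    (.shl (.load (.addN (.reg rfl hlr) (.pow2 (.regN g27 (by omega)) (by omega))) (gX _ hr1)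
      (hXl _ hr1)) (.regN rfl (by omega)) (by omega))) hb1 ?_
  exact Tri.block_nil hb1 rfl

theorem tri_ifftP : ∃ K, ∀ (S : State) (a c k l t : ℕ) (X : ℕ → ℤ), a ≠ 4 → S.reg 16 = c →
    S.reg 18 = k → S.reg 19 = t → S.reg 30 = l → t < k → k ≤ l → 1 ≤ l →
    Holds S a (2 ^ (c + k)) X → (∀ r < 2 ^ (c + k), |X r| ≤ 2 ^ 2 ^ l) →
    Tri (ifftP a) S (K * (2 ^ (c + k + l) * (c + k + l + 1))) (fun S' =>
      Holds S' a (2 ^ (c + k)) (fun r => red (2 ^ l) (ifftArg c l t X r))) := by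
  obtain ⟨Kr, hred⟩ := tri_redP
  refine ⟨20 * (blockWeight fftPre + 2 * (blockWeight (ifftBody 0) + Kr + 150)), ?_⟩
  intro S a c k l t X ha h16 h18 h19 h30 htk hkl hl hX hXb
  obtain ⟨b, hb⟩ : ∃ b, b = 10 * 2 ^ l + (c + k + l) + 10 := ⟨_, rfl⟩
  obtain ⟨N, hN⟩ : ∃ N, N = 2 ^ (c + k) := ⟨_, rfl⟩
  have hb1 : 1 ≤ b := by omega
  have hL := two_le_two_pow hl
  rw [← hN]
  refine Tri.mono (t := blockWeight fftPre * b + (N + 1) *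
    ((blockWeight (ifftBody 0) + Kr) * b + 150 * b)) (Tri.seq
    (tri_fftPre h16 h18 h19 h30 htk hkl hb) ?_) (fft_cost_le hN hb _ _) fun _ h => h
  rintro S₁ hk ⟨h27, h20, h26, h31⟩
  have hX1 := hX.keep hk (by simp)
  have hNl : len (N : ℤ) ≤ b := (len_le_of_lt_two_pow (g := c + k + 1)
    (hN ▸ Nat.pow_lt_pow_right (by omega) (by omega))).trans (by omega)
  have hXl : ∀ r < 2 ^ (c + k), len (X r) ≤ b := fun r hr =>
    (len_le_of_abs_le (hXb r hr)).trans (by omega)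
  have harg : ∀ j < 2 ^ (c + k), |ifftArg c l t X j| ≤ 2 ^ (5 * 2 ^ l) := fun j hj =>
    abs_ifftArg_le (by omega) hXb hj
  refine Tri.stage _ (hN ▸ h20) hNl (fun j hj => (len_le_of_abs_le (abs_red_le_pow hl
    (harg j (hN ▸ hj)))).trans (by omega)) ?_ (by simp) (by omega)
  intro j hj S' hij hk'
  have g16 : S'.reg 16 = c := (hk'.reg 16 (by decide) rfl).trans
    ((hk.reg 16 (by decide) rfl).trans h16)
  have g19 : S'.reg 19 = t := (hk'.reg 19 (by decide) rfl).trans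
    ((hk.reg 19 (by decide) rfl).trans h19)
  have g30 : S'.reg 30 = l := (hk'.reg 30 (by decide) rfl).trans
    ((hk.reg 30 (by decide) rfl).trans h30)
  have g27 : S'.reg 27 = ((c + t : ℕ) : ℤ) := (hk'.reg 27 (by decide) rfl).trans h27
  have g26 : S'.reg 26 = ((2 ^ l : ℕ) : ℤ) := (hk'.reg 26 (by decide) rfl).trans h26
  have g31 : S'.reg 31 = ((l - t - 1 : ℕ) : ℤ) := (hk'.reg 31 (by decide) rfl).trans h31
  have gX := hX1.keep hk' (by simpa using ha)
  have hlj : len (j : ℤ) ≤ b := (len_natCast_mono hj.le).trans hNl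
  rw [hN] at hj
  have hr0 : clearBit (c + t) j < 2 ^ (c + k) := (clearBit_le _ _).trans_lt hj
  have hr1 : clearBit (c + t) j + 2 ^ (c + t) < 2 ^ (c + k) := clearBit_add_lt (by omega) hj
  have hlr : len (clearBit (c + t) j : ℤ) ≤ b := (len_natCast_mono (clearBit_le _ _)).trans hlj
  have htw := twist_lt (c := c) (l := l) (t := t) (r := clearBit (c + t) j) (by omega)
  have hdiv : ∀ m, len ((j / m : ℕ) : ℤ) ≤ b := fun m =>
    (len_natCast_mono (Nat.div_le_self _ _)).trans hlj
  have hmod : ∀ m m', len ((j / m % m' : ℕ) : ℤ) ≤ b := fun m m' =>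
    (len_natCast_mono (Nat.mod_le _ _)).trans (hdiv m)
  have hdiv' : ∀ m, len ((clearBit (c + t) j / m : ℕ) : ℤ) ≤ b := fun m =>
    (len_natCast_mono (Nat.div_le_self _ _)).trans hlr
  have hmod' : ∀ m m', len ((clearBit (c + t) j / m % m' : ℕ) : ℤ) ≤ b := fun m m' =>
    (len_natCast_mono (Nat.mod_le _ _)).trans (hdiv' m)
  rw [add_mul]
  refine Tri.seq (t₁ := blockWeight (ifftBody 0) * b) (Q₁ := fun S'' => S''.reg 22 = ifftArg c l t X j)
    ?_ fun S'' hk'' h22 => hred S'' (2 ^ l) b _ h22 ((hk''.reg 26 (by decide) rfl).trans g26) hL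
      (harg j hj) (by omega)
  refine Tri.block_cons (.shrN (.reg hij hlj) (.regN g27 (by omega))) hb1 ?_
  refine Tri.block_cons (.modN (n := 1) (.reg rfl (hdiv _)) .one (by omega)) hb1 ?_
  refine Tri.block_cons (.cast (w := (clearBit (c + t) j : ℕ)) (.subN (.reg hij hlj)
    (.shlN (.reg rfl (hmod _ _)) (.regN g27 (by omega)) (by omega)) ?_) ?_) hb1 ?_
  · exact (Nat.mul_le_mul_right _ (Nat.mod_le _ _)).trans (Nat.div_mul_le_self _ _)
  · rfl
  refine Tri.block_cons (.shrN (.reg rfl hlr) (.regN g16 (by omega))) hb1 ?_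
  refine Tri.block_cons (.addN (.regN g19 (by omega)) .one) hb1 ?_
  refine Tri.block_cons (.modN (.reg rfl (hdiv' _)) (.regN rfl (by omega)) (by omega)) hb1 ?_
  refine Tri.block_cons (.cast (w := (twist c l t (clearBit (c + t) j) : ℕ)) (.shlN (.addN
    (.shlN (n := 1) (.reg rfl (hmod' _ _)) .one (by omega)) .one) (.regN g31 (by omega))
    (by omega)) ?_) hb1 ?_
  · rw [twist, pow_one, mul_comm 2]
  refine Tri.block_cons (.load (.reg rfl hlr) (gX _ hr0) (hXl _ hr0)) hb1 ?_
  refine Tri.block_cons (.load (.addN (.reg rfl hlr) (.pow2 (.regN g27 (by omega)) (by omega)))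
    (gX _ hr1) (hXl _ hr1)) hb1 ?_
  refine Tri.block_cons (.subN (.shlN .two (.regN g30 (by omega)) (by omega)) .one (by omega)) hb1 ?_
  refine Tri.block_cons (v := ifftArg c l t X j) (.cast (.ite (u := (j / 2 ^ (c + t) % 2 : ℕ))
    (.reg rfl (by simpa using hmod (2 ^ (c + t)) 2))
    (fun _ => .shl (v := X (clearBit (c + t) j) - X (clearBit (c + t) j + 2 ^ (c + t)))
      (.sub (.reg rfl (hXl _ hr0)) (.reg rfl (hXl _ hr1)))
      (.subN (n := twist c l t (clearBit (c + t) j)) (m := 2 * 2 ^ l - 1) (.regN rfl (by omega))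
        (.regN rfl (by omega)) (by omega)) (by omega))
    fun _ => .shl (v := X (clearBit (c + t) j) + X (clearBit (c + t) j + 2 ^ (c + t)))
      (.add (.reg rfl (hXl _ hr0)) (.reg rfl (hXl _ hr1)))
      (.regN (n := 2 * 2 ^ l - 1) rfl (by omega)) (by omega)) ?_) hb1 (Tri.block_nil hb1 rfl)
  rw [ifftArg]
  by_cases h : j / 2 ^ (c + t) % 2 = 0
  · rw [h]
    simp
  · rw [if_neg h, if_pos (by exact_mod_cast Nat.pos_of_ne_zero h)]

/-- Parameters of a step that puts parts together. -/
def unchopPre : List (ℕ × Expr) :=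
  [(27, .add (.reg 16) (.reg 19)),
   (20, .shl (.const 1) (.reg 27)),
   (28, .shl (.const 1) (.sub (.sub (.reg 17) (.const 1)) (.reg 19)))]

def unchopBody (a : ℕ) : List (ℕ × Expr) :=
  [(22, .add (.load a (.reg 21)) (.shl (.load a (.add (.reg 21) (.shl (.const 1) (.reg 27))))
    (.reg 28)))]

def unchopP (a : ℕ) : Prog :=
  .seq (block unchopPre) (stage 21 20 22 4 a (block (unchopBody a)))

theorem tri_unchopP : ∃ K, ∀ (S : State) (a c ℓ k l t : ℕ) (X : ℕ → ℤ), a ≠ 4 → S.reg 16 = c →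
    S.reg 17 = ℓ → S.reg 19 = t → t < k → k ≤ ℓ → l + k = ℓ + 2 →
    Holds S a (2 ^ (c + t + 1)) X →
    (∀ r < 2 ^ (c + t + 1), |X r| ≤ 2 ^ (2 * 2 ^ (ℓ - 1 - t) + 2 ^ l)) →
    Tri (unchopP a) S (K * (2 ^ (c + k + l) * (c + k + l + 1))) (fun S' =>
      Holds S' a (2 ^ (c + t)) (fun r => X r + X (r + 2 ^ (c + t)) * 2 ^ 2 ^ (ℓ - 1 - t))) := by
  refine ⟨20 * (blockWeight unchopPre + 2 * (blockWeight (unchopBody 0) + 150)), ?_⟩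
  intro S a c ℓ k l t X ha h16 h17 h19 htk hkℓ hlk hX hXb
  obtain ⟨e, he⟩ : ∃ e, e = 2 ^ (ℓ - 1 - t) := ⟨_, rfl⟩
  obtain ⟨N, hN⟩ : ∃ N, N = 2 ^ (c + t) := ⟨_, rfl⟩
  obtain ⟨b, hb⟩ : ∃ b, b = 4 * e + 2 ^ l + (c + k + l) + 10 := ⟨_, rfl⟩
  have hl0 := Nat.two_pow_pos l
  have hb1 : 1 ≤ b := by omega
  have he1 : 1 ≤ e := he ▸ Nat.one_le_two_pow
  have hN1 : 1 ≤ N := hN ▸ Nat.one_le_two_pow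
  rw [← he] at hXb ⊢
  rw [← hN]
  rw [pow_succ, ← hN] at hX hXb
  have hNb : N * b ≤ 20 * (2 ^ (c + k + l) * (c + k + l + 1)) := by
    have h1 : N * e ≤ 2 ^ (c + k + l) := by
      rw [hN, he, ← pow_add]; exact Nat.pow_le_pow_right (by omega) (by omega)
    have h2 : N * 2 ^ l ≤ 2 ^ (c + k + l) := by
      rw [hN, ← pow_add]; exact Nat.pow_le_pow_right (by omega) (by omega)
    have h3 : N ≤ 2 ^ (c + k + l) := by
      rw [hN]; exact Nat.pow_le_pow_right (by omega) (by omega)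
    calc N * b = N * (c + k + l + 10) + (4 * (N * e) + N * 2 ^ l) := by rw [hb]; ring
      _ ≤ 2 ^ (c + k + l) * (c + k + l + 10) + (4 * 2 ^ (c + k + l) + 2 ^ (c + k + l)) := by gcongr
      _ = 2 ^ (c + k + l) * (c + k + l + 15) := by ring
      _ ≤ 2 ^ (c + k + l) * (20 * (c + k + l + 1)) := by gcongr; omega
      _ = _ := by ring
  have hbN : b ≤ N * b := Nat.le_mul_of_pos_left _ hN1
  refine Tri.mono (t := blockWeight unchopPre * b + (N + 1) *
    (blockWeight (unchopBody 0) * b + 150 * b)) (Tri.seq (Q₁ := fun S' =>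
      S'.reg 27 = ((c + t : ℕ) : ℤ) ∧ S'.reg 20 = (N : ℤ) ∧ S'.reg 28 = (e : ℤ)) ?_ ?_) ?_
      fun _ h => h
  · refine Tri.block_cons (.addN (.regN h16 (by omega)) (.regN h19 (by omega))) hb1 ?_
    refine Tri.block_cons (.pow2 (.regN rfl (by omega)) (by omega)) hb1 ?_
    refine Tri.block_cons (.pow2 (.subN (.subN (.regN h17 (by omega)) .one (by omega))
      (.regN h19 (by omega)) (by omega)) (by omega)) hb1 ?_
    exact Tri.block_nil hb1 ⟨rfl, hN ▸ rfl, he ▸ rfl⟩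
  · rintro S₁ hk ⟨h27, h20, h28⟩
    have hX1 := hX.keep hk (by simp)
    have hNl : len (N : ℤ) ≤ b := (len_le_of_lt_two_pow (g := c + t + 1)
      (hN ▸ Nat.pow_lt_pow_right (by omega) (by omega))).trans (by omega)
    have hXl : ∀ r < N * 2, len (X r) ≤ b := fun r hr =>
      (len_le_of_abs_le (hXb r hr)).trans (by omega)
    refine Tri.stage _ h20 hNl (fun j hj => ?_) ?_ (by simp) (by omega)
    · refine (len_le_of_abs_le (k := 3 * e + 2 ^ l + 1) ?_).trans (by omega)
      have h1 := hXb j (by omega)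
      have h2 := hXb (j + N) (by omega)
      calc _ ≤ (2 : ℤ) ^ (2 * e + 2 ^ l) + 2 ^ (2 * e + 2 ^ l) * 2 ^ e := by
            refine (abs_add_le _ _).trans (add_le_add h1 ?_)
            rw [abs_mul, abs_of_pos (by positivity : (0 : ℤ) < 2 ^ e)]
            gcongr
        _ ≤ 2 ^ (3 * e + 2 ^ l) + 2 ^ (3 * e + 2 ^ l) := by
            rw [← pow_add]
            exact add_le_add (pow_le_pow_right₀ (by norm_num) (by omega))
              (pow_le_pow_right₀ (by norm_num) (by omega))
        _ = 2 ^ (3 * e + 2 ^ l + 1) := by ring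
    intro j hj S' hij hk'
    have g27 : S'.reg 27 = ((c + t : ℕ) : ℤ) := (hk'.reg 27 (by decide) rfl).trans h27
    have g28 : S'.reg 28 = (e : ℤ) := (hk'.reg 28 (by decide) rfl).trans h28
    have gX := hX1.keep hk' (by simpa using ha)
    have hlj : len (j : ℤ) ≤ b := (len_natCast_mono hj.le).trans hNl
    refine Tri.block_cons (.add (.load (.reg hij hlj) (gX j (by omega)) (hXl j (by omega)))
      (.shl (.load (v := X (j + N)) (.addN (.reg hij hlj) (.pow2 (.regN g27 (by omega)) (by omega)))
        (by rw [← hN]; exact gX (j + N) (by omega)) (hXl _ (by omega)))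
        (.regN g28 (by omega)) (by omega))) hb1 ?_
    exact Tri.block_nil hb1 rfl
  · refine (add_le_add (Nat.mul_le_mul_left _ hbN)
      (stage_cost_le (K := blockWeight (unchopBody 0)) hN1 le_rfl)).trans ?_
    rw [← add_mul]
    refine (Nat.mul_le_mul_left _ hNb).trans_eq ?_
    ring

end BitRAM

namespace BitRAM

open SSA

/-! ### One level of the multiplication -/

theorem Tri.le {P : Prog} {S : State} {t t' : ℕ} {Q : State → Prop} (h : Tri P S t Q)
    (ht : t ≤ t') : Tri P S t' Q := h.mono ht fun _ h => h

theorem arrWrites_chopP (a x : ℕ) : (chopP a).arrWrites x = (x == 4 || x == a) := by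
  simp [chopP]

theorem arrWrites_fftP (a x : ℕ) : (fftP a).arrWrites x = (x == 4 || x == a) := by
  simp [fftP]

theorem arrWrites_ifftP (a x : ℕ) : (ifftP a).arrWrites x = (x == 4 || x == a) := by
  simp [ifftP]

theorem arrWrites_unchopP (a x : ℕ) : (unchopP a).arrWrites x = (x == 4 || x == a) := by
  simp [unchopP]

def fwdP (a : ℕ) : Prog := .seq (forLoop 19 18 (chopP a)) (forLoop 19 18 (fftP a))

theorem arrWrites_fwdP (a x : ℕ) : (fwdP a).arrWrites x = (x == 4 || x == a) := by
  simp [fwdP, arrWrites_chopP, arrWrites_fftP]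

/-- A level consists of `k ≤ P` steps, which costs one more factor `P + 1`; here `P = c + ℓ + 2`,
which is also `c + k + l`. -/
theorem level_cost_le {k P : ℕ} (hk : k ≤ P) (K : ℕ) {t : ℕ} (ht : t ≤ K * (2 ^ P * (P + 1))) :
    (k + 1) * (t + 40 * len (k : ℤ)) ≤ (K + 40) * (2 ^ P * (P + 1) ^ 2) := by
  have h1 : len (k : ℤ) ≤ P + 1 := (len_natCast_le k).trans (by omega)
  have h2 : P + 1 ≤ 2 ^ P * (P + 1) := Nat.le_mul_of_pos_left _ (Nat.two_pow_pos P)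
  calc _ ≤ (P + 1) * (K * (2 ^ P * (P + 1)) + 40 * (2 ^ P * (P + 1))) := by gcongr; omega
    _ = _ := by ring

theorem tri_fwdP : ∃ K, ∀ (S : State) (a c ℓ : ℕ) (X : ℕ → ℤ), a ≠ 4 → S.reg 16 = c →
    S.reg 17 = ℓ → S.reg 18 = parts ℓ → S.reg 30 = next ℓ → 5 ≤ ℓ →
    Holds S a (2 ^ c) X → (∀ r < 2 ^ c, |X r| ≤ 2 ^ 2 ^ ℓ) →
    Tri (fwdP a) S (K * (2 ^ (c + ℓ + 2) * (c + ℓ + 2 + 1) ^ 2)) (fun S' =>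
      Holds S' a (2 ^ (c + parts ℓ)) (fwd c ℓ X)) := by
  obtain ⟨K₁, h₁⟩ := tri_chopP
  obtain ⟨K₂, h₂⟩ := tri_fftP
  refine ⟨K₁ + 40 + (K₂ + 40), ?_⟩
  intro S a c ℓ X ha h16 h17 h18 h30 hℓ hX hXb
  obtain ⟨k2, kℓ, kl, lℓ, l4, hlk⟩ := parts_facts hℓ
  have hch := fun {t} (ht : t ≤ ℓ) => abs_chop_le hXb (t := t) ht
  rw [add_mul]
  refine Tri.seq ((Tri.forLoop h18 (t := K₁ * (2 ^ (c + ℓ) * (c + ℓ + 1)))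
    (fun j S' => Holds S' a (2 ^ (c + j)) (chop c ℓ j X)) hX ?_).mono ?_ fun _ h => h.1) ?_
  · intro j hj S' hij hk hI
    exact h₁ S' a c ℓ j _ ha ((hk.reg 16 (by decide) rfl).trans h16)
      ((hk.reg 17 (by decide) rfl).trans h17) hij (by omega) hI (hch (by omega))
  · refine level_cost_le (by omega) K₁ (Nat.mul_le_mul_left _ (Nat.mul_le_mul
      (Nat.pow_le_pow_right (by omega) (by omega)) (by omega)))
  intro S₁ hk₁ hX₁
  have hY : ∀ r < 2 ^ (c + parts ℓ), |chop c ℓ (parts ℓ) X r| ≤ 2 ^ 2 ^ next ℓ := by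
    intro r hr
    refine (hch kℓ.le r hr).trans ?_
    exact pow_le_pow_right₀ (by norm_num) (Nat.pow_le_pow_right (by omega) (by omega))
  refine ((Tri.forLoop ((hk₁.reg 18 (by decide) rfl).trans h18)
    (t := K₂ * (2 ^ (c + ℓ + 2) * (c + ℓ + 2 + 1)))
    (fun j S' => Holds S' a (2 ^ (c + parts ℓ)) (fft c (next ℓ) j (chop c ℓ (parts ℓ) X))) hX₁ ?_).mono
    (level_cost_le (by omega) K₂ le_rfl) fun _ h => h.1)
  intro j hj S' hij hk hI
  have := h₂ S' a c (parts ℓ) (next ℓ) j _ ha ((hk.reg 16 (by decide) rfl).trans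
      ((hk₁.reg 16 (by decide) rfl).trans h16))
      ((hk.reg 18 (by decide) rfl).trans ((hk₁.reg 18 (by decide) rfl).trans h18)) hij
      ((hk.reg 30 (by decide) rfl).trans ((hk₁.reg 30 (by decide) rfl).trans h30)) hj kl (by omega) hI
      (abs_fft_le (by omega) kl hY hj.le)
  rw [show c + parts ℓ + next ℓ = c + ℓ + 2 by omega] at this
  exact this

/-- The loop variable of a loop that runs downwards. -/
def downP : Prog := block [(19, .sub (.sub (.reg 18) (.const 1)) (.reg 36))]

theorem tri_downP {S : State} {k s : ℕ} (h18 : S.reg 18 = k) (h36 : S.reg 36 = s) (h : s < k) :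
    Tri downP S (30 * (k + 1)) (fun S' => S'.reg 19 = ((k - 1 - s : ℕ) : ℤ)) := by
  have hb1 : 1 ≤ k + 1 := by omega
  refine Tri.le (t := 22 * (k + 1)) ?_ (by omega)
  unfold downP
  exact Tri.block_cons (.subN (.subN (.regN h18 (by omega)) .one (by omega))
    (.regN h36 (by omega)) (by omega)) hb1 (Tri.block_nil hb1 rfl)

def reduceP : Prog :=
  .seq (block [(20, .shl (.const 1) (.reg 16)), (26, .shl (.const 1) (.reg 17))])
    (stage 21 20 22 4 2 (.seq (block [(22, .load 2 (.reg 21))]) redP))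

theorem arrWrites_reduceP (x : ℕ) : reduceP.arrWrites x = (x == 4 || x == 2) := by
  simp [reduceP]

def bwdP : Prog :=
  .seq (forLoop 36 18 (.seq downP (ifftP 2))) (.seq (forLoop 36 18 (.seq downP (unchopP 2))) reduceP)

theorem arrWrites_bwdP (x : ℕ) : bwdP.arrWrites x = (x == 4 || x == 2) := by
  simp only [bwdP, arrWrites_seq, arrWrites_forLoop, downP, arrWrites_block, arrWrites_ifftP,
    arrWrites_unchopP, arrWrites_reduceP, Bool.false_or, Bool.or_self]

theorem tri_reduceP : ∃ K, ∀ (S : State) (c ℓ : ℕ) (X : ℕ → ℤ), S.reg 16 = c →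
    S.reg 17 = ℓ → 1 ≤ ℓ → Holds S 2 (2 ^ c) X → (∀ r < 2 ^ c, |X r| ≤ 2 ^ (5 * 2 ^ ℓ)) →
    Tri reduceP S (K * (2 ^ (c + ℓ) * (c + ℓ + 1))) (fun S' =>
      Holds S' 2 (2 ^ c) (fun r => red (2 ^ ℓ) (X r))) := by
  obtain ⟨Kr, hred⟩ := tri_redP
  refine ⟨20 * (50 + 2 * (50 + Kr + 150)), ?_⟩
  intro S c ℓ X h16 h17 hℓ hX hXb
  obtain ⟨b, hb⟩ : ∃ b, b = 10 * 2 ^ ℓ + (c + 0 + ℓ) + 10 := ⟨_, rfl⟩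
  obtain ⟨N, hN⟩ : ∃ N, N = 2 ^ (c + 0) := ⟨_, rfl⟩
  have hN' : N = 2 ^ c := hN
  have hb1 : 1 ≤ b := by omega
  have hL := two_le_two_pow hℓ
  rw [← hN'] at hX hXb ⊢
  refine Tri.mono (t := 50 * b + (N + 1) * ((50 + Kr) * b + 150 * b))
    (Tri.seq (Q₁ := fun S' => S'.reg 20 = (N : ℤ) ∧ S'.reg 26 = ((2 ^ ℓ : ℕ) : ℤ)) ?_ ?_)
    (fft_cost_le hN hb _ _) fun _ h => h
  · refine Tri.le ?_ (Nat.mul_le_mul_right _ (by decide : blockWeight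
      [(20, .shl (.const 1) (.reg 16)), (26, .shl (.const 1) (.reg 17))] ≤ 50))
    refine Tri.block_cons (.pow2 (.regN h16 (by omega)) (by omega)) hb1 ?_
    refine Tri.block_cons (.pow2 (.regN (n := ℓ) h17 (by omega)) (by omega)) hb1 ?_
    exact Tri.block_nil hb1 ⟨hN' ▸ rfl, rfl⟩
  rintro S₁ hk ⟨h20, h26⟩
  have hX1 := hX.keep hk (by simp)
  have hNl : len (N : ℤ) ≤ b := (len_le_of_lt_two_pow (g := c + 1)
    (hN' ▸ Nat.pow_lt_pow_right (by omega) (by omega))).trans (by omega)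
  refine Tri.stage _ h20 hNl (fun j hj => (len_le_of_abs_le (abs_red_le_pow hℓ
    (hXb j hj))).trans (by omega)) ?_ (by simp) (by omega)
  intro j hj S' hij hk'
  have g26 : S'.reg 26 = ((2 ^ ℓ : ℕ) : ℤ) := (hk'.reg 26 (by decide) rfl).trans h26
  have gX := hX1.keep hk' (by simp)
  have hlj : len (j : ℤ) ≤ b := (len_natCast_mono hj.le).trans hNl
  rw [add_mul]
  refine Tri.seq (t₁ := 50 * b) (Q₁ := fun S'' => S''.reg 22 = X j)
    (Tri.le (Tri.block_cons (.load (.reg hij hlj) (gX j hj) ?_) hb1 (Tri.block_nil hb1 rfl))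
      (Nat.mul_le_mul_right _ (by decide))) fun S'' hk'' h22 =>
    hred S'' (2 ^ ℓ) b _ h22 ((hk''.reg 26 (by decide) rfl).trans g26) hL (hXb j hj) (by omega)
  exact (len_le_of_abs_le (hXb j hj)).trans (by omega)

theorem tri_bwdP : ∃ K, ∀ (S : State) (c ℓ : ℕ) (Z : ℕ → ℤ), S.reg 16 = c →
    S.reg 17 = ℓ → S.reg 18 = parts ℓ → S.reg 30 = next ℓ → 5 ≤ ℓ →
    Holds S 2 (2 ^ (c + parts ℓ)) Z → (∀ r < 2 ^ (c + parts ℓ), |Z r| ≤ 2 ^ 2 ^ next ℓ) →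
    Tri bwdP S (K * (2 ^ (c + ℓ + 2) * (c + ℓ + 2 + 1) ^ 2)) (fun S' =>
      Holds S' 2 (2 ^ c) (bwd c ℓ Z) ∧ ∀ r < 2 ^ c, |bwd c ℓ Z r| ≤ 2 ^ (2 ^ ℓ - 1) + 1) := by
  obtain ⟨K₁, h₁⟩ := tri_ifftP
  obtain ⟨K₂, h₂⟩ := tri_unchopP
  obtain ⟨K₃, h₃⟩ := tri_reduceP
  refine ⟨30 + K₁ + 40 + (30 + K₂ + 40 + K₃), ?_⟩
  intro S c ℓ Z h16 h17 h18 h30 hℓ hZ hZb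
  obtain ⟨k2, kℓ, kl, lℓ, l4, hlk⟩ := parts_facts hℓ
  have hP : ∀ K t, t ≤ K * (2 ^ (c + ℓ + 2) * (c + ℓ + 2 + 1)) → 30 * (parts ℓ + 1) + t ≤
      (30 + K) * (2 ^ (c + ℓ + 2) * (c + ℓ + 2 + 1)) := by
    intro K t ht
    rw [add_mul]
    refine add_le_add (Nat.mul_le_mul_left _ ?_) ht
    exact (show parts ℓ + 1 ≤ c + ℓ + 2 + 1 by omega).trans
      (Nat.le_mul_of_pos_left _ (Nat.two_pow_pos _))
  have eP : c + parts ℓ + next ℓ = c + ℓ + 2 := by omega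
  have hi := fun {s} (hs : s ≤ parts ℓ) => abs_ifft_le (c := c) (by omega) hZb (s := s) hs
  rw [add_mul]
  refine Tri.seq ((Tri.forLoop h18
    (t := 30 * (parts ℓ + 1) + K₁ * (2 ^ (c + ℓ + 2) * (c + ℓ + 2 + 1)))
    (fun j S' => Holds S' 2 (2 ^ (c + parts ℓ)) (ifft c (next ℓ) (parts ℓ) j Z)) hZ ?_).mono
    (level_cost_le (by omega) _ (hP _ _ le_rfl)) fun _ h => h.1) ?_
  · intro j hj S' hij hk hI
    have g18 := (hk.reg 18 (by decide) rfl).trans h18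
    refine (tri_downP g18 hij hj).seq fun S'' hk' h19 => ?_
    have := h₁ S'' 2 c (parts ℓ) (next ℓ) _ _ (by decide) ((hk'.reg 16 (by decide) rfl).trans
      ((hk.reg 16 (by decide) rfl).trans h16)) ((hk'.reg 18 (by decide) rfl).trans g18) h19
      ((hk'.reg 30 (by decide) rfl).trans ((hk.reg 30 (by decide) rfl).trans h30)) (by omega) kl
      (by omega) (hI.keep hk' (by simp [downP])) (hi hj.le)
    rw [eP] at this
    exact this
  intro S₁ hk₁ hX₁
  have g16 := (hk₁.reg 16 (by decide) rfl).trans h16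
  have g17 := (hk₁.reg 17 (by decide) rfl).trans h17
  have g18 := (hk₁.reg 18 (by decide) rfl).trans h18
  set W := ifft c (next ℓ) (parts ℓ) (parts ℓ) Z with hW
  have hu := fun {s} (hs : s ≤ parts ℓ) => abs_unchop_le (c := c) kℓ.le (hi le_rfl) (s := s) hs
  rw [← hW] at hu
  rw [add_mul]
  refine Tri.seq ((Tri.forLoop g18
    (t := 30 * (parts ℓ + 1) + K₂ * (2 ^ (c + ℓ + 2) * (c + ℓ + 2 + 1)))
    (fun j S' => Holds S' 2 (2 ^ (c + (parts ℓ - j))) (unchop c ℓ (parts ℓ) j W)) hX₁ ?_).mono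
    (level_cost_le (by omega) _ (hP _ _ le_rfl)) fun _ h => h.1) ?_
  · intro j hj S' hij hk hI
    refine (tri_downP ((hk.reg 18 (by decide) rfl).trans g18) hij hj).seq fun S'' hk' h19 => ?_
    have e1 : c + (parts ℓ - j) = c + (parts ℓ - 1 - j) + 1 := by omega
    have e2 : ℓ - (parts ℓ - j) = ℓ - 1 - (parts ℓ - 1 - j) := by omega
    have hu := hu hj.le
    rw [e1] at hI hu
    rw [e2] at hu
    have := h₂ S'' 2 c ℓ (parts ℓ) (next ℓ) (parts ℓ - 1 - j) _ (by decide)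
      ((hk'.reg 16 (by decide) rfl).trans ((hk.reg 16 (by decide) rfl).trans g16))
      ((hk'.reg 17 (by decide) rfl).trans ((hk.reg 17 (by decide) rfl).trans g17)) h19
      (by omega) kℓ.le hlk (hI.keep hk' (by simp [downP])) hu
    rw [eP] at this
    rw [show parts ℓ - (j + 1) = parts ℓ - 1 - j by omega]
    exact this
  intro S₂ hk₂ hX₂
  have hu := hu le_rfl
  rw [Nat.sub_self, Nat.add_zero, Nat.sub_zero] at hu
  rw [Nat.sub_self, Nat.add_zero] at hX₂
  have hu5 : ∀ r < 2 ^ c, |unchop c ℓ (parts ℓ) (parts ℓ) W r| ≤ 2 ^ (5 * 2 ^ ℓ) := by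
    intro r hr
    refine (hu r hr).trans (pow_le_pow_right₀ (by norm_num) ?_)
    have : 2 ^ next ℓ ≤ 2 ^ ℓ := Nat.pow_le_pow_right (by omega) lℓ
    omega
  refine (h₃ S₂ c ℓ _ ((hk₂.reg 16 (by decide) rfl).trans g16)
    ((hk₂.reg 17 (by decide) rfl).trans g17) (by omega) hX₂ hu5).mono ?_ fun S' h => ⟨h, ?_⟩
  · refine Nat.mul_le_mul_left _ (Nat.mul_le_mul (Nat.pow_le_pow_right (by omega) (by omega)) ?_)
    nlinarith
  · intro r hr
    exact abs_red_le (two_le_two_pow (by omega)) (hu5 r hr)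

end BitRAM

/-! ### The sequence of levels -/

namespace SSA

/-- The sequence is constant once it has reached `4`. The program can therefore always make `n`
rounds, the superfluous ones being idle. -/
def level (n : ℕ) : ℕ → ℕ
  | 0 => n
  | j + 1 => if 4 < level n j then next (level n j) else level n j

/-- Logarithm of the number of residues on a level. -/
def width (n : ℕ) : ℕ → ℕ
  | 0 => 0
  | j + 1 => if 4 < level n j then width n j + parts (level n j) else width n j

def residues (n : ℕ) (X : ℕ → ℤ) : ℕ → ℕ → ℤ
  | 0 => X
  | j + 1 => if 4 < level n j then fwd (width n j) (level n j) (residues n X j) else residues n X j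

theorem four_le_level {n : ℕ} (hn : 4 ≤ n) (j : ℕ) : 4 ≤ level n j := by
  induction j with
  | zero => exact hn
  | succ j ih =>
    rw [level]
    split_ifs with h
    · exact (parts_facts h).2.2.2.2.1
    · exact ih

theorem level_le {n : ℕ} (hn : 4 ≤ n) (j : ℕ) : level n j ≤ max 4 (n - j) := by
  induction j with
  | zero => simp [level, hn]
  | succ j ih =>
    rw [level]
    split_ifs with h
    · unfold next parts
      omega
    · omega

theorem level_self {n : ℕ} (hn : 4 ≤ n) : level n n = 4 := by
  have h1 := four_le_level hn n
  have h2 := level_le hn n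
  omega

theorem level_le_self {n : ℕ} (hn : 4 ≤ n) (j : ℕ) : level n j ≤ n := by
  have h2 := level_le hn j
  omega

/-- Here `a` counts the rounds that were not idle. Each of them adds `2` to `width + level` and at
least halves `level - 3`. Hence `2 ^ a ≤ n` as long as the level is at least `4`, and the data grow
by a factor of at most `4 ^ a ≤ n ^ 2`. -/
theorem exists_width_add_level (n j : ℕ) :
    ∃ a, width n j + level n j = n + 2 * a ∧ 2 ^ a * (level n j - 3) ≤ n := by
  induction j with
  | zero => exact ⟨0, by simp [width, level], by simp [level]⟩
  | succ j ih =>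
    obtain ⟨a, h1, h2⟩ := ih
    rw [level, width]
    split_ifs with h
    · obtain ⟨k2, kℓ, kl, lℓ, l4, hlk⟩ := parts_facts h
      refine ⟨a + 1, by omega, ?_⟩
      refine le_trans ?_ h2
      rw [pow_succ, mul_assoc]
      refine Nat.mul_le_mul_left _ ?_
      unfold next parts
      omega
    · exact ⟨a, h1, h2⟩

/-- The cost of one level, uniformly in the level: a factor `n ^ 2` for the growth of the data,
another one for the squared logarithm. -/
theorem two_pow_width_le {n : ℕ} (hn : 4 ≤ n) (j : ℕ) :
    2 ^ (width n j + level n j + 2) * (width n j + level n j + 2 + 1) ^ 2 ≤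
      150 * (2 ^ n * n ^ 4) := by
  obtain ⟨a, h1, h2⟩ := exists_width_add_level n j
  have h3 := four_le_level hn j
  have h4 : 2 ^ a ≤ n := (Nat.le_mul_of_pos_right _ (by omega)).trans h2
  have h5 : a < 2 ^ a := Nat.lt_two_pow_self
  rw [h1]
  calc 2 ^ (n + 2 * a + 2) * (n + 2 * a + 2 + 1) ^ 2
      = 4 * (2 ^ n * (2 ^ a) ^ 2) * (n + 2 * a + 2 + 1) ^ 2 := by rw [pow_add, pow_add, pow_mul']; ring
    _ ≤ 4 * (2 ^ n * n ^ 2) * (6 * n) ^ 2 := by gcongr; omega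
    _ = 144 * (2 ^ n * n ^ 4) := by ring
    _ ≤ _ := by gcongr; norm_num

theorem abs_residues_le {n : ℕ} {X : ℕ → ℤ} (hX : |X 0| ≤ 2 ^ 2 ^ n) (j : ℕ) :
    ∀ r < 2 ^ width n j, |residues n X j r| ≤ 2 ^ 2 ^ level n j := by
  induction j with
  | zero =>
    intro r hr
    obtain rfl : r = 0 := by simpa [width] using hr
    exact hX
  | succ j ih =>
    rw [level, width, residues]
    split_ifs with h
    · obtain ⟨k2, kℓ, kl, lℓ, l4, hlk⟩ := parts_facts h
      refine abs_fft_le (by omega) kl (fun r hr => (abs_chop_le ih kℓ.le r hr).trans ?_) le_rfl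
      exact pow_le_pow_right₀ (by norm_num) (Nat.pow_le_pow_right (by omega) (by omega))
    · exact ih

end SSA

/-! ### Multiplication -/

namespace BitRAM

open SSA

def levelPre : List (ℕ × Expr) :=
  [(18, .shr (.add (.reg 17) (.const 2)) (.const 1)),
   (30, .add (.sub (.reg 17) (.reg 18)) (.const 2))]

theorem tri_levelPre {S : State} {ℓ : ℕ} (h17 : S.reg 17 = ℓ) (hℓ : 5 ≤ ℓ) :
    Tri (block levelPre) S (100 * (ℓ + 1))
      (fun S' => S'.reg 18 = parts ℓ ∧ S'.reg 30 = next ℓ) := by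
  have hb1 : 1 ≤ ℓ + 1 := by omega
  have := parts_facts hℓ
  refine Tri.le ?_ (Nat.mul_le_mul_right _ (by decide : blockWeight levelPre ≤ 100))
  refine Tri.block_cons (.shrN (n := 1) (.addN (.regN h17 (by omega)) .two) .one) hb1 ?_
  refine Tri.block_cons (.addN (.subN (n := parts ℓ) (.regN h17 (by omega)) (.regN rfl (by omega))
    (by omega)) .two) hb1 ?_
  exact Tri.block_nil hb1 ⟨rfl, rfl⟩

def levelDown : Prog :=
  .seq (block levelPre) (.seq (fwdP 2) (.seq (fwdP 3)
    (block [(16, .add (.reg 16) (.reg 18)), (17, .reg 30)])))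

theorem arrWrites_levelDown (x : ℕ) : levelDown.arrWrites x = (x == 4 || x == 2 || x == 3) := by
  simp only [levelDown, arrWrites_seq, arrWrites_block, arrWrites_fwdP]
  cases x == 4 <;> cases x == 2 <;> cases x == 3 <;> rfl

def levelUp : Prog :=
  .seq (block levelPre) (.seq (block [(16, .sub (.reg 16) (.reg 18))]) bwdP)

theorem arrWrites_levelUp (x : ℕ) : levelUp.arrWrites x = (x == 4 || x == 2) := by
  simp only [levelUp, arrWrites_seq, arrWrites_block, arrWrites_bwdP, Bool.false_or]

theorem tri_levelDown : ∃ K, ∀ (S : State) (c ℓ : ℕ) (X Y : ℕ → ℤ), S.reg 16 = c →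
    S.reg 17 = ℓ → 5 ≤ ℓ → Holds S 2 (2 ^ c) X → (∀ r < 2 ^ c, |X r| ≤ 2 ^ 2 ^ ℓ) →
    Holds S 3 (2 ^ c) Y → (∀ r < 2 ^ c, |Y r| ≤ 2 ^ 2 ^ ℓ) →
    Tri levelDown S (K * (2 ^ (c + ℓ + 2) * (c + ℓ + 2 + 1) ^ 2)) (fun S' =>
      S'.reg 16 = ((c + parts ℓ : ℕ) : ℤ) ∧ S'.reg 17 = next ℓ ∧
      Holds S' 2 (2 ^ (c + parts ℓ)) (fwd c ℓ X) ∧ Holds S' 3 (2 ^ (c + parts ℓ)) (fwd c ℓ Y)) := by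
  obtain ⟨K, h⟩ := tri_fwdP
  refine ⟨100 + (K + (K + 100)), ?_⟩
  intro S c ℓ X Y h16 h17 hℓ hX hXb hY hYb
  obtain ⟨T, hT⟩ : ∃ T, T = 2 ^ (c + ℓ + 2) * (c + ℓ + 2 + 1) ^ 2 := ⟨_, rfl⟩
  have hf := parts_facts hℓ
  have hTl : c + ℓ + 1 ≤ T := by
    rw [hT]
    refine le_trans ?_ (Nat.le_mul_of_pos_left _ (Nat.two_pow_pos _))
    nlinarith
  rw [← hT, add_mul]
  refine Tri.seq ((tri_levelPre h17 hℓ).le (Nat.mul_le_mul_left _ (by omega))) ?_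
  rintro S₁ k₁ ⟨h18, h30⟩
  have g16 := (k₁.reg 16 (by decide) rfl).trans h16
  have g17 := (k₁.reg 17 (by decide) rfl).trans h17
  rw [add_mul, hT]
  refine Tri.seq (h S₁ 2 c ℓ X (by decide) g16 g17 h18 h30 hℓ (hX.keep k₁ (by simp)) hXb) ?_
  intro S₂ k₂ hX₂
  have g16 := (k₂.reg 16 (by decide) rfl).trans g16
  have g17 := (k₂.reg 17 (by decide) rfl).trans g17
  have h18 := (k₂.reg 18 (by decide) rfl).trans h18
  have h30 := (k₂.reg 30 (by decide) rfl).trans h30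
  rw [add_mul]
  refine Tri.seq (h S₂ 3 c ℓ Y (by decide) g16 g17 h18 h30 hℓ
    ((hY.keep k₁ (by simp)).keep k₂ (by simp [arrWrites_fwdP])) hYb) ?_
  intro S₃ k₃ hY₃
  have hX₃ := hX₂.keep k₃ (by simp [arrWrites_fwdP])
  rw [← hT]
  have hT1 : 1 ≤ T := by omega
  refine Tri.le ?_ (Nat.mul_le_mul_right _ (by decide : blockWeight
    [(16, .add (.reg 16) (.reg 18)), (17, .reg 30)] ≤ 100))
  refine Tri.block_cons (.addN (.regN ((k₃.reg 16 (by decide) rfl).trans g16) (by omega))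
    (.regN ((k₃.reg 18 (by decide) rfl).trans h18) (by omega))) hT1 ?_
  refine Tri.block_cons (.regN ((k₃.reg 30 (by decide) rfl).trans h30) (by omega)) hT1 ?_
  exact Tri.block_nil hT1 ⟨rfl, rfl, hX₃, hY₃⟩

theorem tri_levelUp : ∃ K, ∀ (S : State) (c ℓ : ℕ) (Z : ℕ → ℤ), S.reg 16 = ((c + parts ℓ : ℕ) : ℤ) →
    S.reg 17 = ℓ → 5 ≤ ℓ → Holds S 2 (2 ^ (c + parts ℓ)) Z →
    (∀ r < 2 ^ (c + parts ℓ), |Z r| ≤ 2 ^ 2 ^ next ℓ) →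
    Tri levelUp S (K * (2 ^ (c + ℓ + 2) * (c + ℓ + 2 + 1) ^ 2)) (fun S' =>
      S'.reg 16 = c ∧ Holds S' 2 (2 ^ c) (bwd c ℓ Z) ∧
        ∀ r < 2 ^ c, |bwd c ℓ Z r| ≤ 2 ^ (2 ^ ℓ - 1) + 1) := by
  obtain ⟨K, h⟩ := tri_bwdP
  refine ⟨100 + (100 + K), ?_⟩
  intro S c ℓ Z h16 h17 hℓ hZ hZb
  obtain ⟨T, hT⟩ : ∃ T, T = 2 ^ (c + ℓ + 2) * (c + ℓ + 2 + 1) ^ 2 := ⟨_, rfl⟩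
  have hf := parts_facts hℓ
  have hTl : c + ℓ + 1 ≤ T := by
    rw [hT]
    refine le_trans ?_ (Nat.le_mul_of_pos_left _ (Nat.two_pow_pos _))
    nlinarith
  rw [← hT, add_mul]
  refine Tri.seq ((tri_levelPre h17 hℓ).le (Nat.mul_le_mul_left _ (by omega))) ?_
  rintro S₁ k₁ ⟨h18, h30⟩
  have g16 := (k₁.reg 16 (by decide) rfl).trans h16
  have g17 := (k₁.reg 17 (by decide) rfl).trans h17
  have hT1 : 1 ≤ T := by omega
  rw [add_mul]
  refine Tri.seq (Q₁ := fun S' => S'.reg 16 = c) (Tri.le ?_ (Nat.mul_le_mul_right _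
    (by decide : blockWeight [(16, .sub (.reg 16) (.reg 18))] ≤ 100))) ?_
  · refine Tri.block_cons (.subN (.regN g16 (by omega)) (.regN h18 (by omega)) (by omega)) hT1 ?_
    exact Tri.block_nil hT1 (by simp)
  intro S₂ k₂ g16
  have g17 := (k₂.reg 17 (by decide) rfl).trans g17
  have h18 := (k₂.reg 18 (by decide) rfl).trans h18
  have h30 := (k₂.reg 30 (by decide) rfl).trans h30
  rw [hT]
  refine (h S₂ c ℓ Z g16 g17 h18 h30 hℓ ((hZ.keep k₁ (by simp)).keep k₂ (by simp)) hZb).post le_rfl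
    fun S' k h => ⟨(k.reg 16 (by decide) rfl).trans g16, h⟩

/-- Multiplication by repeated addition, on the last level. -/
def basePre : List (ℕ × Expr) :=
  [(32, .load 2 (.reg 21)),
   (33, .load 3 (.reg 21)),
   (32, .ite (.reg 33) (.reg 32) (.sub (.const 0) (.reg 32))),
   (33, .ite (.reg 33) (.reg 33) (.sub (.const 0) (.reg 33))),
   (22, .const 0)]

def baseBody : Prog :=
  .seq (block basePre) (.seq (forLoop 34 33 (block [(22, .add (.reg 22) (.reg 32))])) redP)

def baseP : Prog :=
  .seq (block [(20, .shl (.const 1) (.reg 16)), (26, .const 16)]) (stage 21 20 22 4 2 baseBody)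

theorem arrWrites_baseP (x : ℕ) : baseP.arrWrites x = (x == 4 || x == 2) := by
  simp [baseP, baseBody]

theorem tri_baseBody : ∃ K, ∀ (S : State) (b j : ℕ) (x y : ℤ), S.reg 21 = j → len (j : ℤ) ≤ b →
    S.arr 2 j = x → S.arr 3 j = y → |x| ≤ 2 ^ 16 → |y| ≤ 2 ^ 16 → S.reg 26 = (16 : ℕ) → 100 ≤ b →
    Tri baseBody S (K * b) (fun S' => S'.reg 22 = red 16 (x * y)) := by
  obtain ⟨Kr, hred⟩ := tri_redP
  refine ⟨blockWeight basePre + ((2 ^ 16 + 1) * 100 + Kr), ?_⟩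
  intro S b j x y h21 hj hx hy hxb hyb h26 hb
  have hb1 : 1 ≤ b := by omega
  have hxl : len x ≤ b := (len_le_of_abs_le hxb).trans (by omega)
  have hyl : len y ≤ b := (len_le_of_abs_le hyb).trans (by omega)
  rw [add_mul, add_mul]
  -- The sign of `y` is moved to the other factor, so that `x * y` is an `m`-fold sum of `z = ± x`.
  -- As `m ≤ 2 ^ 16`, this takes a constant number of additions.
  obtain ⟨m, hm⟩ : ∃ m : ℕ, m = y.natAbs := ⟨_, rfl⟩
  have hm2 : (m : ℤ) = if 0 < y then y else 0 - y := by
    rw [hm, Int.natCast_natAbs, zero_sub]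
    split_ifs with h
    · exact abs_of_pos h
    · exact abs_of_nonpos (not_lt.1 h)
  have hmb : m ≤ 2 ^ 16 := by zify; rw [hm, Int.natCast_natAbs]; exact hyb
  obtain ⟨z, hz⟩ : ∃ z, z = if 0 < y then x else 0 - x := ⟨_, rfl⟩
  have hmz : m * z = x * y := by
    rw [hm2, hz]
    split_ifs <;> ring
  have hzb : |z| ≤ 2 ^ 16 := by
    rw [hz]
    split_ifs
    · exact hxb
    · rwa [zero_sub, abs_neg]
  have hzl : len z ≤ b := (len_le_of_abs_le hzb).trans (by omega)
  have hml : len (m : ℤ) ≤ b := (len_le_of_abs_le (k := 16) (by exact_mod_cast hmb)).trans (by omega)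
  refine Tri.seq (Q₁ := fun S' => S'.reg 32 = z ∧ S'.reg 33 = m ∧ S'.reg 22 = 0) ?_ ?_
  · refine Tri.block_cons (.load (.reg h21 hj) hx hxl) hb1 ?_
    refine Tri.block_cons (.load (.reg h21 hj) hy hyl) hb1 ?_
    refine Tri.block_cons (v := z) (.cast (.ite (u := y) (v := x) (w := 0 - x) (.reg rfl hyl)
      (fun _ => .reg rfl hxl) fun _ => .sub (.const 0) (.reg rfl hxl)) hz.symm) hb1 ?_
    refine Tri.block_cons (v := m) (.cast (.ite (u := y) (v := y) (w := 0 - y) (.reg rfl hyl)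
      (fun _ => .reg rfl hyl) fun _ => .sub (.const 0) (.reg rfl hyl)) hm2.symm) hb1 ?_
    exact Tri.block_cons (.const 0) hb1 (Tri.block_nil hb1 ⟨rfl, rfl, rfl⟩)
  rintro S₁ k₁ ⟨h32, h33, h22⟩
  refine Tri.seq (Q₁ := fun S' => S'.reg 22 = m * z) (Tri.mono (Tri.forLoop h33 (t := 50 * b)
    (fun i S' => S'.reg 22 = i * z) (by simp [h22]) ?_) ?_ fun _ h => h.1) ?_
  · intro i hi S' hij k hI
    have hil : len (i * z) ≤ b := by
      refine (len_le_of_abs_le (k := 32) ?_).trans (by omega)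
      rw [abs_mul, Nat.abs_cast]
      calc (i : ℤ) * |z| ≤ 2 ^ 16 * 2 ^ 16 := by
            gcongr
            exact_mod_cast hi.le.trans hmb
        _ = 2 ^ 32 := by norm_num
    refine Tri.le ?_ (Nat.mul_le_mul_right _
      (by decide : blockWeight [(22, .add (.reg 22) (.reg 32))] ≤ 50))
    refine Tri.block_cons (.add (.reg hI hil) (.reg ((k.reg 32 (by decide) rfl).trans h32) hzl)) hb1 ?_
    refine Tri.block_nil hb1 ?_
    simp only [State.setReg_reg]
    push_cast
    ring
  · calc (m + 1) * (50 * b + 40 * len (m : ℤ)) ≤ (2 ^ 16 + 1) * (50 * b + 40 * b) := by gcongr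
      _ ≤ _ := by omega
  intro S₂ k₂ h22
  have hxy : |x * y| ≤ 2 ^ (5 * 16) := by
    rw [abs_mul]
    calc |x| * |y| ≤ 2 ^ 16 * 2 ^ 16 := by gcongr
      _ ≤ _ := by norm_num
  exact hred S₂ 16 b _ (h22.trans hmz) ((k₂.reg 26 (by decide) rfl).trans
    ((k₁.reg 26 (by decide) rfl).trans h26)) (by norm_num) hxy (by omega)

theorem tri_baseP : ∃ K, ∀ (S : State) (c : ℕ) (X Y : ℕ → ℤ), S.reg 16 = c →
    Holds S 2 (2 ^ c) X → Holds S 3 (2 ^ c) Y →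
    (∀ r < 2 ^ c, |X r| ≤ 2 ^ 16) → (∀ r < 2 ^ c, |Y r| ≤ 2 ^ 16) →
    Tri baseP S (K * (2 ^ c * (c + 1))) (fun S' =>
      Holds S' 2 (2 ^ c) (fun r => red 16 (X r * Y r))) := by
  obtain ⟨Kb, hbase⟩ := tri_baseBody
  refine ⟨(50 + 2 * (Kb + 150)) * 100, ?_⟩
  intro S c X Y h16 hX hY hXb hYb
  obtain ⟨b, hb⟩ : ∃ b, b = 100 * (c + 1) := ⟨_, rfl⟩
  obtain ⟨N, hN⟩ : ∃ N, N = 2 ^ c := ⟨_, rfl⟩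
  have hb1 : 1 ≤ b := by omega
  have hN1 : 1 ≤ N := hN ▸ Nat.one_le_two_pow
  rw [← hN] at hX hY hXb hYb ⊢
  refine Tri.le (t := 50 * b + (N + 1) * (Kb * b + 150 * b)) (Tri.seq (Q₁ := fun S' =>
    S'.reg 20 = (N : ℤ) ∧ S'.reg 26 = (16 : ℕ)) (Tri.le ?_ (Nat.mul_le_mul_right _ (by decide :
      blockWeight [(20, .shl (.const 1) (.reg 16)), (26, .const 16)] ≤ 50))) ?_) ?_
  · refine Tri.block_cons (.pow2 (.regN h16 (by omega)) (by omega)) hb1 ?_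
    exact Tri.block_cons (.const 16) hb1 (Tri.block_nil hb1 ⟨hN ▸ rfl, rfl⟩)
  · rintro S₁ k₁ ⟨h20, h26⟩
    have hNl : len (N : ℤ) ≤ b := (len_le_of_lt_two_pow (g := c + 1)
      (hN ▸ Nat.pow_lt_pow_right (by omega) (by omega))).trans (by omega)
    have hxy : ∀ j < N, |X j * Y j| ≤ 2 ^ (5 * 2 ^ 4) := by
      intro j hj
      rw [abs_mul]
      calc |X j| * |Y j| ≤ 2 ^ 16 * 2 ^ 16 := by gcongr <;> [exact hXb j hj; exact hYb j hj]
        _ ≤ _ := by norm_num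
    refine Tri.stage _ h20 hNl (fun j hj => (len_le_of_abs_le (abs_red_le_pow (l := 4) (by norm_num)
      (hxy j hj))).trans (by norm_num; omega)) ?_ (by simp [baseBody]) (by omega)
    intro j hj S' hij k
    exact hbase S' b j _ _ hij ((len_natCast_mono hj.le).trans hNl)
      ((hX.keep k₁ (by simp)).keep k (by simp [baseBody]) j hj)
      ((hY.keep k₁ (by simp)).keep k (by simp [baseBody]) j hj) (hXb j hj) (hYb j hj)
      ((k.reg 26 (by decide) rfl).trans h26) (by omega)
  · have h1 := stage_cost_le (K := Kb) (b := b) hN1 le_rfl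
    have h2 : b ≤ N * b := Nat.le_mul_of_pos_left _ hN1
    calc _ ≤ 50 * (N * b) + 2 * (Kb + 150) * (N * b) := by gcongr
      _ = _ := by rw [hb]; ring

end BitRAM

/-! ### The recursion of the multiplication, unrolled into rounds -/

namespace BitRAM

open SSA

/-- Arrays `2` and `3` hold the residues of the two factors. As `next` is not injective and rounds
may be idle, the levels are recorded in array `5` for the way back. -/
def descend : Prog :=
  forLoop 14 10 (.seq (storeE 5 (.reg 14) (.reg 17))
    (ifE (.sub (.reg 17) (.const 4)) levelDown (block [])))

def ascend : Prog :=
  forLoop 35 10 (.seq (block [(14, .sub (.sub (.reg 10) (.const 1)) (.reg 35)),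
    (17, .load 5 (.reg 14))]) (ifE (.sub (.reg 17) (.const 4)) levelUp (block [])))

/-- Multiply registers `11` and `12`; the factors have `2 ^ n` bits, where `n` is in register
`10`. -/
def mulP : Prog :=
  .seq (block [(16, .const 0), (17, .reg 10)])
    (.seq (storeE 2 (.const 0) (.reg 11)) (.seq (storeE 3 (.const 0) (.reg 12))
      (.seq descend (.seq baseP (.seq ascend (block [(13, .load 2 (.const 0))]))))))

@[simp] theorem arrWrites_ifE (e : Expr) (p q : Prog) (a : ℕ) :
    (ifE e p q).arrWrites a = (p.arrWrites a || q.arrWrites a) := by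
  simp [ifE, Prog.arrWrites]

theorem tri_descend : ∃ K, ∀ (S : State) (n : ℕ) (X Y : ℕ → ℤ), 4 ≤ n → S.reg 10 = n →
    S.reg 16 = 0 → S.reg 17 = n → Holds S 2 1 X → Holds S 3 1 Y → |X 0| ≤ 2 ^ 2 ^ n →
    |Y 0| ≤ 2 ^ 2 ^ n → Tri descend S (K * (2 ^ n * n ^ 5)) (fun S' =>
      Holds S' 5 n (fun j => level n j) ∧ S'.reg 16 = width n n ∧ S'.reg 17 = level n n ∧
      Holds S' 2 (2 ^ width n n) (residues n X n) ∧
      Holds S' 3 (2 ^ width n n) (residues n Y n)) := by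
  obtain ⟨K, hdown⟩ := tri_levelDown
  refine ⟨2 * (K * 150 + 240), ?_⟩
  intro S n X Y hn h10 h16 h17 hX hY hXb hYb
  have hX' := abs_residues_le hXb
  have hY' := abs_residues_le hYb
  obtain ⟨T, hT⟩ : ∃ T, T = 2 ^ n * n ^ 4 := ⟨_, rfl⟩
  have hnT : n + 1 ≤ T := by
    rw [hT]
    calc n + 1 ≤ 2 ^ n := Nat.lt_two_pow_self
      _ ≤ _ := Nat.le_mul_of_pos_right _ (by positivity)
  refine (Tri.forLoop (N := n) h10 (t := 100 * T + (50 * T + (K * 150 + 50) * T)) (fun j S' =>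
      Holds S' 5 j (fun j => level n j) ∧ S'.reg 16 = width n j ∧ S'.reg 17 = level n j ∧
      Holds S' 2 (2 ^ width n j) (residues n X j) ∧
      Holds S' 3 (2 ^ width n j) (residues n Y j)) ⟨by simp [Holds], by simpa [width],
        by simpa [level], by simpa [width], by simpa [width]⟩ ?_).mono ?_ fun _ h => h.1
  · rintro j hj S' hij k ⟨hI5, hI16, hI17, hI2, hI3⟩
    have l1 := level_le_self hn j
    have l4 := four_le_level hn j
    have hjT : len (j : ℤ) ≤ T := (len_natCast_le j).trans (by omega)
    have hlT : len (level n j : ℤ) ≤ T := (len_natCast_le _).trans (by omega)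
    refine Tri.seq (t₁ := 100 * T) (Q₁ := fun S'' => Holds S'' 5 (j + 1) (fun j => level n j) ∧
      S''.reg = S'.reg ∧ S''.arr 2 = S'.arr 2 ∧ S''.arr 3 = S'.arr 3) ?_ ?_
    · refine Tri.storeE (b := T) (by omega) (by simpa [Expr.Leaf, hij] using hjT)
        (by simpa [Expr.Leaf, hI17] using hlT) (by simp [Expr.weight, Expr.growth]; omega) ?_
      refine ⟨?_, rfl, rfl, rfl⟩
      intro m hm
      simp only [Expr.eval, hij, hI17, State.setCell_arr, if_true]
      rcases Nat.lt_succ_iff_lt_or_eq.1 hm with h | rfl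
      · rw [Function.update_of_ne (by exact_mod_cast h.ne)]
        exact hI5 m h
      · simp
    rintro S₁ k₁ ⟨g5, gr, g2, g3⟩
    have g16 : S₁.reg 16 = width n j := by rw [gr, hI16]
    have g17 : S₁.reg 17 = level n j := by rw [gr, hI17]
    have hI2 : Holds S₁ 2 (2 ^ width n j) (residues n X j) := by rwa [Holds, g2]
    have hI3 : Holds S₁ 3 (2 ^ width n j) (residues n Y j) := by rwa [Holds, g3]
    have hev : (Expr.sub (.reg 17) (.const 4)).eval S₁ = (level n j : ℤ) - 4 := by
      simp [Expr.eval, g17]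
    refine Tri.le (Tri.ifE (b := T) (t := (K * 150 + 50) * T) (by omega)
      (by simpa [Expr.Leaf, g17] using hlT) ?_ ?_)
      (Nat.add_le_add_right (Nat.mul_le_mul_right _ (by decide)) _)
    · intro h
      rw [hev] at h
      have h : 4 < level n j := by omega
      refine (hdown S₁ (width n j) (level n j) _ _ g16 g17 h hI2 (hX' j) hI3 (hY' j)).post ?_ ?_
      · rw [add_mul, hT, mul_assoc]
        exact (Nat.mul_le_mul_left _ (two_pow_width_le hn j)).trans (by omega)
      · rintro S'' k'' ⟨q16, q17, q2, q3⟩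
        rw [level, width, residues, residues, if_pos h, if_pos h, if_pos h, if_pos h]
        have q5 := g5.keep k'' (by simp [arrWrites_levelDown])
        exact ⟨q5, q16, q17, q2, q3⟩
    · intro h
      rw [hev] at h
      have h : ¬ 4 < level n j := by omega
      rw [level, width, residues, residues, if_neg h, if_neg h, if_neg h, if_neg h]
      refine (Tri.block_nil (b := T) (by omega) ?_).le (Nat.mul_le_mul_right _ (by simp [blockWeight]))
      exact ⟨g5, g16, g17, hI2, hI3⟩
  · have hl : len (n : ℤ) ≤ T := (len_natCast_le n).trans hnT
    have e : 2 ^ n * n ^ 5 = n * T := by rw [hT]; ring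
    rw [e]
    refine (loop_cost_le (by omega) hl (K := K * 150 + 200) (by linarith)).trans_eq ?_
    ring

/-- The invariant is that array `2` holds the products of the residues of both factors with respect
to the modulus of the current level. An active round preserves it by `bwd_modEq`; on level `0` the
only residues are the factors themselves. -/
theorem tri_ascend : ∃ K, ∀ (S : State) (n : ℕ) (X Y Z : ℕ → ℤ), 4 ≤ n → S.reg 10 = n →
    S.reg 16 = width n n → |X 0| ≤ 2 ^ 2 ^ n → |Y 0| ≤ 2 ^ 2 ^ n →
    Holds S 5 n (fun j => level n j) → Holds S 2 (2 ^ width n n) Z →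
    (∀ r < 2 ^ width n n, |Z r| ≤ 2 ^ (2 ^ 4 - 1) + 1 ∧
      Z r ≡ residues n X n r * residues n Y n r [ZMOD 2 ^ 2 ^ 4 + 1]) →
    Tri ascend S (K * (2 ^ n * n ^ 5)) (fun S' => ∃ z : ℤ, S'.arr 2 0 = z ∧
      |z| ≤ 2 ^ (2 ^ n - 1) + 1 ∧ z ≡ X 0 * Y 0 [ZMOD 2 ^ 2 ^ n + 1]) := by
  obtain ⟨K, hup⟩ := tri_levelUp
  refine ⟨2 * (K * 150 + 240), ?_⟩
  intro S n X Y Z hn h10 h16 hXb hYb h5 hZ hZb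
  have hX' := abs_residues_le hXb
  have hY' := abs_residues_le hYb
  obtain ⟨T, hT⟩ : ∃ T, T = 2 ^ n * n ^ 4 := ⟨_, rfl⟩
  have hnT : n + 1 ≤ T := by
    rw [hT]
    calc n + 1 ≤ 2 ^ n := Nat.lt_two_pow_self
      _ ≤ _ := Nat.le_mul_of_pos_right _ (by positivity)
  refine (Tri.forLoop (N := n) h10 (t := 100 * T + (50 * T + (K * 150 + 50) * T)) (fun j S' =>
      S'.reg 16 = width n (n - j) ∧ ∃ Z : ℕ → ℤ, Holds S' 2 (2 ^ width n (n - j)) Z ∧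
      ∀ r < 2 ^ width n (n - j), |Z r| ≤ 2 ^ (2 ^ level n (n - j) - 1) + 1 ∧
        Z r ≡ residues n X (n - j) r * residues n Y (n - j) r [ZMOD 2 ^ 2 ^ level n (n - j) + 1])
      ⟨by simpa using h16, Z, hZ, by simpa [level_self hn] using hZb⟩ ?_).mono ?_ ?_
  · rintro j hj S' hij k ⟨hI16, Z, hZ, hZb⟩
    obtain ⟨i, hi⟩ : ∃ i, n - 1 - j = i := ⟨_, rfl⟩
    rw [show n - j = i + 1 by omega] at hI16 hZ hZb
    rw [show n - (j + 1) = i by omega]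
    have l1 := level_le_self hn i
    have l4 := four_le_level hn i
    have hT1 : 1 ≤ T := by omega
    have g10 := (k.reg 10 (by decide) rfl).trans h10
    have hlT : len (level n i : ℤ) ≤ T := (len_natCast_le _).trans (by omega)
    refine Tri.seq (t₁ := 100 * T) (Q₁ := fun S'' => S''.reg 17 = level n i)
      (Tri.le ?_ (Nat.mul_le_mul_right _ (by decide : blockWeight
        [(14, .sub (.sub (.reg 10) (.const 1)) (.reg 35)), (17, .load 5 (.reg 14))] ≤ 100))) ?_
    · refine Tri.block_cons (.subN (.subN (.regN g10 (by omega)) .one (by omega))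
        (.regN hij (by omega)) (by omega)) hT1 ?_
      refine Tri.block_cons (v := level n i) (.load (.regN (n := i) (by simp [hi]) (by omega)) ?_ hlT) hT1
        (Tri.block_nil hT1 rfl)
      exact h5.keep k (by simp [arrWrites_levelUp]) i (by omega)
    rintro S₁ k₁ g17
    have g16 := (k₁.reg 16 (by decide) rfl).trans hI16
    have hZ := hZ.keep k₁ (by simp)
    have hev : (Expr.sub (.reg 17) (.const 4)).eval S₁ = (level n i : ℤ) - 4 := by
      simp [Expr.eval, g17]
    refine Tri.le (Tri.ifE (b := T) (t := (K * 150 + 50) * T) (by omega)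
      (by simpa [Expr.Leaf, g17] using hlT) ?_ ?_)
      (Nat.add_le_add_right (Nat.mul_le_mul_right _ (by decide)) _)
    · intro h
      rw [hev] at h
      have h : 4 < level n i := by omega
      rw [width, if_pos h] at g16 hZ hZb
      rw [level, residues, residues, if_pos h, if_pos h, if_pos h] at hZb
      obtain ⟨k2, kℓ, kl, lℓ, l4, hlk⟩ := parts_facts h
      have hZb' : ∀ r < 2 ^ (width n i + parts (level n i)), |Z r| ≤ 2 ^ 2 ^ next (level n i) := by
        intro r hr
        refine (hZb r hr).1.trans ?_
        have h2 := two_le_two_pow (show 1 ≤ next (level n i) by omega)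
        have : (2 : ℤ) ^ 2 ^ next (level n i) =
            2 ^ (2 ^ next (level n i) - 1) + 2 ^ (2 ^ next (level n i) - 1) := by
          rw [← two_mul, ← pow_succ']; congr 1; omega
        have : (1 : ℤ) ≤ 2 ^ (2 ^ next (level n i) - 1) := one_le_pow₀ (by norm_num)
        linarith
      refine (hup S₁ (width n i) (level n i) Z g16 g17 h hZ hZb').mono ?_ ?_
      · rw [add_mul, hT, mul_assoc]
        exact (Nat.mul_le_mul_left _ (two_pow_width_le hn i)).trans (by omega)
      · rintro S'' ⟨q16, q2, qb⟩
        exact ⟨q16, _, q2, fun r hr => ⟨qb r hr, bwd_modEq h (hX' i) (hY' i) hZb'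
          (fun r hr => (hZb r hr).2) r hr⟩⟩
    · intro h
      rw [hev] at h
      have h : ¬ 4 < level n i := by omega
      rw [width, if_neg h] at g16 hZ hZb
      rw [level, residues, residues, if_neg h, if_neg h, if_neg h] at hZb
      refine (Tri.block_nil (b := T) (by omega) ?_).le (Nat.mul_le_mul_right _ (by simp [blockWeight]))
      exact ⟨g16, Z, hZ, hZb⟩
  · have hl : len (n : ℤ) ≤ T := (len_natCast_le n).trans hnT
    have e : 2 ^ n * n ^ 5 = n * T := by rw [hT]; ring
    rw [e]
    refine (loop_cost_le (by omega) hl (K := K * 150 + 200) (by linarith)).trans_eq ?_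
    ring
  · rintro S' ⟨⟨-, Z, h2, hb⟩, -⟩
    rw [Nat.sub_self] at h2 hb
    obtain ⟨b1, b2⟩ := hb 0 (by simp [width])
    exact ⟨Z 0, by simpa using h2 0 (by simp [width]), b1, b2⟩

/-- The residue `z` obtained satisfies `|z| ≤ 2 ^ (2 ^ n - 1) + 1`, and `|x * y|` is at most a
quarter of `2 ^ 2 ^ n`; the sum of both stays below the modulus, so `z` is the product itself. The
`n` rounds cost `O(2 ^ n n ^ 4)` each. -/
theorem tri_mulP : ∃ K, ∀ (S : State) (n : ℕ) (x y : ℤ), 4 ≤ n → S.reg 10 = n →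
    S.reg 11 = x → S.reg 12 = y → |x| ≤ 2 ^ 2 ^ n → |y| ≤ 2 ^ 2 ^ n →
    |x * y| ≤ 2 ^ (2 ^ n - 2) →
    Tri mulP S (K * (2 ^ n * n ^ 5)) (fun S' => S'.reg 13 = x * y) := by
  obtain ⟨K₁, hd⟩ := tri_descend
  obtain ⟨K₂, hb⟩ := tri_baseP
  obtain ⟨K₃, ha⟩ := tri_ascend
  refine ⟨500 + (500 + (500 + (K₁ + (150 * K₂ + (K₃ + 500))))), ?_⟩
  intro S n x y hn h10 h11 h12 hx hy hxy
  obtain ⟨T, hT⟩ : ∃ T, T = 2 ^ n * n ^ 5 := ⟨_, rfl⟩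
  have hn2 : 2 ^ n + 3 ≤ T := by
    have h1 : 2 ^ n * 4 ^ 5 ≤ T := by rw [hT]; gcongr
    have := Nat.two_pow_pos n
    omega
  have hn3 : n < 2 ^ n := Nat.lt_two_pow_self
  have hT1 : 1 ≤ T := by omega
  have hxl : len x ≤ T := (len_le_of_abs_le hx).trans (by omega)
  have hyl : len y ≤ T := (len_le_of_abs_le hy).trans (by omega)
  have hw : Expr.weight (.const 0) = 1 ∧ Expr.growth (.const 0) = 1 := by decide
  rw [← hT]
  simp only [add_mul]
  refine Tri.seq (Q₁ := fun S' => S'.reg 16 = 0 ∧ S'.reg 17 = n) (Tri.le ?_ (Nat.mul_le_mul_right _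
    (by decide : blockWeight [(16, .const 0), (17, .reg 10)] ≤ 500))) ?_
  · refine Tri.block_cons (.const 0) hT1 (Tri.block_cons (.regN h10 (by omega)) hT1 ?_)
    exact Tri.block_nil hT1 ⟨rfl, rfl⟩
  rintro S₁ k₁ ⟨h16, h17⟩
  have g10 := (k₁.reg 10 (by decide) rfl).trans h10
  have g11 := (k₁.reg 11 (by decide) rfl).trans h11
  have g12 := (k₁.reg 12 (by decide) rfl).trans h12
  refine Tri.seq (Q₁ := fun S' => S'.reg = S₁.reg ∧ S'.arr 2 0 = x) ?_ ?_
  · refine Tri.storeE hT1 trivial (by simpa [Expr.Leaf, g11] using hxl) ?_ ⟨rfl, ?_⟩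
    · exact Nat.mul_le_mul_right _ (by decide)
    · simp [Expr.eval, g11]
  rintro S₂ k₂ ⟨e₂, x₂⟩
  refine Tri.seq (Q₁ := fun S' => S'.reg = S₁.reg ∧ S'.arr 2 0 = x ∧ S'.arr 3 0 = y) ?_ ?_
  · refine Tri.storeE hT1 trivial (by simpa [Expr.Leaf, e₂, g12] using hyl) ?_ ⟨e₂, ?_, ?_⟩
    · exact Nat.mul_le_mul_right _ (by decide)
    · simpa using x₂
    · simp [Expr.eval, e₂, g12]
  rintro S₃ k₃ ⟨e₃, x₃, y₃⟩
  rw [← e₃] at g10 g11 g12 h16 h17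
  have hone : ∀ {a : ℕ} {v : ℤ}, S₃.arr a 0 = v → Holds S₃ a 1 fun _ => v := by
    intro a v h j hj
    obtain rfl : j = 0 := by omega
    exact h
  rw [hT]
  refine Tri.seq (hd S₃ n _ _ hn g10 h16 h17 (hone x₃) (hone y₃) hx hy) ?_
  rintro S₄ k₄ ⟨q5, q16, q17, q2, q3⟩
  have hX := abs_residues_le (X := fun _ => x) hx n
  have hY := abs_residues_le (X := fun _ => y) hy n
  rw [level_self hn] at hX hY
  refine Tri.seq ((hb S₄ _ _ _ q16 q2 q3 hX hY).le ?_) ?_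
  · rw [mul_comm 150, mul_assoc]
    refine Nat.mul_le_mul_left _ ?_
    refine le_trans ?_ ((two_pow_width_le hn n).trans ?_)
    · have : 2 ^ width n n ≤ 2 ^ (width n n + level n n + 2) :=
        Nat.pow_le_pow_right (by omega) (by omega)
      refine Nat.mul_le_mul this ?_
      nlinarith
    · exact Nat.mul_le_mul_left _ (Nat.mul_le_mul_left _ (Nat.pow_le_pow_right (by omega) (by omega)))
  intro S₅ k₅ p2
  have hbase : ∀ r < 2 ^ width n n, |residues n (fun _ => x) n r * residues n (fun _ => y) n r| ≤
      2 ^ (5 * 2 ^ 4) := by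
    intro r hr
    rw [abs_mul]
    calc _ ≤ (2 : ℤ) ^ 2 ^ 4 * 2 ^ 2 ^ 4 := by gcongr <;> [exact hX r hr; exact hY r hr]
      _ ≤ _ := by norm_num
  refine Tri.seq (ha S₅ n (fun _ => x) (fun _ => y) _ hn ((k₅.reg 10 (by decide) rfl).trans
    ((k₄.reg 10 (by decide) rfl).trans g10)) ((k₅.reg 16 (by decide) rfl).trans q16) hx hy
    (q5.keep k₅ (by simp [arrWrites_baseP])) p2 fun r hr => ⟨?_, red_modEq _ _⟩) ?_
  · exact abs_red_le (by norm_num) (hbase r hr)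
  rintro S₆ k₆ ⟨z, hz, hzb, hzm⟩
  have hL : 16 ≤ 2 ^ n := (Nat.pow_le_pow_right (by omega) hn).trans' (by norm_num)
  have e1 : (2 : ℤ) ^ 2 ^ n = 2 * 2 ^ (2 ^ n - 1) := by rw [← pow_succ']; congr 1; omega
  have e2 : (2 : ℤ) ^ (2 ^ n - 1) = 2 * 2 ^ (2 ^ n - 2) := by rw [← pow_succ']; congr 1; omega
  have e3 : (1 : ℤ) ≤ 2 ^ (2 ^ n - 2) := one_le_pow₀ (by norm_num)
  obtain rfl : z = x * y := eq_of_modEq_of_abs_lt hzm (by linarith)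
  have hzl : len (x * y) ≤ T := (len_le_of_abs_le hxy).trans (by omega)
  rw [← hT]
  refine Tri.le ?_ (Nat.mul_le_mul_right _
    (by decide : blockWeight [(13, .load 2 (.const 0))] ≤ 500))
  exact Tri.block_cons (.load (.const 0) hz hzl) hT1 (Tri.block_nil hT1 rfl)

@[simp] theorem arrWrites_mulP (x : ℕ) :
    mulP.arrWrites x = (x == 2 || x == 3 || x == 4 || x == 5) := by
  simp only [mulP, descend, ascend, arrWrites_seq, arrWrites_block, arrWrites_forLoop, arrWrites_ifE,
    arrWrites_storeE, arrWrites_levelDown, arrWrites_levelUp, arrWrites_baseP]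
  cases x == 2 <;> cases x == 3 <;> cases x == 4 <;> cases x == 5 <;> rfl

end BitRAM

/-! ### Shifts of univariate polynomials by evaluation at a power of two -/

namespace SSA

/-- Values of the parts with `2 ^ t` coefficients. -/
def partVal (v : ℤ) : ℕ → (ℕ → ℤ) → ℕ → ℤ
  | 0, X => X
  | t + 1, X => fun i => partVal v t X (2 * i) + partVal v t X (2 * i + 1) * v ^ 2 ^ t

theorem partVal_eq_sum (v : ℤ) (t : ℕ) (X : ℕ → ℤ) (i : ℕ) :
    partVal v t X i = ∑ j ∈ Finset.range (2 ^ t), X (i * 2 ^ t + j) * v ^ j := by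
  induction t generalizing i with
  | zero => simp [partVal]
  | succ t ih =>
    simp only [partVal]
    rw [ih, ih, pow_succ, mul_two, Finset.sum_range_add, Finset.sum_mul]
    congr 1
    · refine Finset.sum_congr rfl fun j _ => ?_
      rw [show 2 * i * 2 ^ t + j = i * (2 ^ t + 2 ^ t) + j by ring]
    · refine Finset.sum_congr rfl fun j _ => ?_
      rw [show (2 * i + 1) * 2 ^ t + j = i * (2 ^ t + 2 ^ t) + (2 ^ t + j) by ring, pow_add]
      ring

/-- Coefficients of the shift of the polynomial with the coefficients `X 0, …, X (m - 1)`. -/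
def taylor (m : ℕ) (u : ℤ) (X : ℕ → ℤ) (i : ℕ) : ℤ :=
  ∑ j ∈ Finset.range m, X j * (j.choose i * u ^ (j - i))

/-- The shifted polynomial at `y` is the original one at `y + u`: the binomial theorem after an
exchange of sums. For `y = 2 ^ 2 ^ ω` the left side packs all coefficients of the shift into one
integer, while the right side can be computed from the given coefficients. -/
theorem partVal_taylor (y u : ℤ) (t : ℕ) (X : ℕ → ℤ) :
    partVal y t (taylor (2 ^ t) u X) 0 = partVal (y + u) t X 0 := by
  simp only [partVal_eq_sum, taylor, zero_mul, zero_add, Finset.sum_mul]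
  rw [Finset.sum_comm]
  refine Finset.sum_congr rfl fun j hj => ?_
  rw [add_pow, Finset.mul_sum]
  refine ((Finset.sum_subset (Finset.range_mono (Finset.mem_range.1 hj)) ?_).trans
    (Finset.sum_congr rfl fun i _ => ?_)).symm
  · intro i _ hi
    rw [Nat.choose_eq_zero_of_lt (by simpa using hi)]
    simp
  · ring

theorem abs_pow_le {ω : ℕ} {u : ℤ} (hu : |u| ≤ 2 ^ 2 ^ ω) (t : ℕ) :
    |(2 ^ 2 ^ ω + u) ^ 2 ^ t| ≤ 2 ^ ((2 ^ ω + 1) * 2 ^ t) := by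
  rw [abs_pow, pow_mul]
  gcongr
  refine (abs_add_le _ _).trans ?_
  rw [abs_of_pos (by positivity), pow_succ]
  linarith

theorem abs_partVal_le {ω κ : ℕ} {u : ℤ} {X : ℕ → ℤ} (hu : |u| ≤ 2 ^ 2 ^ ω)
    (hX : ∀ j < 2 ^ κ, |X j| ≤ 2 ^ 2 ^ ω) {t : ℕ} (ht : t ≤ κ) :
    ∀ i < 2 ^ (κ - t), |partVal (2 ^ 2 ^ ω + u) t X i| ≤ 2 ^ ((2 ^ ω + 2) * 2 ^ t) := by
  induction t with
  | zero =>
    intro i hi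
    exact (hX i hi).trans (pow_le_pow_right₀ (by norm_num) (by omega))
  | succ t ih =>
    intro i hi
    have e : κ - t = κ - (t + 1) + 1 := by omega
    have ih := ih (by omega)
    rw [e, pow_succ] at ih
    have h1 := ih (2 * i) (by omega)
    have h2 := ih (2 * i + 1) (by omega)
    have h3 := abs_pow_le hu t
    have ht := Nat.two_pow_pos t
    rw [partVal]
    calc _ ≤ (2 : ℤ) ^ ((2 ^ ω + 2) * 2 ^ t) +
          2 ^ ((2 ^ ω + 2) * 2 ^ t) * 2 ^ ((2 ^ ω + 1) * 2 ^ t) := by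
          refine (abs_add_le _ _).trans (add_le_add h1 ?_)
          rw [abs_mul]
          gcongr
      _ ≤ 2 ^ ((2 ^ ω + 2) * 2 ^ t + (2 ^ ω + 1) * 2 ^ t) +
          2 ^ ((2 ^ ω + 2) * 2 ^ t + (2 ^ ω + 1) * 2 ^ t) := by
          rw [← pow_add]
          exact add_le_add (pow_le_pow_right₀ (by norm_num) (Nat.le_add_right _ _)) le_rfl
      _ = 2 ^ ((2 ^ ω + 2) * 2 ^ t + (2 ^ ω + 1) * 2 ^ t + 1) := by ring
      _ ≤ _ := pow_le_pow_right₀ (by norm_num) (by rw [pow_succ]; nlinarith)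

/-- Packing balanced digits yields a balanced digit for the squared base. Strictness matters: with
`2 ^ (ω + s) = a + 1`, the upper block is at most `2 ^ a - 1`, so the total is below `(2 ^ a - 1) *
2 ^ (a + 1) + 2 ^ a < 2 ^ (2 * a + 1)`. -/
theorem abs_partVal_lt {ω κ : ℕ} {H : ℕ → ℤ} (hH : ∀ j < 2 ^ κ, |H j| < 2 ^ (2 ^ ω - 1)) {s : ℕ}
    (hs : s ≤ κ) : ∀ i < 2 ^ (κ - s), |partVal (2 ^ 2 ^ ω) s H i| < 2 ^ (2 ^ (ω + s) - 1) := by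
  induction s with
  | zero => exact hH
  | succ s ih =>
    intro i hi
    have e : κ - s = κ - (s + 1) + 1 := by omega
    have ih := ih (by omega)
    rw [e, pow_succ] at ih
    have h1 := ih (2 * i) (by omega)
    have h2 := ih (2 * i + 1) (by omega)
    obtain ⟨a, ha⟩ : ∃ a, 2 ^ (ω + s) = a + 1 := ⟨2 ^ (ω + s) - 1, by
      have := Nat.two_pow_pos (ω + s); omega⟩
    rw [partVal, ← add_assoc, pow_succ, ha, ← pow_mul, ← pow_add, ha,
      show (a + 1) * 2 - 1 = a + (a + 1) by omega]
    rw [ha, Nat.add_sub_cancel] at h1 h2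
    have hp : (0 : ℤ) < 2 ^ (a + 1) := by positivity
    have e2 : (2 : ℤ) ^ (a + 1) = 2 * 2 ^ a := pow_succ' _ _
    have h3 : |partVal (2 ^ 2 ^ ω) s H (2 * i + 1) * 2 ^ (a + 1)| ≤ (2 ^ a - 1) * 2 ^ (a + 1) := by
      rw [abs_mul, abs_of_pos hp]
      exact mul_le_mul_of_nonneg_right (by linarith) hp.le
    refine (abs_add_le _ _).trans_lt ?_
    have e3 : (2 : ℤ) ^ (a + (a + 1)) = 2 ^ a * 2 ^ (a + 1) := pow_add _ _ _
    linarith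

end SSA

/-! ### Evaluation at `2 ^ 2 ^ ω + u` along a binary tree -/

namespace BitRAM

open SSA

def evalBody : Prog :=
  .seq (block [(45, .load 6 (.shl (.reg 43) (.const 1))),
      (11, .load 6 (.add (.shl (.reg 43) (.const 1)) (.const 1))), (12, .reg 47)])
    (.seq mulP (block [(45, .add (.reg 45) (.reg 13))]))

def evalPre : List (ℕ × Expr) :=
  [(44, .shl (.const 1) (.sub (.sub (.reg 40) (.const 1)) (.reg 46))),
    (10, .add (.add (.reg 41) (.reg 46)) (.const 3))]

/-- Register `46` holds the depth `t`, `47` the power `(2 ^ 2 ^ ω + u) ^ 2 ^ t`, squared at the end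
of a step, `44` the number of pairs to be joined, and `10` the size for `mulP`. -/
def evalStep : Prog :=
  .seq (block evalPre) (.seq (stage 43 44 45 7 6 evalBody)
    (.seq (block [(11, .reg 47), (12, .reg 47)]) (.seq mulP (block [(47, .reg 13)]))))

def extractPre : List (ℕ × Expr) :=
  [(44, .shl (.const 1) (.add (.reg 46) (.const 1))),
    (48, .shl (.const 1) (.add (.reg 41) (.sub (.sub (.reg 40) (.const 1)) (.reg 46))))]

def extractBody : List (ℕ × Expr) :=
  [(49, .shr (.reg 43) (.const 1)),
    (50, .sub (.reg 43) (.shl (.shr (.reg 43) (.const 1)) (.const 1))),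
    (45, .load 6 (.reg 49)),
    (49, .shr (.add (.reg 45) (.shl (.const 1) (.sub (.reg 48) (.const 1)))) (.reg 48)),
    (45, .ite (.reg 50) (.reg 49) (.sub (.reg 45) (.shl (.reg 49) (.reg 48))))]

def extractStep : Prog := .seq (block extractPre) (stage 43 44 45 7 6 (block extractBody))

/-- Shift the polynomial with `2 ^ κ` coefficients in array `6` by `u`; here `κ`, `ω`, `u` are in
the registers `40`, `41`, `42`, and all coefficients have fewer than `2 ^ ω` bits. -/
def shiftP : Prog :=
  .seq (block [(47, .add (.shl (.const 1) (.shl (.const 1) (.reg 41))) (.reg 42))])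
    (.seq (forLoop 46 40 evalStep) (forLoop 46 40 extractStep))

theorem tri_evalBody : ∃ K, ∀ (S : State) (b n j : ℕ) (x y v : ℤ), 4 ≤ n → S.reg 10 = n →
    S.reg 47 = v → S.reg 43 = j → S.arr 6 (j * 2 : ℕ) = x → S.arr 6 (j * 2 + 1 : ℕ) = y →
    |x| ≤ 2 ^ 2 ^ n → |y| ≤ 2 ^ 2 ^ n → |v| ≤ 2 ^ 2 ^ n → |y * v| ≤ 2 ^ (2 ^ n - 2) →
    len (j : ℤ) ≤ b → 2 ^ n * n ^ 5 ≤ b →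
    Tri evalBody S (K * b) (fun S' => S'.reg 45 = x + y * v) := by
  obtain ⟨K, hmul⟩ := tri_mulP
  refine ⟨100 + (K + 100), ?_⟩
  intro S b n j x y v hn h10 h47 h43 hx hy hxb hyb hvb hyv hj hb
  have hnb : 2 ^ n + 2 ≤ b := by
    have h1 : 2 ^ n * 1024 ≤ b := (Nat.mul_le_mul_left _ (Nat.pow_le_pow_left hn 5)).trans hb
    have h2 : 1 ≤ 2 ^ n := Nat.one_le_two_pow
    linarith
  have hb1 : 1 ≤ b := (Nat.le_add_left 1 (2 ^ n + 1)).trans hnb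
  have hxl : len x ≤ b := (len_le_of_abs_le hxb).trans hnb
  have hyl : len y ≤ b := (len_le_of_abs_le hyb).trans hnb
  have hvl : len v ≤ b := (len_le_of_abs_le hvb).trans hnb
  have hyvl : len (y * v) ≤ b := (len_le_of_abs_le hyv).trans (by have := Nat.sub_le (2 ^ n) 2; linarith)
  rw [add_mul, add_mul]
  refine Tri.seq (Q₁ := fun S' => S'.reg 45 = x ∧ S'.reg 11 = y ∧ S'.reg 12 = v) (Tri.le ?_
    (Nat.mul_le_mul_right _ (by decide : blockWeight
      [(45, .load 6 (.shl (.reg 43) (.const 1))),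
      (11, .load 6 (.add (.shl (.reg 43) (.const 1)) (.const 1))), (12, .reg 47)] ≤ 100))) ?_
  · refine Tri.block_cons (.load (.shlN (n := 1) (.reg h43 hj) .one hb1) hx hxl) hb1 ?_
    refine Tri.block_cons (.load (.addN (.shlN (n := 1) (.reg h43 hj) .one hb1) .one) hy hyl) hb1 ?_
    exact Tri.block_cons (.reg h47 hvl) hb1 (Tri.block_nil hb1 ⟨rfl, rfl, rfl⟩)
  rintro S₁ k₁ ⟨h45, h11, h12⟩
  refine Tri.seq ((hmul S₁ n y v hn ((k₁.reg 10 (by decide) rfl).trans h10) h11 h12 hyb hvb hyv).le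
    (Nat.mul_le_mul_left _ hb)) ?_
  intro S₂ k₂ h13
  refine Tri.le ?_ (Nat.mul_le_mul_right _ (by decide : blockWeight
      [(45, .add (.reg 45) (.reg 13))] ≤ 100))
  exact Tri.block_cons (.add (.reg ((k₂.reg 45 (by decide) rfl).trans h45) hxl) (.reg h13 hyvl)) hb1
    (Tri.block_nil hb1 rfl)

/-- There are `2 ^ (κ - 1 - t)` products of size `2 ^ (ω + t + 3)`: the total `2 ^ (κ + ω + 2)` is
the same at each depth. -/
theorem tri_evalStep : ∃ K, ∀ (S : State) (κ ω t : ℕ) (u : ℤ) (X : ℕ → ℤ), 1 ≤ ω → S.reg 40 = κ →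
    S.reg 41 = ω → S.reg 46 = t → t < κ → S.reg 47 = (2 ^ 2 ^ ω + u) ^ 2 ^ t →
    |u| ≤ 2 ^ 2 ^ ω → (∀ j < 2 ^ κ, |X j| ≤ 2 ^ 2 ^ ω) →
    Holds S 6 (2 ^ (κ - t)) (partVal (2 ^ 2 ^ ω + u) t X) →
    Tri evalStep S (K * (2 ^ (κ + ω + 2) * (κ + ω + 3) ^ 5)) (fun S' =>
      S'.reg 47 = (2 ^ 2 ^ ω + u) ^ 2 ^ (t + 1) ∧
      Holds S' 6 (2 ^ (κ - (t + 1))) (partVal (2 ^ 2 ^ ω + u) (t + 1) X)) := by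
  obtain ⟨Kb, hbody⟩ := tri_evalBody
  obtain ⟨Km, hmul⟩ := tri_mulP
  refine ⟨100 + (2 * (Kb + 150) + (100 + (Km + 100))), ?_⟩
  intro S κ ω t u X hω h40 h41 h46 ht h47 hu hXb hX
  obtain ⟨b, hb⟩ : ∃ b, b = 2 ^ (ω + t + 3) * (κ + ω + 3) ^ 5 := ⟨_, rfl⟩
  obtain ⟨N, hN⟩ : ∃ N, N = 2 ^ (κ - 1 - t) := ⟨_, rfl⟩
  -- The factors have at most `(2 ^ ω + 2) * 2 ^ t` and `(2 ^ ω + 1) * 2 ^ t` bits; `2 ^ n = 8 * 2 ^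
  -- ω * 2 ^ t` also leaves the two spare bits that `mulP` demands of a product.
  obtain ⟨n, hn⟩ : ∃ n, n = ω + t + 3 := ⟨_, rfl⟩
  obtain ⟨v, hv⟩ : ∃ v : ℤ, v = 2 ^ 2 ^ ω + u := ⟨_, rfl⟩
  have hn4 : 4 ≤ n := by omega
  have hN1 : 1 ≤ N := hN ▸ Nat.one_le_two_pow
  have hκb : κ + ω + 3 + 2 ^ n ≤ b := by
    rw [hb, ← hn]
    have h1 := Nat.two_pow_pos n
    have h2 : 2 * (κ + ω + 3) ≤ (κ + ω + 3) ^ 5 := by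
      calc 2 * (κ + ω + 3) ≤ (κ + ω + 3) * (κ + ω + 3) := Nat.mul_le_mul_right _ (by omega)
        _ = (κ + ω + 3) ^ 2 := (sq _).symm
        _ ≤ _ := Nat.pow_le_pow_right (by omega) (by norm_num)
    nlinarith
  have hn0 := Nat.two_pow_pos n
  have hb1 : 1 ≤ b := by omega
  have hnb : 2 ^ n * n ^ 5 ≤ b := by
    rw [hb, ← hn]
    gcongr
    omega
  have hNb : N * b = 2 ^ (κ + ω + 2) * (κ + ω + 3) ^ 5 := by
    rw [hN, hb, ← mul_assoc, ← pow_add]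
    congr 2
    omega
  have hbN : b ≤ N * b := Nat.le_mul_of_pos_left _ hN1
  have hNl : len (N : ℤ) ≤ b := (len_le_of_lt_two_pow (g := κ)
    (hN ▸ Nat.pow_lt_pow_right (by omega) (by omega))).trans (by omega)
  have hXt := abs_partVal_le hu hXb ht.le
  have hXt1 := abs_partVal_le hu hXb (t := t + 1) (by omega)
  have hvt := abs_pow_le hu t
  rw [← hv] at hXt hvt h47 hX hXt1 ⊢
  have e2n : 2 ^ n = 8 * (2 ^ ω * 2 ^ t) := by rw [hn, pow_add, pow_add]; ring
  have hω1 : 2 ≤ 2 ^ ω := two_le_two_pow hω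
  have ht1 := Nat.two_pow_pos t
  have ewt : 2 * 2 ^ t ≤ 2 ^ ω * 2 ^ t := Nat.mul_le_mul_right _ hω1
  have hv2 : |v ^ 2 ^ t| ≤ 2 ^ 2 ^ n := hvt.trans (pow_le_pow_right₀ (by norm_num) (by
    rw [e2n, add_mul]; omega))
  have hX2 : ∀ i < 2 ^ (κ - t), |partVal v t X i| ≤ 2 ^ 2 ^ n := fun i hi =>
    (hXt i hi).trans (pow_le_pow_right₀ (by norm_num) (by rw [e2n, add_mul]; omega))
  have hvv : |v ^ 2 ^ t * v ^ 2 ^ t| ≤ 2 ^ (2 ^ n - 2) := by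
    rw [abs_mul]
    calc _ ≤ (2 : ℤ) ^ ((2 ^ ω + 1) * 2 ^ t) * 2 ^ ((2 ^ ω + 1) * 2 ^ t) := by gcongr
      _ = 2 ^ ((2 ^ ω + 1) * 2 ^ t + (2 ^ ω + 1) * 2 ^ t) := (pow_add _ _ _).symm
      _ ≤ _ := pow_le_pow_right₀ (by norm_num) (by rw [e2n, add_mul]; omega)
  have hXv : ∀ i < 2 ^ (κ - t), |partVal v t X i * v ^ 2 ^ t| ≤ 2 ^ (2 ^ n - 2) := by
    intro i hi
    rw [abs_mul]
    calc _ ≤ (2 : ℤ) ^ ((2 ^ ω + 2) * 2 ^ t) * 2 ^ ((2 ^ ω + 1) * 2 ^ t) := by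
          gcongr; exact hXt i hi
      _ = 2 ^ ((2 ^ ω + 2) * 2 ^ t + (2 ^ ω + 1) * 2 ^ t) := (pow_add _ _ _).symm
      _ ≤ _ := pow_le_pow_right₀ (by norm_num) (by rw [e2n, add_mul, add_mul]; omega)
  have eκ : 2 ^ (κ - t) = 2 * N := by
    rw [hN, ← pow_succ']; congr 1; omega
  have eκ' : 2 ^ (κ - (t + 1)) = N := by
    rw [hN]; congr 1; omega
  rw [eκ] at hX hX2 hXv
  rw [eκ'] at hXt1 ⊢
  have hvl : len (v ^ 2 ^ t) ≤ b := (len_le_of_abs_le hv2).trans (by omega)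
  rw [← hNb]
  simp only [add_mul _ _ (N * b)]
  refine Tri.seq (Q₁ := fun S' => S'.reg 44 = N ∧ S'.reg 10 = n) (Tri.le ?_ (Nat.mul_le_mul
    (by decide : blockWeight evalPre ≤ 100) hbN)) ?_
  · refine Tri.block_cons (.pow2 (.subN (.subN (.regN h40 (by omega)) .one (by omega))
      (.regN h46 (by omega)) (by omega)) (by omega)) hb1 ?_
    refine Tri.block_cons (.addN (n := 3) (.addN (.regN h41 (by omega)) (.regN h46 (by omega)))
      (.const 3)) hb1 ?_
    exact Tri.block_nil hb1 ⟨hN ▸ rfl, hn ▸ rfl⟩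
  rintro S₁ k₁ ⟨h44, h10⟩
  have g47 := (k₁.reg 47 (by decide) rfl).trans h47
  have hX := hX.keep k₁ (by simp)
  refine Tri.seq ((Tri.stage (partVal v (t + 1) X) h44 hNl (fun j hj => (len_le_of_abs_le
    (hXt1 j hj)).trans ?_) (t := Kb * b) ?_ (by simp [evalBody]) (by decide)).le
    (stage_cost_le hN1 le_rfl)) ?_
  · rw [pow_succ, ← mul_assoc]
    rw [e2n] at hκb
    rw [add_mul]
    omega
  · intro j hj S' hij k
    have gX := hX.keep k (by simp [evalBody])
    have := hbody S' b n j (partVal v t X (2 * j)) (partVal v t X (2 * j + 1)) (v ^ 2 ^ t) hn4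
      ((k.reg 10 (by decide) rfl).trans h10) ((k.reg 47 (by decide) rfl).trans g47) hij
      (by rw [mul_comm j]; exact gX _ (by omega)) (by rw [mul_comm j]; exact gX _ (by omega))
      (hX2 _ (by omega)) (hX2 _ (by omega)) hv2 (hXv _ (by omega))
      ((len_natCast_mono hj.le).trans hNl) hnb
    exact this
  intro S₂ k₂ hX₂
  have g47 := (k₂.reg 47 (by decide) rfl).trans g47
  refine Tri.seq (Q₁ := fun S' => S'.reg 11 = v ^ 2 ^ t ∧ S'.reg 12 = v ^ 2 ^ t) (Tri.le ?_
    (Nat.mul_le_mul (by decide : blockWeight [(11, .reg 47), (12, .reg 47)] ≤ 100) hbN)) ?_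
  · refine Tri.block_cons (.reg g47 hvl) hb1 (Tri.block_cons (.reg (v := v ^ 2 ^ t) g47 hvl) hb1 ?_)
    exact Tri.block_nil hb1 ⟨rfl, rfl⟩
  rintro S₃ k₃ ⟨h11, h12⟩
  have g10 := (k₃.reg 10 (by decide) rfl).trans ((k₂.reg 10 (by decide) rfl).trans h10)
  refine Tri.seq ((hmul S₃ n _ _ hn4 g10 h11 h12 hv2 hv2 hvv).le
    (Nat.mul_le_mul_left _ (hnb.trans hbN))) ?_
  intro S₄ k₄ h13
  refine Tri.le ?_ (Nat.mul_le_mul (by decide : blockWeight [(47, .reg 13)] ≤ 100) hbN)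
  refine Tri.block_cons (.reg h13 ((len_le_of_abs_le hvv).trans (by omega))) hb1
    (Tri.block_nil hb1 ⟨?_, ?_⟩)
  · simp only [State.setReg_reg, if_true]
    rw [← pow_add, ← two_mul, ← pow_succ']
  · have hX₃ := Holds.keep hX₂ k₃ (by simp)
    have hX₄ := hX₃.keep k₄ (by simp)
    exact hX₄

end BitRAM

/-! ### Extraction of the digits and the univariate shift -/

namespace BitRAM

open SSA

/-- An entry is `x + y * 2 ^ e` with `|x| < 2 ^ (e - 1)`, so balanced division returns exactly `x`
and `y` (`hi_add_mul`). Entry `j` of the new level is the half of entry `j / 2` that the parity of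
`j` selects. -/
theorem tri_extractStep : ∃ K, ∀ (S : State) (κ ω t : ℕ) (H : ℕ → ℤ), 1 ≤ ω → S.reg 40 = κ →
    S.reg 41 = ω → S.reg 46 = t → t < κ → (∀ j < 2 ^ κ, |H j| < 2 ^ (2 ^ ω - 1)) →
    Holds S 6 (2 ^ t) (partVal (2 ^ 2 ^ ω) (κ - t) H) →
    Tri extractStep S (K * (2 ^ (κ + ω + 2) * (κ + ω + 3))) (fun S' =>
      Holds S' 6 (2 ^ (t + 1)) (partVal (2 ^ 2 ^ ω) (κ - (t + 1)) H)) := by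
  refine ⟨100 + 2 * (500 + 150), ?_⟩
  intro S κ ω t H hω h40 h41 h46 ht hHb hH
  obtain ⟨s, hs⟩ : ∃ s, s = κ - (t + 1) := ⟨_, rfl⟩
  obtain ⟨e, he⟩ : ∃ e, e = 2 ^ (ω + s) := ⟨_, rfl⟩
  obtain ⟨N, hN⟩ : ∃ N, N = 2 ^ (t + 1) := ⟨_, rfl⟩
  obtain ⟨b, hb⟩ : ∃ b, b = 2 ^ (ω + s + 2) * (κ + ω + 3) := ⟨_, rfl⟩
  have he1 : 2 ≤ e := by
    rw [he]
    exact two_le_two_pow (by omega)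
  have hN1 : 1 ≤ N := hN ▸ Nat.one_le_two_pow
  have heb : 4 * e + (κ + ω + 3) ≤ b := by
    have : 2 ^ (ω + s + 2) = 4 * e := by rw [he, pow_add]; ring
    rw [hb, this]
    nlinarith
  have hb1 : 1 ≤ b := by omega
  have hNb : N * b = 2 ^ (κ + ω + 2) * (κ + ω + 3) := by
    rw [hN, hb, ← mul_assoc, ← pow_add]
    congr 2
    omega
  have hbN : b ≤ N * b := Nat.le_mul_of_pos_left _ hN1
  have hNl : len (N : ℤ) ≤ b := (len_le_of_lt_two_pow (g := κ + 1)
    (hN ▸ Nat.pow_lt_pow_right (by omega) (by omega))).trans (by omega)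
  have hlt := abs_partVal_lt hHb (show s ≤ κ by omega)
  rw [show κ - s = t + 1 by omega, ← hN, ← he] at hlt
  rw [show κ - t = s + 1 by omega] at hH
  rw [← hs, ← hN, ← hNb]
  have hstep : ∀ i, partVal (2 ^ 2 ^ ω) (s + 1) H i = partVal (2 ^ 2 ^ ω) s H (2 * i) +
      partVal (2 ^ 2 ^ ω) s H (2 * i + 1) * 2 ^ e := by
    intro i
    rw [partVal, ← pow_mul, ← pow_add, ← he]
  simp only [add_mul _ _ (N * b)]
  refine Tri.seq (Q₁ := fun S' => S'.reg 44 = N ∧ S'.reg 48 = e) (Tri.le ?_ (Nat.mul_le_mul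
    (by decide : blockWeight extractPre ≤ 100) hbN)) ?_
  · refine Tri.block_cons (.pow2 (.addN (.regN h46 (by omega)) .one) (by omega)) hb1 ?_
    refine Tri.block_cons (.pow2 (.addN (.regN h41 (by omega)) (.subN (.subN (.regN h40 (by omega)) .one
      (by omega)) (.regN h46 (by omega)) (by omega))) (by omega)) hb1 ?_
    refine Tri.block_nil hb1 ⟨hN ▸ rfl, ?_⟩
    rw [he, hs, show κ - (t + 1) = κ - 1 - t by omega]
    rfl
  rintro S₁ k₁ ⟨h44, h48⟩
  have hH := hH.keep k₁ (by simp)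
  refine (Tri.stage (b := b) (partVal (2 ^ 2 ^ ω) s H) h44 hNl (fun j hj => (len_le_of_abs_lt
    (hlt j hj)).trans (by omega)) (t := 500 * b) ?_ (by simp) (by decide)).le
    (stage_cost_le hN1 le_rfl)
  intro j hj S' hij k
  have g48 := (k.reg 48 (by decide) rfl).trans h48
  have hlj : len (j : ℤ) ≤ b := (len_natCast_mono hj.le).trans hNl
  have hj2 : len ((j / 2 ^ 1 : ℕ) : ℤ) ≤ b := (len_natCast_mono (Nat.div_le_self _ _)).trans hlj
  have hj3 : j / 2 ^ 1 < 2 ^ t := by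
    rw [hN, pow_succ] at hj
    omega
  have hG := hH.keep k (by simp) (j / 2 ^ 1) hj3
  rw [hstep] at hG
  have hN2 : N = 2 * 2 ^ t := by rw [hN, pow_succ']
  have hlo := hlt (2 * (j / 2 ^ 1)) (by omega)
  have hhi := hlt (2 * (j / 2 ^ 1) + 1) (by omega)
  obtain ⟨x, hx⟩ : ∃ x, x = partVal (2 ^ 2 ^ ω) s H (2 * (j / 2 ^ 1)) := ⟨_, rfl⟩
  obtain ⟨y, hy⟩ : ∃ y, y = partVal (2 ^ 2 ^ ω) s H (2 * (j / 2 ^ 1) + 1) := ⟨_, rfl⟩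
  rw [← hx] at hlo hG
  rw [← hy] at hhi hG
  have hres : partVal (2 ^ 2 ^ ω) s H j = if 0 < ((j % 2 ^ 1 : ℕ) : ℤ) then y else x := by
    rcases Nat.mod_two_eq_zero_or_one j with h | h
    · rw [pow_one, h, hx]
      simp only [Nat.cast_zero, lt_irrefl, if_false]
      congr 1
      omega
    · rw [pow_one, h, hy]
      simp only [Nat.cast_one, zero_lt_one, if_true]
      congr 1
      omega
  have hyl : len y ≤ b := (len_le_of_abs_lt hhi).trans (by omega)
  have hxyl : len (x + y * 2 ^ e) ≤ b := by
    have h1 := (len_add_le x (y * 2 ^ e))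
    have h2 := len_shl_le y e
    have h3 := len_le_of_abs_lt hhi
    have h4 := len_le_of_abs_lt hlo
    omega
  refine Tri.le ?_ (Nat.mul_le_mul_right _ (by decide : blockWeight extractBody ≤ 500))
  refine Tri.block_cons (.shrN (n := 1) (.reg hij hlj) .one) hb1 ?_
  refine Tri.block_cons (.modN (n := 1) (.reg hij hlj) .one hb1) hb1 ?_
  refine Tri.block_cons (.load (.reg rfl hj2) hG hxyl) hb1 ?_
  refine Tri.block_cons (v := y) (.cast (.shr (.add (.reg rfl hxyl) (.pow2 (.subN (.regN g48 (by omega))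
    .one (by omega)) (by omega))) (.regN g48 (by omega))) ?_) hb1 ?_
  · push_cast
    exact hi_add_mul (by omega) y hlo
  refine Tri.block_cons (v := partVal (2 ^ 2 ^ ω) s H j) (.cast (.ite
    (u := (j % 2 ^ 1 : ℕ)) (v := y) (w := x + y * 2 ^ e - y * 2 ^ e)
    (.reg rfl ((len_natCast_mono (Nat.mod_le _ _)).trans hlj)) (fun _ => .reg rfl hyl)
    fun _ => .sub (.reg rfl hxyl) (.shl (.reg rfl hyl) (.regN g48 (by omega)) (by omega))) ?_) hb1
    (Tri.block_nil hb1 rfl)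
  rw [hres, add_sub_cancel_right]

theorem tri_shiftP : ∃ K, ∀ (S : State) (κ ω : ℕ) (u : ℤ) (X : ℕ → ℤ), 1 ≤ ω → S.reg 40 = κ →
    S.reg 41 = ω → S.reg 42 = u → |u| ≤ 2 ^ 2 ^ ω → (∀ j < 2 ^ κ, |X j| ≤ 2 ^ 2 ^ ω) →
    (∀ j < 2 ^ κ, |taylor (2 ^ κ) u X j| < 2 ^ (2 ^ ω - 1)) → Holds S 6 (2 ^ κ) X →
    Tri shiftP S (K * (2 ^ (κ + ω + 2) * (κ + ω + 3) ^ 6)) (fun S' =>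
      Holds S' 6 (2 ^ κ) (taylor (2 ^ κ) u X)) := by
  obtain ⟨K₁, he⟩ := tri_evalStep
  obtain ⟨K₂, hx⟩ := tri_extractStep
  refine ⟨100 + (K₁ + 40 + (K₂ + 40)), ?_⟩
  intro S κ ω u X hω h40 h41 h42 hu hXb hHb hX
  obtain ⟨D, hD⟩ : ∃ D, D = κ + ω + 3 := ⟨_, rfl⟩
  obtain ⟨A, hA⟩ : ∃ A, A = 2 ^ (κ + ω + 2) * D ^ 5 := ⟨_, rfl⟩
  have e6 : 2 ^ (κ + ω + 2) * D ^ 6 = D * A := by rw [hA]; ring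
  have hκA : len (κ : ℤ) ≤ A := by
    refine (len_natCast_le κ).trans ?_
    rw [hA]
    refine (show κ + 1 ≤ D by omega).trans ?_
    calc D = 1 * D ^ 1 := by ring
      _ ≤ _ := Nat.mul_le_mul Nat.one_le_two_pow (Nat.pow_le_pow_right (by omega) (by omega))
  have hloop : ∀ {K t : ℕ}, t ≤ K * A → (κ + 1) * (t + 40 * len (κ : ℤ)) ≤
      K * (D * A) + 40 * (D * A) := by
    intro K t ht
    calc _ ≤ D * (K * A + 40 * A) := by gcongr; omega
      _ = _ := by ring
  have hD1 : 1 ≤ D := by omega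
  have hωA : ω + 4 * 2 ^ ω + 3 ≤ D * A := by
    rw [← e6]
    calc ω + 4 * 2 ^ ω + 3 ≤ 4 * 2 ^ ω * D := by
          have := Nat.one_le_two_pow (n := ω)
          have h1 : 4 * 2 ^ ω * 1 ≤ 4 * 2 ^ ω * ω := Nat.mul_le_mul_left _ hω
          have h3 : 1 * D ≤ 2 ^ ω * D := Nat.mul_le_mul_right _ this
          have h2 : 2 ^ ω * 4 ≤ 2 ^ ω * D := Nat.mul_le_mul_left _ (by omega)
          linarith
      _ = 2 ^ (ω + 2) * D ^ 1 := by ring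
      _ ≤ _ := Nat.mul_le_mul (Nat.pow_le_pow_right (by omega) (by omega))
        (Nat.pow_le_pow_right hD1 (by omega))
  rw [← hD, e6]
  simp only [add_mul _ _ (D * A)]
  have hT1 : 1 ≤ D * A := by omega
  refine Tri.seq (Q₁ := fun S' => S'.reg 47 = (2 ^ 2 ^ ω + u)) (Tri.le ?_ (Nat.mul_le_mul_right _
    (by decide : blockWeight [(47, .add (.shl (.const 1) (.shl (.const 1) (.reg 41))) (.reg 42))] ≤
      100))) ?_
  · refine Tri.block_cons (v := 2 ^ 2 ^ ω + u) (.cast (.add (.pow2 (.pow2 (.regN h41 (by omega))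
      (by omega)) (by omega)) (.reg h42 ((len_le_of_abs_le hu).trans (by omega)))) (by simp)) hT1 ?_
    exact Tri.block_nil hT1 rfl
  intro S₁ k₁ h47
  have g40 := (k₁.reg 40 (by decide) rfl).trans h40
  have g41 := (k₁.reg 41 (by decide) rfl).trans h41
  have hX := hX.keep k₁ (by simp)
  refine Tri.seq ((Tri.forLoop g40 (t := K₁ * A) (fun t S' => S'.reg 47 = (2 ^ 2 ^ ω + u) ^ 2 ^ t ∧
    Holds S' 6 (2 ^ (κ - t)) (partVal (2 ^ 2 ^ ω + u) t X)) ⟨by simpa using h47, hX⟩ ?_).mono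
    (hloop le_rfl) fun _ h => h.1) ?_
  · rintro t ht S' hij k ⟨q47, hq⟩
    rw [hA, hD]
    exact he S' κ ω t u X hω ((k.reg 40 (by decide) rfl).trans g40)
      ((k.reg 41 (by decide) rfl).trans g41) hij ht q47 hu hXb hq
  rintro S₂ k₂ ⟨-, h6⟩
  rw [Nat.sub_self, pow_zero] at h6
  refine (Tri.forLoop ((k₂.reg 40 (by decide) rfl).trans g40) (t := K₂ * A) (fun t S' =>
    Holds S' 6 (2 ^ t) (partVal (2 ^ 2 ^ ω) (κ - t) (taylor (2 ^ κ) u X))) ?_ ?_).mono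
    (hloop le_rfl) fun S' h => ?_
  · intro j hj
    obtain rfl : j = 0 := by simpa using hj
    -- The value computed by the first loop is read as the packed coefficients of the shifted
    -- polynomial.
    rw [Nat.sub_zero, partVal_taylor]
    exact h6 0 (by omega)
  · intro t ht S' hij k hq
    refine (hx S' κ ω t _ hω ((k.reg 40 (by decide) rfl).trans ((k₂.reg 40 (by decide) rfl).trans g40))
      ((k.reg 41 (by decide) rfl).trans ((k₂.reg 41 (by decide) rfl).trans g41)) hij ht hHb hq).le ?_
    rw [hA, ← hD]
    exact Nat.mul_le_mul_left _ (Nat.mul_le_mul_left _ (by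
      calc D = D ^ 1 := (pow_one D).symm
        _ ≤ _ := Nat.pow_le_pow_right hD1 (by omega)))
  · have := h.1
    rw [Nat.sub_self] at this
    exact this

@[simp] theorem arrWrites_shiftP (x : ℕ) : shiftP.arrWrites x =
    (x == 2 || x == 3 || x == 4 || x == 5 || x == 6 || x == 7) := by
  simp only [shiftP, evalStep, extractStep, evalBody, arrWrites_seq, arrWrites_block,
    arrWrites_forLoop, arrWrites_stage, arrWrites_mulP]
  cases x == 2 <;> cases x == 3 <;> cases x == 4 <;> cases x == 5 <;> cases x == 6 <;>
    cases x == 7 <;> rfl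

end BitRAM

/-! ### Sizes -/

namespace BitRAM

/-- `r := cnt * x` by repeated addition. -/
def timesP (r cnt x : ℕ) : Prog :=
  .seq (block [(r, .const 0)]) (forLoop 56 cnt (block [(r, .add (.reg r) (.reg x))]))

theorem tri_timesP {S : State} {r cnt x N y b : ℕ} (hN : S.reg cnt = N) (hy : S.reg x = y)
    (hb : 1 ≤ b) (hNb : len (N : ℤ) ≤ b) (hyb : len (y : ℤ) ≤ b) (hNy : len ((N * y : ℕ) : ℤ) ≤ b)
    (hr : r < 100 := by decide) (hx : x < 100 := by decide) (hcnt : cnt < 100 := by decide)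
    (hrx : x ≠ r := by decide) (hrc : cnt ≠ r := by decide) (h56 : cnt ≠ 56 := by decide)
    (hr56 : r ≠ 56 := by decide)
    (hw1 : (block [(r, .add (.reg r) (.reg x))]).writes 56 = false := by rfl)
    (hw2 : (block [(r, .add (.reg r) (.reg x))]).writes cnt = false := by rfl)
    (hw3 : (forLoop 56 cnt (block [(r, .add (.reg r) (.reg x))])).writes x = false := by rfl) :
    Tri (timesP r cnt x) S (100 * ((N + 1) * b)) (fun S' => S'.reg r = ((N * y : ℕ) : ℤ)) := by
  refine Tri.le (t := 10 * b + (N + 1) * (20 * b + 40 * len (N : ℤ))) (Tri.seq (Q₁ := fun S' =>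
    S' = S.setReg r 0) (Tri.le (Tri.block_cons (b := b) (.const 0) hb (Tri.block_nil hb rfl))
      (Nat.mul_le_mul_right _ (by simp [blockWeight, Expr.weight, Expr.growth, len_zero]))) ?_) ?_
  · rintro S₁ - rfl
    refine (Tri.forLoop (N := N) (t := 20 * b) (by simpa [hrc] using hN) (fun j S' =>
      S'.reg r = ((j * y : ℕ) : ℤ)) (by simp [hr56]) ?_ (by decide) hcnt h56 hw1 hw2).mono le_rfl
      fun _ h => h.1
    intro j hj S' hij k hI
    have hjb : len ((j * y : ℕ) : ℤ) ≤ b :=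
      (len_natCast_mono (Nat.mul_le_mul_right y hj.le)).trans hNy
    have g : S'.reg x = y := (k.reg x hx hw3).trans (by simpa [hrx] using hy)
    refine Tri.le (Tri.block_cons (b := b) (.addN (.reg hI hjb) (.reg g hyb)) hb
      (Tri.block_nil hb ?_) (by simp [Expr.ok, hr, hx])) (Nat.mul_le_mul_right _
      (by simp [blockWeight, Expr.weight, Expr.growth]))
    simp only [State.setReg_reg, hr56, if_false, if_true]
    ring_nf
  · have h1 : (N + 1) * (20 * b + 40 * len (N : ℤ)) ≤ (N + 1) * (20 * b + 40 * b) := by gcongr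
    have h2 : 1 * b ≤ (N + 1) * b := Nat.mul_le_mul_right _ (by omega)
    have h3 : (N + 1) * (20 * b + 40 * b) = 60 * ((N + 1) * b) := by ring
    omega

def maxBody (a : ℕ) : List (ℕ × Expr) :=
  [(62, .load a (.reg 61)), (60, .ite (.sub (.reg 62) (.reg 60)) (.reg 62) (.reg 60)),
    (60, .ite (.sub (.sub (.const 0) (.reg 62)) (.reg 60)) (.sub (.const 0) (.reg 62)) (.reg 60))]

/-- Put the maximum of the absolute values in the array `a` into register `60`. -/
def maxP (a cnt : ℕ) : Prog :=
  .seq (block [(60, .const 0)]) (forLoop 61 cnt (block (maxBody a)))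

theorem tri_maxP {S : State} {a cnt N τ b : ℕ} {X : ℕ → ℤ} (hN : S.reg cnt = N)
    (hX : Holds S a N X) (hXb : ∀ j < N, |X j| < 2 ^ τ) (hb : τ + 2 ≤ b) (hNb : len (N : ℤ) ≤ b)
    (hcnt : cnt < 100 := by decide) (hc60 : cnt ≠ 60 := by decide) (hc61 : cnt ≠ 61 := by decide)
    (hw2 : (block (maxBody a)).writes cnt = false := by rfl) :
    Tri (maxP a cnt) S (1000 * ((N + 1) * b)) (fun S' => ∃ m : ℕ, S'.reg 60 = m ∧ m < 2 ^ τ ∧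
      ∀ j < N, |X j| ≤ m) := by
  have hb1 : 1 ≤ b := by omega
  refine Tri.le (t := 10 * b + (N + 1) * (500 * b + 40 * len (N : ℤ))) (Tri.seq (Q₁ := fun S' =>
    S' = S.setReg 60 0) (Tri.le (Tri.block_cons (b := b) (.const 0) hb1 (Tri.block_nil hb1 rfl))
      (Nat.mul_le_mul_right _ (by simp [blockWeight, Expr.weight, Expr.growth, len_zero]))) ?_) ?_
  · rintro S₁ - rfl
    refine (Tri.forLoop (N := N) (t := 500 * b) (by simpa [hc60] using hN) (fun i S' =>
      ∃ m : ℕ, S'.reg 60 = m ∧ m < 2 ^ τ ∧ ∀ j < i, |X j| ≤ m) ⟨0, rfl, by positivity, by simp⟩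
      ?_ (by decide) hcnt hc61 rfl hw2).mono le_rfl fun _ h => h.1
    rintro j hj S' hij k ⟨m, h60, hm, hI⟩
    have hmb : len (m : ℤ) ≤ b := (len_le_of_lt_two_pow hm).trans (by omega)
    have hxb : len (X j) ≤ b := (len_le_of_abs_lt (hXb j hj)).trans (by omega)
    have hv : ∀ v : ℤ, |v| < 2 ^ τ → len v ≤ b := fun v h => (len_le_of_abs_lt h).trans (by omega)
    have hc : S'.arr a (j : ℤ) = X j := by
      have h := k.arr a (by simp)
      rw [h]
      exact hX j hj
    have hmax : ∀ v w : ℤ, (if 0 < v - w then v else w) = max v w := by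
      intro v w
      rcases lt_or_ge w v with h | h
      · rw [if_pos (by linarith), max_eq_left h.le]
      · rw [if_neg (by linarith), max_eq_right h]
    have hm1 : |max (X j) m| < 2 ^ τ := by
      rcases max_choice (X j) m with h | h <;> rw [h]
      · exact hXb j hj
      · rw [Nat.abs_cast]
        exact_mod_cast hm
    have hm2 : |max (0 - X j) (max (X j) m)| < 2 ^ τ := by
      rcases max_choice (0 - X j) (max (X j) m) with h | h <;> rw [h]
      · rw [zero_sub, abs_neg]
        exact hXb j hj
      · exact hm1
    refine Tri.le ?_ (Nat.mul_le_mul_right _ (by simp [maxBody, blockWeight, Expr.weight, Expr.growth,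
      len_zero] : blockWeight (maxBody a) ≤ 500))
    refine Tri.block_cons (.load (.reg hij ((len_natCast_mono hj.le).trans hNb)) hc hxb) hb1 ?_
    refine Tri.block_cons (v := max (X j) m) (.cast (.ite (u := X j - m) (v := X j) (w := m)
      (.sub (.reg rfl hxb) (.reg h60 hmb)) (fun _ => .reg rfl hxb) (fun _ => .reg h60 hmb))
      (hmax _ _)) hb1 ?_
    refine Tri.block_cons (v := max (0 - X j) (max (X j) m)) (.cast (.ite
      (u := 0 - X j - max (X j) m) (v := 0 - X j) (w := max (X j) m)
      (.sub (.sub (.const 0) (.reg rfl hxb)) (.reg rfl (hv _ hm1)))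
      (fun _ => .sub (.const 0) (.reg rfl hxb)) (fun _ => .reg rfl (hv _ hm1)))
      (hmax _ _)) hb1 (Tri.block_nil hb1 ?_)
    have h0 : 0 ≤ max (0 - X j) (max (X j) m) :=
      (Int.natCast_nonneg m).trans ((le_max_right _ _).trans (le_max_right _ _))
    obtain ⟨m', hm'⟩ := Int.eq_ofNat_of_zero_le h0
    rw [hm'] at hm2
    refine ⟨m', by simpa using hm', ?_, ?_⟩
    · rw [Nat.abs_cast] at hm2
      exact_mod_cast hm2
    · intro i hi
      rw [← hm']
      rcases Nat.lt_succ_iff_lt_or_eq.1 hi with h | rfl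
      · exact (hI i h).trans ((le_max_right _ _).trans (le_max_right _ _))
      · refine abs_le.2 ⟨?_, (le_max_left _ _).trans (le_max_right _ _)⟩
        have := le_max_left (0 - X i) (max (X i) m)
        linarith
  · have h1 : (N + 1) * (500 * b + 40 * len (N : ℤ)) ≤ (N + 1) * (500 * b + 40 * b) := by gcongr
    have h2 : 1 * b ≤ (N + 1) * b := Nat.mul_le_mul_right _ (by omega)
    have h3 : (N + 1) * (500 * b + 40 * b) = 540 * ((N + 1) * b) := by ring
    omega

/-- Search the least value of register `r` for which register `x` has at most `e` bits. -/
def searchP (r x : ℕ) (e : Expr) : Prog :=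
  .seq (block [(r, .const 0)]) (whileE (.shr (.reg x) e) (block [(r, .add (.reg r) (.const 1))]))

/-- The function `g` is what the expression computes from the candidate: the identity in the search
for a logarithm, `2 ^ a` in the search for the logarithm of a bitsize. A candidate that is reached
is zero or has a predecessor that failed, so `hgb` bounds all of them. -/
theorem tri_searchP {S : State} {r x y A b : ℕ} {e : Expr} (g : ℕ → ℕ) (hg : ∀ a, a ≤ g a)
    (hy : S.reg x = y) (hyb : len (y : ℤ) ≤ b)
    (hgb : ∀ a, (a = 0 ∨ 2 ^ g (a - 1) ≤ y) → g a + 1 ≤ b ∧ a ≤ A)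
    (he : ∀ (S' : State) (a : ℕ), S'.reg r = (a : ℤ) → g a + 1 ≤ b → e.Val S' b (g a : ℤ))
    (hok : (Expr.shr (.reg x) e).ok = true := by rfl)
    (hw : (Expr.shr (.reg x) e).weight + (Expr.shr (.reg x) e).growth ≤ 500 := by decide)
    (hr : r < 100 := by decide) (hx : x < 100 := by decide) (hxr : x ≠ r := by decide)
    (hwx : (block [(r, .add (.reg r) (.const 1))]).writes x = false := by rfl) :
    Tri (searchP r x e) S (1000 * ((A + 1) * b)) (fun S' => ∃ a : ℕ, S'.reg r = a ∧ y < 2 ^ g a ∧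
      (a = 0 ∨ 2 ^ g (a - 1) ≤ y)) := by
  have hb1 : 1 ≤ b := (one_le_len _).trans hyb
  have hex : ∃ a, y < 2 ^ g a := ⟨y, Nat.lt_two_pow_self.trans_le
    (Nat.pow_le_pow_right (by omega) (hg y))⟩
  classical
  obtain ⟨N, hN, hmin⟩ : ∃ N, y < 2 ^ g N ∧ ∀ a < N, 2 ^ g a ≤ y :=
    ⟨Nat.find hex, Nat.find_spec hex, fun a h => not_lt.1 (Nat.find_min hex h)⟩
  have hpre : ∀ a ≤ N, a = 0 ∨ 2 ^ g (a - 1) ≤ y := by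
    intro a ha
    rcases Nat.eq_zero_or_pos a with h | h
    · exact .inl h
    · exact .inr (hmin _ (by omega))
  have hNA := (hgb N (hpre N le_rfl)).2
  refine Tri.le (t := 10 * b + (N + 1) * (((Expr.shr (.reg x) e).weight +
      (Expr.shr (.reg x) e).growth) * b + 20 * b)) (Tri.seq (Q₁ := fun S' => S' = S.setReg r 0)
    (Tri.le (Tri.block_cons (b := b) (.const 0) hb1 (Tri.block_nil hb1 rfl))
      (Nat.mul_le_mul_right _ (by simp [blockWeight, Expr.weight, Expr.growth, len_zero]))) ?_) ?_
  · rintro S₁ - rfl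
    have hval : ∀ a ≤ N, ∀ S' : State, S'.reg r = (a : ℤ) → S'.reg x = y →
        (Expr.shr (.reg x) e).Val S' b (y / 2 ^ g a : ℕ) := fun a ha S' h1 h2 =>
      .shrN (.reg h2 hyb) (he S' a h1 (hgb a (hpre a ha)).1)
    refine (Tri.whileE (t := 20 * b) (fun j S' => S'.reg r = (j : ℤ) ∧ S'.reg x = y) N hb1
      ⟨by simp, by simpa [hxr] using hy⟩ ?_ ?_ hok).mono le_rfl
      fun S' h => ⟨N, h.1, hN, hpre N le_rfl⟩
    · rintro j hj S' ⟨h1, h2⟩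
      have hv := hval j hj.le S' h1 h2
      refine ⟨hv.leaf, ?_, ?_⟩
      · rw [hv.eval]
        exact_mod_cast Nat.div_pos (hmin j hj) (Nat.two_pow_pos _)
      · have hjb : j + 1 ≤ b := by
          have := hg j
          have := (hgb j (hpre j hj.le)).1
          omega
        refine Tri.post (Tri.block_cons (b := b) (.addN (.regN h1 hjb) .one) hb1
          (Tri.block_nil hb1 rfl) (by simpa [Expr.ok] using hr)) (Nat.mul_le_mul_right _ ?_) ?_
        · simp [blockWeight, Expr.weight, Expr.growth, show len 1 = 2 by decide]
        · rintro S'' k rfl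
          exact ⟨by simp, (k.reg x hx hwx).trans h2⟩
    · rintro S' ⟨h1, h2⟩
      have hv := hval N le_rfl S' h1 h2
      refine ⟨hv.leaf, ?_⟩
      rw [hv.eval, Nat.div_eq_of_lt hN]
      simp
  · calc _ ≤ 10 * ((A + 1) * b) + (A + 1) * (500 * b + 20 * b) := by
          gcongr
          exact Nat.le_mul_of_pos_left _ (by omega)
      _ = 530 * ((A + 1) * b) := by ring
      _ ≤ _ := Nat.mul_le_mul_right _ (by norm_num)

end BitRAM

/-! ### Shifts in one variable after the other -/

namespace TaylorShift

open MvPolynomial SSA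

theorem coeff_prod_X_add_C_pow {n : ℕ} (u : Fin n → ℤ) (e m : Fin n →₀ ℕ) :
    coeff m (∏ l, ((X l + C (u l) : MvPolynomial (Fin n) ℤ)) ^ e l) =
      ∏ l, ((e l).choose (m l) * u l ^ (e l - m l) : ℤ) := by
  classical
  have h1 : ∀ l, ((X l + C (u l) : MvPolynomial (Fin n) ℤ)) ^ e l =
      ∑ i ∈ Finset.range (e l + 1), C (((e l).choose i : ℤ) * u l ^ (e l - i)) * X l ^ i := by
    intro l
    rw [add_pow]
    refine Finset.sum_congr rfl fun i _ => ?_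
    simp only [map_mul, map_pow, map_natCast]
    ring
  simp only [h1, Finset.prod_univ_sum, Finset.prod_mul_distrib, ← map_prod]
  have h2 : ∀ p : Fin n → ℕ, ∏ l, (X l : MvPolynomial (Fin n) ℤ) ^ p l =
      monomial (Finsupp.equivFunOnFinite.symm p) 1 := by
    intro p
    rw [monomial_eq, Finsupp.prod_fintype _ _ (by simp)]
    simp
  simp only [h2, coeff_sum, coeff_C_mul, coeff_monomial]
  rw [Finset.sum_eq_single (fun l => m l)]
  · rw [if_pos (by ext; simp), mul_one]
  · intro p _ hp
    rw [if_neg, mul_zero]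
    rintro rfl
    exact hp (by ext; simp)
  · intro hm
    simp only [Fintype.mem_piFinset, Finset.mem_range, not_forall] at hm
    obtain ⟨l, hl⟩ := hm
    rw [← Finset.prod_mul_distrib, Finset.prod_eq_zero (Finset.mem_univ l), zero_mul]
    rw [Nat.choose_eq_zero_of_lt (Nat.lt_of_succ_le (not_lt.1 hl))]
    simp

theorem coeff_shift {n : ℕ} (u : Fin n → ℤ) (f : MvPolynomial (Fin n) ℤ) (m : Fin n →₀ ℕ) :
    coeff m (shift u f) = ∑ e ∈ f.support, coeff e f *
      ∏ l, ((e l).choose (m l) * u l ^ (e l - m l) : ℤ) := by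
  conv_lhs => rw [f.as_sum]
  simp only [shift, map_sum, coeff_sum, aeval_monomial]
  refine Finset.sum_congr rfl fun e _ => ?_
  rw [Finsupp.prod_fintype _ _ (by simp), algebraMap_eq, coeff_C_mul, coeff_prod_X_add_C_pow]

/-- The first `k` components of `u`. -/
def firstOf {n : ℕ} (k : ℕ) (u : Fin n → ℤ) (l : Fin n) : ℤ := if (l : ℕ) < k then u l else 0

/-- Before variable `k` is shifted, its factor in `coeff_shift` is a binomial coefficient times `0 ^
(e k - i)`, which is `1` for `i = e k` and `0` otherwise. The sum over `i` therefore selects `i = e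
k` and restores the factor for `u k`. -/
theorem coeff_shift_succ {n d : ℕ} (u : Fin n → ℤ) {f : MvPolynomial (Fin n) ℤ} (k : Fin n)
    (hf : degreeOf k f ≤ d) (m : Fin n →₀ ℕ) :
    coeff m (shift (firstOf (k + 1) u) f) =
      taylor (d + 1) (u k) (fun i => coeff (m.update k i) (shift (firstOf k u) f)) (m k) := by
  classical
  simp only [taylor, coeff_shift, Finset.sum_mul]
  rw [Finset.sum_comm]
  refine Finset.sum_congr rfl fun e he => ?_
  have hek : e k ≤ d := (degreeOf_le_iff.1 hf) e he
  have h1 : ∀ i, ∏ l, ((e l).choose ((m.update k i) l) *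
      firstOf k u l ^ (e l - (m.update k i) l) : ℤ) =
      (if e k = i then 1 else 0) * ∏ l ∈ Finset.univ.erase k,
        ((e l).choose (m l) * firstOf (k + 1) u l ^ (e l - m l) : ℤ) := by
    intro i
    rw [← Finset.mul_prod_erase _ _ (Finset.mem_univ k)]
    congr 1
    · rw [Finsupp.update_apply, if_pos rfl, firstOf, if_neg (lt_irrefl _)]
      split_ifs with h
      · simp [h]
      · rcases Nat.lt_or_gt_of_ne h with h | h
        · simp [Nat.choose_eq_zero_of_lt h]
        · simp [zero_pow (show e k - i ≠ 0 by omega)]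
    · refine Finset.prod_congr rfl fun l hl => ?_
      have hlk : l ≠ k := Finset.ne_of_mem_erase hl
      have hlk' : (l : ℕ) ≠ k := fun h => hlk (Fin.ext h)
      rw [Finsupp.update_apply, if_neg hlk, firstOf, firstOf]
      congr 2
      split_ifs <;> first | rfl | omega
  simp only [h1]
  rw [Finset.sum_eq_single (e k)]
  · rw [if_pos rfl, ← Finset.mul_prod_erase _ _ (Finset.mem_univ k), one_mul]
    simp only [firstOf, Nat.lt_succ_self, if_true]
    ring
  · intro i _ hi
    rw [if_neg (Ne.symm hi)]
    simp
  · intro h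
    simp at h
    omega

end TaylorShift

/-! ### Growth under a univariate shift, and lines in a tensor -/

namespace SSA

theorem taylor_congr {m : ℕ} {u : ℤ} {X Y : ℕ → ℤ} (h : ∀ i < m, X i = Y i) :
    taylor m u X = taylor m u Y := by
  ext i
  exact Finset.sum_congr rfl fun j hj => by rw [h j (Finset.mem_range.1 hj)]

/-- Coefficients that are zero do not matter. -/
theorem taylor_pad {m m' : ℕ} (h : m ≤ m') (u : ℤ) (X : ℕ → ℤ) :
    taylor m' u (fun i => if i < m then X i else 0) = taylor m u X := by
  ext i
  unfold taylor
  refine (Finset.sum_subset (Finset.range_mono h) ?_).symm.trans (Finset.sum_congr rfl ?_)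
  · intro j _ hj
    simp [show ¬ j < m by simpa using hj]
  · intro j hj
    simp [show j < m by simpa using hj]

/-- Up to sign, each factor of `X j` is a single term of the expansion of `(|u| + 1) ^ j` or zero,
and the sum of these powers over `j < m` is dominated by `(|u| + 2) ^ m ≤ 2 ^ (m * (s + 1))`. This
is the source of the term with `σ` in the running time. -/
theorem abs_taylor_le {m s : ℕ} {u B : ℤ} {X : ℕ → ℤ} (hB : ∀ j < m, |X j| ≤ B)
    (hB0 : 0 ≤ B) (hu : |u| < 2 ^ s) (i : ℕ) : |taylor m u X i| ≤ B * 2 ^ (m * (s + 1)) := by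
  have h0 := abs_nonneg u
  have h2 : |u| + 1 + 1 ≤ 2 ^ (s + 1) := by
    have : (1 : ℤ) ≤ 2 ^ s := one_le_pow₀ (by norm_num)
    rw [pow_succ]
    linarith
  have h1 : ∀ j, |(j.choose i * u ^ (j - i) : ℤ)| ≤ (|u| + 1) ^ j := by
    intro j
    rw [abs_mul, Nat.abs_cast, abs_pow]
    rcases Nat.lt_or_ge j i with h | h
    · rw [Nat.choose_eq_zero_of_lt h]
      simp
      positivity
    · rw [add_pow]
      refine le_trans ?_ (Finset.single_le_sum (f := fun k => |u| ^ k * 1 ^ (j - k) * (j.choose k : ℤ))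
        (fun k _ => by positivity) (Finset.mem_range.2 (show j - i < j + 1 by omega)))
      simp [Nat.choose_symm h, mul_comm]
  have h3 : ∑ j ∈ Finset.range m, (|u| + 1) ^ j ≤ (|u| + 1 + 1) ^ m := by
    rw [add_pow (|u| + 1) 1 m, Finset.sum_range_succ]
    refine le_trans (Finset.sum_le_sum fun j hj => ?_) (le_add_of_nonneg_right (by positivity))
    rw [one_pow, mul_one]
    refine le_mul_of_one_le_right (by positivity) ?_
    exact_mod_cast Nat.choose_pos (Finset.mem_range.1 hj).le
  calc |taylor m u X i| ≤ ∑ j ∈ Finset.range m, |X j * (j.choose i * u ^ (j - i))| :=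
        Finset.abs_sum_le_sum_abs _ _
    _ ≤ ∑ j ∈ Finset.range m, B * (|u| + 1) ^ j := by
        refine Finset.sum_le_sum fun j hj => ?_
        rw [abs_mul]
        exact mul_le_mul (hB j (Finset.mem_range.1 hj)) (h1 j) (abs_nonneg _) hB0
    _ = B * ∑ j ∈ Finset.range m, (|u| + 1) ^ j := by rw [Finset.mul_sum]
    _ ≤ B * (2 ^ (s + 1)) ^ m := by
        refine mul_le_mul_of_nonneg_left (h3.trans ?_) hB0
        gcongr
    _ = _ := by rw [← pow_mul, mul_comm m]

/-- Number of the line in direction `p` through `j`. -/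
def lineOf (p D j : ℕ) : ℕ := j / (p * D) * p + j % p

/-- The first index on the line with the number `φ`. -/
def lineStart (p D φ : ℕ) : ℕ := φ / p * (p * D) + φ % p

/-- Shift along all lines in direction `p`. -/
def axisShift (p D : ℕ) (u : ℤ) (Y : ℕ → ℤ) (j : ℕ) : ℤ :=
  taylor D u (fun i => Y (lineStart p D (lineOf p D j) + i * p)) (j / p % D)

theorem lineOf_mod (p D j : ℕ) : lineOf p D j % p = j % p := by
  simp [lineOf]

theorem lineOf_div {p D j : ℕ} (hp : 0 < p) : lineOf p D j / p = j / (p * D) := by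
  rw [lineOf, mul_comm, Nat.mul_add_div hp, Nat.div_eq_of_lt (Nat.mod_lt _ hp), add_zero]

theorem lineStart_lineOf {p D j : ℕ} (hp : 0 < p) :
    lineStart p D (lineOf p D j) + j / p % D * p = j := by
  rw [lineStart, lineOf_mod, lineOf_div hp, ← Nat.div_div_eq_div_mul]
  have h1 := Nat.div_add_mod j p
  have h2 := Nat.div_add_mod (j / p) D
  calc j / p / D * (p * D) + j % p + j / p % D * p
      = p * (D * (j / p / D) + j / p % D) + j % p := by ring
    _ = j := by rw [h2, h1]

theorem lineOf_lineStart_add {p D φ i : ℕ} (hp : 0 < p) (hi : i < D) :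
    lineOf p D (lineStart p D φ + i * p) = φ ∧ (lineStart p D φ + i * p) / p % D = i := by
  have hm := Nat.mod_lt φ hp
  have e : lineStart p D φ + i * p = p * (D * (φ / p) + i) + φ % p := by
    rw [lineStart]; ring
  have h1 : (lineStart p D φ + i * p) / p = D * (φ / p) + i := by
    rw [e, Nat.mul_add_div hp, Nat.div_eq_of_lt hm, add_zero]
  have h2 : (lineStart p D φ + i * p) % p = φ % p := by
    rw [e, Nat.mul_add_mod, Nat.mod_mod]
  refine ⟨?_, ?_⟩
  · rw [lineOf, ← Nat.div_div_eq_div_mul, h1, h2, Nat.mul_add_div (by omega), Nat.div_eq_of_lt hi,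
      add_zero, mul_comm, Nat.div_add_mod]
  · rw [h1, Nat.mul_add_mod, Nat.mod_eq_of_lt hi]

theorem lineStart_add_lt {p D φ i r : ℕ} (hp : 0 < p) (hi : i < D) (hφ : φ < r * p) :
    lineStart p D φ + i * p < r * (p * D) := by
  have h1 : φ / p < r := Nat.div_lt_of_lt_mul (by rwa [mul_comm])
  have hm := Nat.mod_lt φ hp
  calc lineStart p D φ + i * p < φ / p * (p * D) + p + i * p := by rw [lineStart]; omega
    _ = φ / p * (p * D) + (i + 1) * p := by ring
    _ ≤ φ / p * (p * D) + D * p := by gcongr; omega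
    _ = (φ / p + 1) * (p * D) := by ring
    _ ≤ _ := Nat.mul_le_mul_right _ h1

theorem lineOf_lt {p D j r : ℕ} (hp : 0 < p) (hj : j < r * (p * D)) : lineOf p D j < r * p := by
  have h1 : j / (p * D) < r := Nat.div_lt_of_lt_mul (by rwa [mul_comm])
  have hm := Nat.mod_lt j hp
  calc lineOf p D j < (j / (p * D) + 1) * p := by rw [lineOf, add_mul]; omega
    _ ≤ _ := Nat.mul_le_mul_right _ h1

/-- The program visits the lines in order and updates the first index by additions only: it advances
by one, and at the end of a block it jumps over the rest of the block. -/
theorem lineStart_succ {p D φ : ℕ} (hp : 0 < p) :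
    (φ % p + 1 < p → lineStart p D (φ + 1) = lineStart p D φ + 1 ∧ (φ + 1) % p = φ % p + 1) ∧
    (¬ φ % p + 1 < p → lineStart p D (φ + 1) + p = lineStart p D φ + 1 + p * D ∧
      (φ + 1) % p = 0) := by
  have hm := Nat.mod_lt φ hp
  have e := Nat.div_add_mod φ p
  constructor
  · intro h
    have h1 : (φ + 1) / p = φ / p := by
      rw [← e, add_assoc, Nat.mul_add_div hp, Nat.div_eq_of_lt h, e, add_zero]
    have h2 : (φ + 1) % p = φ % p + 1 := by
      conv_lhs => rw [← e, add_assoc, Nat.mul_add_mod, Nat.mod_eq_of_lt h]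
    exact ⟨by rw [lineStart, lineStart, h1, h2, add_assoc], h2⟩
  · intro h
    have h3 : φ % p + 1 = p := by omega
    have e' : φ + 1 = p * (φ / p + 1) := by
      rw [mul_add, mul_one]; omega
    have h1 : (φ + 1) / p = φ / p + 1 := by
      rw [e', Nat.mul_div_cancel_left _ hp]
    have h2 : (φ + 1) % p = 0 := by
      rw [e', Nat.mul_mod_right]
    refine ⟨?_, h2⟩
    rw [lineStart, lineStart, h1, h2, add_mul, one_mul]
    omega

end SSA

/-! ### Tensor indices, and the shift in one variable on the level of arrays -/

namespace TaylorShift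

open MvPolynomial SSA

theorem shift_zero {n : ℕ} (f : MvPolynomial (Fin n) ℤ) : shift 0 f = f := by
  simp [shift]

theorem coeffArray_natCast {n s d : ℕ} (f : Fin s → MvPolynomial (Fin n) ℤ) {j : ℕ}
    (hj : j / (d + 1) ^ n < s) :
    coeffArray d f j = coeff (exponent n d j) (f ⟨j / (d + 1) ^ n, hj⟩) := by
  rw [coeffArray, dif_pos ⟨Int.natCast_nonneg j, hj⟩]
  rfl

theorem div_pow_of_div_eq {D k l x y : ℕ} (h : x / (D ^ k * D) = y / (D ^ k * D)) (hkl : k < l) :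
    x / D ^ l = y / D ^ l := by
  obtain ⟨m, rfl⟩ := Nat.exists_eq_add_of_lt hkl
  have e : D ^ (k + m + 1) = D ^ k * D * D ^ m := by ring
  rw [e, ← Nat.div_div_eq_div_mul x, ← Nat.div_div_eq_div_mul y, h]

theorem digit_of_mod_eq {D k l x y : ℕ} (h : x % D ^ k = y % D ^ k) (hkl : l < k) :
    x / D ^ l % D = y / D ^ l % D := by
  obtain ⟨m, rfl⟩ := Nat.exists_eq_add_of_lt hkl
  have e : D ^ (l + m + 1) = D ^ l * D ^ (m + 1) := by ring
  have key : ∀ z, z / D ^ l % D = z % D ^ (l + m + 1) / D ^ l % D := by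
    intro z
    rw [e, Nat.mod_mul_right_div_self, Nat.mod_mod_of_dvd]
    exact dvd_pow_self D (by omega)
  rw [key x, key y, h]

/-- Coefficients after the shifts in the first `k` variables. -/
noncomputable def partialShift {n s : ℕ} (d : ℕ) (f : Fin s → MvPolynomial (Fin n) ℤ)
    (u : Fin n → ℤ) (k j : ℕ) : ℤ :=
  coeffArray d (fun i => shift (firstOf k u) (f i)) j

theorem partialShift_zero {n s : ℕ} (d : ℕ) (f : Fin s → MvPolynomial (Fin n) ℤ)
    (u : Fin n → ℤ) (j : ℕ) : partialShift d f u 0 j = coeffArray d f j := by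
  have : firstOf 0 u = 0 := by ext l; simp [firstOf]
  simp only [partialShift, this, shift_zero]

theorem partialShift_self {n s : ℕ} (d : ℕ) (f : Fin s → MvPolynomial (Fin n) ℤ)
    (u : Fin n → ℤ) (j : ℕ) :
    partialShift d f u n j = coeffArray d (fun i => shift u (f i)) j := by
  have : firstOf n u = u := by ext l; simp [firstOf]
  simp only [partialShift, this]

/-- The digits of an index in base `d + 1` are the exponents. The index `J` at position `i` of the
line through `j` agrees with `j` below and above digit `k`, and its digit `k` is `i`. Hence a line
lists exactly the coefficients that enter `coeff_shift_succ`. -/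
theorem partialShift_succ {n s d : ℕ} {f : Fin s → MvPolynomial (Fin n) ℤ} (u : Fin n → ℤ)
    (hf : ∀ j k, degreeOf k (f j) ≤ d) (k : Fin n) {j : ℕ} (hj : j < s * (d + 1) ^ n) :
    partialShift d f u (k + 1) j =
      axisShift ((d + 1) ^ (k : ℕ)) (d + 1) (u k) (partialShift d f u k) j := by
  have hp : 0 < (d + 1) ^ (k : ℕ) := by positivity
  have hjs : j / (d + 1) ^ n < s := Nat.div_lt_of_lt_mul (by rwa [mul_comm])
  rw [partialShift, coeffArray_natCast _ hjs, coeff_shift_succ u k (hf _ _), axisShift]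
  refine congrFun (taylor_congr fun i hi => ?_) _
  obtain ⟨J, hJ⟩ : ∃ J, J = lineStart ((d + 1) ^ (k : ℕ)) (d + 1) (lineOf ((d + 1) ^ (k : ℕ)) (d + 1) j) +
    i * (d + 1) ^ (k : ℕ) := ⟨_, rfl⟩
  obtain ⟨h1, h2⟩ := lineOf_lineStart_add (φ := lineOf ((d + 1) ^ (k : ℕ)) (d + 1) j) hp hi
  rw [← hJ] at h1 h2 ⊢
  have h3 : J % (d + 1) ^ (k : ℕ) = j % (d + 1) ^ (k : ℕ) := by
    rw [← lineOf_mod _ (d + 1) J, h1, lineOf_mod]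
  have h4 : J / ((d + 1) ^ (k : ℕ) * (d + 1)) = j / ((d + 1) ^ (k : ℕ) * (d + 1)) := by
    rw [← lineOf_div hp, h1, lineOf_div hp]
  have h5 : J / (d + 1) ^ n = j / (d + 1) ^ n := div_pow_of_div_eq h4 k.2
  have h6 : (exponent n d j).update k i = exponent n d J := by
    ext l
    rw [Finsupp.update_apply]
    simp only [exponent, Finsupp.equivFunOnFinite_symm_apply_apply]
    split_ifs with hl
    · rw [hl, h2]
    · rcases lt_or_gt_of_ne hl with h | h
      · exact (digit_of_mod_eq h3 h).symm
      · rw [div_pow_of_div_eq h4 h]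
  rw [partialShift, coeffArray_natCast _ (h5 ▸ hjs), h6]
  simp only [h5]

theorem abs_coeffArray_lt {n s d τ : ℕ} {f : Fin s → MvPolynomial (Fin n) ℤ}
    (hf : ∀ j, polyBitsize (f j) ≤ τ) (j : ℤ) : |coeffArray d f j| < 2 ^ τ := by
  rw [coeffArray]
  split_ifs with h
  · have hf := hf ⟨j.toNat / (d + 1) ^ n, h.2⟩
    by_cases hm : exponent n d j.toNat ∈ (f ⟨j.toNat / (d + 1) ^ n, h.2⟩).support
    · have h1 := Finset.le_sup (f := fun m =>
        (coeff m (f ⟨j.toNat / (d + 1) ^ n, h.2⟩)).natAbs.size + 1) hm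
      have h2 := (h1.trans (le_max_right 1 _)).trans hf
      have h3 := Nat.lt_size_self (coeff (exponent n d j.toNat) (f ⟨j.toNat / (d + 1) ^ n, h.2⟩)).natAbs
      have h4 := h3.trans_le (Nat.pow_le_pow_right (n := 2) (by omega) ((Nat.le_succ _).trans h2))
      rw [← Int.natCast_natAbs]
      exact_mod_cast h4
    · rw [notMem_support_iff.1 hm]
      simp
  · simp

theorem abs_shiftArray_lt {n σ : ℕ} {u : Fin n → ℤ} (hu : ∀ k, intBitsize (u k) ≤ σ) (j : ℤ) :
    |shiftArray u j| < 2 ^ σ := by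
  rw [shiftArray]
  split_ifs with h
  · have h1 := (le_max_right 1 _).trans (hu ⟨j.toNat, h.2⟩)
    have h4 := (Nat.lt_size_self (u ⟨j.toNat, h.2⟩).natAbs).trans_le
      (Nat.pow_le_pow_right (n := 2) (by omega) h1)
    rw [← Int.natCast_natAbs]
    exact_mod_cast h4
  · simp

theorem coeffArray_eq_zero {n s d : ℕ} (f : Fin s → MvPolynomial (Fin n) ℤ) {z : ℤ}
    (hz : ∀ j : ℕ, j < s * (d + 1) ^ n → z ≠ j) : coeffArray d f z = 0 := by
  rw [coeffArray, dif_neg]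
  rintro ⟨h1, h2⟩
  refine hz z.toNat ?_ (by omega)
  rwa [Nat.div_lt_iff_lt_mul (by positivity)] at h2

theorem shiftArray_natCast {n : ℕ} (u : Fin n → ℤ) (k : Fin n) : shiftArray u (k : ℕ) = u k := by
  simp [shiftArray]

end TaylorShift

/-! ### Shifts along lines of the coefficient tensors -/

namespace BitRAM

open SSA

/-- Conventions for the lines: registers `51`, `70`, `72` hold the length `D`, the stride `p` and `p
* D`; `71` is the variable, `75` the line `φ`, `73` its first index, `74` the remainder `φ % p`;
`76` holds `2 ^ κ`, the length after padding by zeros, and `77` is a moving address. -/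
def fillP : Prog := forLoop 43 76 (storeE 6 (.reg 43) (.const 0))

def gatherP : Prog :=
  .seq (block [(77, .reg 73)]) (forLoop 43 51 (.seq (storeE 6 (.reg 43) (.load 0 (.reg 77)))
    (block [(77, .add (.reg 77) (.reg 70))])))

def scatterP : Prog :=
  .seq (block [(77, .reg 73)]) (forLoop 43 51 (.seq (storeE 0 (.reg 77) (.load 6 (.reg 43)))
    (block [(77, .add (.reg 77) (.reg 70))])))

def advance : List (ℕ × Expr) :=
  [(73, .add (.reg 73) (.const 1)), (74, .add (.reg 74) (.const 1)),
    (73, .ite (.sub (.reg 70) (.reg 74)) (.reg 73) (.sub (.add (.reg 73) (.reg 72)) (.reg 70))),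
    (74, .ite (.sub (.reg 70) (.reg 74)) (.reg 74) (.const 0))]

/-- Shift along one line. -/
def fiberP : Prog :=
  .seq fillP (.seq gatherP (.seq shiftP (.seq scatterP (block advance))))

theorem line_cost_le {N M t b K : ℕ} (hN : N ≤ M) (hM : 1 ≤ M) (ht : t ≤ K * b)
    (hb : len (N : ℤ) ≤ b) : (N + 1) * (t + 40 * len (N : ℤ)) ≤ 2 * (K + 40) * (M * b) := by
  calc _ ≤ (2 * M) * (K * b + 40 * b) := by gcongr; omega
    _ = _ := by ring

theorem tri_fillP {S : State} {N b : ℕ} (h76 : S.reg 76 = N) (hN : 1 ≤ N) (hb : len (N : ℤ) ≤ b) :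
    Tri fillP S (100 * (N * b)) (fun S' => Holds S' 6 N fun _ => 0) := by
  have hb1 : 1 ≤ b := (one_le_len _).trans hb
  refine (Tri.forLoop h76 (t := 10 * b) (fun j S' => Holds S' 6 j fun _ => 0)
    (by simp [Holds]) ?_).mono (line_cost_le le_rfl hN le_rfl hb) fun _ h => h.1
  intro j hj S' hij k hI
  have hjb : len (j : ℤ) ≤ b := (len_natCast_mono hj.le).trans hb
  refine Tri.storeE (b := b) hb1 (by simpa [Expr.Leaf, hij] using hjb) trivial
    (Nat.mul_le_mul_right _ (by decide)) ?_
  intro m hm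
  simp only [Expr.eval, hij, State.setReg_arr, State.setCell_arr, if_true]
  rcases Nat.lt_succ_iff_lt_or_eq.1 hm with h | rfl
  · rw [Function.update_of_ne (by exact_mod_cast h.ne)]
    exact hI m h
  · simp

theorem tri_gatherP {S : State} {D p st M b : ℕ} {X : ℕ → ℤ} (h51 : S.reg 51 = D)
    (h70 : S.reg 70 = p) (h73 : S.reg 73 = st) (hD : D ≤ M) (hM : 1 ≤ M)
    (hDb : len (D : ℤ) ≤ b) (hpb : len (p : ℤ) ≤ b) (hsb : len ((st + D * p : ℕ) : ℤ) ≤ b)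
    (hX : ∀ i < D, S.arr 0 (st + i * p : ℕ) = X i) (hXb : ∀ i < D, len (X i) ≤ b)
    (h6 : Holds S 6 M fun _ => 0) :
    Tri gatherP S (500 * (M * b))
      (fun S' => Holds S' 6 M fun i => if i < D then X i else 0) := by
  have hb1 : 1 ≤ b := (one_le_len _).trans hDb
  have hMb : b ≤ M * b := Nat.le_mul_of_pos_left _ hM
  have hadr : ∀ i ≤ D, len ((st + i * p : ℕ) : ℤ) ≤ b := fun i hi =>
    (len_natCast_mono (Nat.add_le_add_left (Nat.mul_le_mul_right p hi) _)).trans hsb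
  refine Tri.le (t := 10 * b + 2 * (100 + 40) * (M * b)) (Tri.seq (Q₁ := fun S' => S' =
    S.setReg 77 st) (Tri.le (Tri.block_cons (b := b) (.reg h73 (by simpa using hadr 0 (by omega))) hb1
      (Tri.block_nil hb1 rfl)) (Nat.mul_le_mul_right _ (by decide))) ?_) (by omega)
  rintro S₁ - rfl
  refine (Tri.forLoop (N := D) (by simpa using h51) (t := 30 * b + 70 * b) (fun j S' =>
    S'.reg 77 = (st + j * p : ℕ) ∧ Holds S' 6 M fun i => if i < j then X i else 0)
    ⟨by simp, by simpa [Holds] using h6⟩ ?_).mono (line_cost_le hD hM (by omega) hDb)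
    fun _ h => h.1.2
  rintro j hj S' hij k ⟨h77, hI⟩
  have hjb : len (j : ℤ) ≤ b := (len_natCast_mono hj.le).trans hDb
  have hc : S'.arr 0 (st + j * p : ℕ) = X j := by
    rw [k.arr 0 (by simp)]
    exact hX j hj
  have g70 : S'.reg 70 = p := (k.reg 70 (by decide) rfl).trans (by simpa using h70)
  refine Tri.seq (Q₁ := fun S'' => S''.reg = S'.reg ∧
    Holds S'' 6 M fun i => if i < j + 1 then X i else 0) ?_ ?_
  · refine Tri.storeE (b := b) hb1 (by simpa [Expr.Leaf, hij] using hjb) ?_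
      (Nat.mul_le_mul_right _ (by decide)) ⟨rfl, ?_⟩
    · exact (Expr.Val.load (.reg h77 (hadr j hj.le)) hc (hXb j hj)).leaf
    · intro m hm
      simp only [Expr.eval, hij, h77, hc, State.setCell_arr, if_true]
      have hIm := hI m hm
      dsimp only at hIm
      rcases lt_trichotomy m j with h | rfl | h
      · rw [Function.update_of_ne (by exact_mod_cast h.ne), hIm, if_pos h, if_pos (by omega)]
      · simp
      · rw [Function.update_of_ne (by exact_mod_cast h.ne'), hIm, if_neg (by omega),
          if_neg (by omega)]
  · rintro S'' k' ⟨e, hI'⟩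
    refine Tri.le ?_ (Nat.mul_le_mul_right _ (by decide : blockWeight
      [(77, .add (.reg 77) (.reg 70))] ≤ 70))
    refine Tri.block_cons (.addN (n := p) (.reg (e ▸ h77) (hadr j hj.le)) (.reg (e ▸ g70) hpb)) hb1
      (Tri.block_nil hb1 ⟨?_, hI'⟩)
    simp only [State.setReg_reg]
    ring_nf
    rfl

theorem tri_scatterP {S : State} {D p st M b : ℕ} {X : ℕ → ℤ} (h51 : S.reg 51 = D)
    (h70 : S.reg 70 = p) (h73 : S.reg 73 = st) (hD : D ≤ M) (hM : 1 ≤ M) (hp : 0 < p)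
    (hDb : len (D : ℤ) ≤ b) (hpb : len (p : ℤ) ≤ b) (hsb : len ((st + D * p : ℕ) : ℤ) ≤ b)
    (hX : Holds S 6 D X) (hXb : ∀ i < D, len (X i) ≤ b) :
    Tri scatterP S (500 * (M * b)) (fun S' => (∀ i < D, S'.arr 0 (st + i * p : ℕ) = X i) ∧
      ∀ z : ℤ, (∀ i < D, z ≠ (st + i * p : ℕ)) → S'.arr 0 z = S.arr 0 z) := by
  have hb1 : 1 ≤ b := (one_le_len _).trans hDb
  have hMb : b ≤ M * b := Nat.le_mul_of_pos_left _ hM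
  have hadr : ∀ i ≤ D, len ((st + i * p : ℕ) : ℤ) ≤ b := fun i hi =>
    (len_natCast_mono (Nat.add_le_add_left (Nat.mul_le_mul_right p hi) _)).trans hsb
  refine Tri.le (t := 10 * b + 2 * (100 + 40) * (M * b)) (Tri.seq (Q₁ := fun S' => S' =
    S.setReg 77 st) (Tri.le (Tri.block_cons (b := b) (.reg h73 (by simpa using hadr 0 (by omega))) hb1
      (Tri.block_nil hb1 rfl)) (Nat.mul_le_mul_right _ (by decide))) ?_) (by omega)
  rintro S₁ - rfl
  refine (Tri.forLoop (N := D) (by simpa using h51) (t := 30 * b + 70 * b) (fun j S' =>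
    S'.reg 77 = (st + j * p : ℕ) ∧ (∀ i < j, S'.arr 0 (st + i * p : ℕ) = X i) ∧
      ∀ z : ℤ, (∀ i < j, z ≠ (st + i * p : ℕ)) → S'.arr 0 z = S.arr 0 z)
    ⟨by simp, by simp, by simp⟩ ?_).mono (line_cost_le hD hM (by omega) hDb) fun _ h => h.1.2
  rintro j hj S' hij k ⟨h77, hI, hI2⟩
  have hjb : len (j : ℤ) ≤ b := (len_natCast_mono hj.le).trans hDb
  have hc : S'.arr 6 j = X j := by
    rw [k.arr 6 (by simp)]
    exact hX j hj
  have g70 : S'.reg 70 = p := (k.reg 70 (by decide) rfl).trans (by simpa using h70)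
  refine Tri.seq (Q₁ := fun S'' => S''.reg = S'.reg ∧
    (∀ i < j + 1, S''.arr 0 (st + i * p : ℕ) = X i) ∧
      ∀ z : ℤ, (∀ i < j + 1, z ≠ (st + i * p : ℕ)) → S''.arr 0 z = S.arr 0 z) ?_ ?_
  · refine Tri.storeE (b := b) hb1 (by simpa only [Expr.Leaf, h77] using hadr j hj.le) ?_
      (Nat.mul_le_mul_right _ (by decide)) ⟨rfl, ?_, ?_⟩
    · exact (Expr.Val.load (.reg hij hjb) hc (hXb j hj)).leaf
    · intro m hm
      simp only [Expr.eval, hij, h77, hc, State.setCell_arr, if_true]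
      rcases Nat.lt_succ_iff_lt_or_eq.1 hm with h | rfl
      · rw [Function.update_of_ne, hI m h]
        have : m * p < j * p := Nat.mul_lt_mul_of_pos_right h hp
        omega
      · simp
    · intro z hz
      simp only [Expr.eval, hij, h77, State.setCell_arr, if_true]
      rw [Function.update_of_ne (hz j (by omega)), hI2 z fun i hi => hz i (by omega)]
  · rintro S'' k' ⟨e, hI', hI2'⟩
    refine Tri.le ?_ (Nat.mul_le_mul_right _ (by decide : blockWeight
      [(77, .add (.reg 77) (.reg 70))] ≤ 70))
    refine Tri.block_cons (.addN (n := p) (.reg (e ▸ h77) (hadr j hj.le)) (.reg (e ▸ g70) hpb)) hb1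
      (Tri.block_nil hb1 ⟨?_, hI', hI2'⟩)
    simp only [State.setReg_reg]
    ring_nf
    rfl

theorem tri_advance {S : State} {p q st o b : ℕ} (h70 : S.reg 70 = p) (h72 : S.reg 72 = q)
    (h73 : S.reg 73 = st) (h74 : S.reg 74 = o) (hb1 : 2 ≤ b) (hp : len (p : ℤ) ≤ b) (hq : len (q : ℤ) ≤ b)
    (hst : len ((st + 1 : ℕ) : ℤ) ≤ b) (ho : len ((o + 1 : ℕ) : ℤ) ≤ b) :
    Tri (block advance) S (200 * b) (fun S' =>
      S'.reg 73 = (if o + 1 < p then ((st + 1 : ℕ) : ℤ) else (st + 1 : ℕ) + q - p) ∧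
      S'.reg 74 = if o + 1 < p then ((o + 1 : ℕ) : ℤ) else 0) := by
  have hb1 : 1 ≤ b := by omega
  have e : ∀ v w : ℤ, (if 0 < (p : ℤ) - ((o + 1 : ℕ) : ℤ) then v else w) = if o + 1 < p then v else w := by
    intro v w
    congr 1
    simp only [sub_pos, Nat.cast_lt]
  refine Tri.le ?_ (Nat.mul_le_mul_right _ (by decide : blockWeight advance ≤ 200))
  refine Tri.block_cons (.addN (.reg h73 ((len_natCast_mono (Nat.le_succ _)).trans hst)) .one) hb1 ?_
  refine Tri.block_cons (.addN (.reg h74 ((len_natCast_mono (Nat.le_succ _)).trans ho)) .one) hb1 ?_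
  refine Tri.block_cons (.cast (.ite (u := (p : ℤ) - ((o + 1 : ℕ) : ℤ)) (v := ((st + 1 : ℕ) : ℤ))
    (w := ((st + 1 : ℕ) : ℤ) + q - p)
    (.sub (.reg h70 hp) (.reg rfl ho)) (fun _ => .reg rfl hst)
    fun _ => .sub (.add (.reg rfl hst) (.reg h72 hq)) (.reg h70 hp)) (e _ _)) hb1 ?_
  refine Tri.block_cons (.cast (.ite (u := (p : ℤ) - ((o + 1 : ℕ) : ℤ)) (v := ((o + 1 : ℕ) : ℤ))
    (w := 0) (.sub (.reg h70 hp) (.reg rfl ho)) (fun _ => .reg rfl ho) fun _ => .const 0)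
    (e _ _)) hb1 ?_
  exact Tri.block_nil hb1 ⟨rfl, rfl⟩

theorem tri_fiberP : ∃ K, ∀ (S : State) (κ ω D p st o b : ℕ) (u : ℤ) (X : ℕ → ℤ), 1 ≤ ω →
    S.reg 40 = κ → S.reg 41 = ω → S.reg 42 = u → S.reg 51 = D → S.reg 76 = (2 ^ κ : ℕ) →
    S.reg 70 = p → S.reg 72 = (p * D : ℕ) → S.reg 73 = st → S.reg 74 = o →
    D ≤ 2 ^ κ → 0 < p → 0 < D → o < p →
    2 ^ ω + 2 ≤ b → len ((2 ^ κ : ℕ) : ℤ) ≤ b → len ((st + D * p : ℕ) : ℤ) ≤ b →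
    |u| ≤ 2 ^ 2 ^ ω → (∀ i < D, S.arr 0 (st + i * p : ℕ) = X i) → (∀ i < D, |X i| ≤ 2 ^ 2 ^ ω) →
    (∀ i, |taylor D u X i| < 2 ^ (2 ^ ω - 1)) →
    Tri fiberP S (K * (2 ^ κ * b + 2 ^ (κ + ω + 2) * (κ + ω + 3) ^ 6)) (fun S' =>
      (∀ i < D, S'.arr 0 (st + i * p : ℕ) = taylor D u X i) ∧
      (∀ z : ℤ, (∀ i < D, z ≠ (st + i * p : ℕ)) → S'.arr 0 z = S.arr 0 z) ∧
      S'.reg 73 = (if o + 1 < p then ((st + 1 : ℕ) : ℤ) else (st + 1 : ℕ) + (p * D : ℕ) - p) ∧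
      S'.reg 74 = if o + 1 < p then ((o + 1 : ℕ) : ℤ) else 0) := by
  obtain ⟨K, hshift⟩ := tri_shiftP
  refine ⟨100 + (500 + (K + (500 + 200))), ?_⟩
  intro S κ ω D p st o b u X hω h40 h41 h42 h51 h76 h70 h72 h73 h74 hD hp hD0 ho hb hMb hst hu hX hXb hT
  obtain ⟨M, hM⟩ : ∃ M, M = 2 ^ κ := ⟨_, rfl⟩
  have hM1 : 1 ≤ M := hM ▸ Nat.one_le_two_pow
  rw [← hM] at hD hMb h76
  obtain ⟨E, hE⟩ : ∃ E, E = 2 ^ (κ + ω + 2) * (κ + ω + 3) ^ 6 := ⟨_, rfl⟩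
  have hDb : len (D : ℤ) ≤ b := (len_natCast_mono hD).trans hMb
  have hDp : 1 * p ≤ D * p := Nat.mul_le_mul_right _ hD0
  have hpb : len (p : ℤ) ≤ b := (len_natCast_mono (by omega)).trans hst
  have hqb : len ((p * D : ℕ) : ℤ) ≤ b := (len_natCast_mono (by rw [mul_comm]; omega)).trans hst
  have hXl : ∀ i < D, len (X i) ≤ b := fun i hi => (len_le_of_abs_le (hXb i hi)).trans hb
  have hTl : ∀ i < D, len (taylor D u X i) ≤ b := fun i hi =>
    (len_le_of_abs_lt (hT i)).trans (by have := Nat.two_pow_pos ω; omega)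
  have hMb1 : b ≤ M * b := Nat.le_mul_of_pos_left _ hM1
  have hpad : ∀ j < 2 ^ κ, |(fun i => if i < D then X i else 0) j| ≤ 2 ^ 2 ^ ω := by
    intro j _
    dsimp only
    split_ifs with h
    · exact hXb j h
    · simp
  have ht : taylor (2 ^ κ) u (fun i => if i < D then X i else 0) = taylor D u X :=
    taylor_pad (hM ▸ hD) u X
  rw [← hM, ← hE]
  refine Tri.le (t := 100 * (M * b) + (500 * (M * b) + (K * E + (500 * (M * b) + 200 * b)))) ?_ ?_
  · refine Tri.seq (tri_fillP h76 hM1 hMb) fun S₁ k₁ hz => ?_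
    have e0 : S₁.arr 0 = S.arr 0 := k₁.arr 0 (by simp [fillP])
    refine Tri.seq (tri_gatherP ((k₁.reg 51 (by decide) rfl).trans h51)
      ((k₁.reg 70 (by decide) rfl).trans h70) ((k₁.reg 73 (by decide) rfl).trans h73) hD hM1 hDb hpb hst
      (fun i hi => by rw [e0]; exact hX i hi) hXl hz) fun S₂ k₂ h6 => ?_
    rw [hM] at h6
    have hgo := hshift S₂ κ ω u _ hω ((k₂.reg 40 (by decide) rfl).trans ((k₁.reg 40 (by decide) rfl).trans h40))
      ((k₂.reg 41 (by decide) rfl).trans ((k₁.reg 41 (by decide) rfl).trans h41))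
      ((k₂.reg 42 (by decide) rfl).trans ((k₁.reg 42 (by decide) rfl).trans h42)) hu hpad
      (by rw [ht]; exact fun j _ => hT j) h6
    rw [ht, ← hE, ← hM] at hgo
    refine Tri.seq hgo fun S₃ k₃ h6 => ?_
    have e3 : S₃.arr 0 = S.arr 0 := (k₃.arr 0 (by simp)).trans
      ((k₂.arr 0 (by simp [gatherP])).trans e0)
    have g : ∀ r < 100, fillP.writes r = false → gatherP.writes r = false → shiftP.writes r = false →
      S₃.reg r = S.reg r := fun r hr h1 h2 h3 =>
      (k₃.reg r hr h3).trans ((k₂.reg r hr h2).trans (k₁.reg r hr h1))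
    have g70 := (g 70 (by decide) rfl rfl rfl).trans h70
    have g72 := (g 72 (by decide) rfl rfl rfl).trans h72
    have g73 := (g 73 (by decide) rfl rfl rfl).trans h73
    have g74 := (g 74 (by decide) rfl rfl rfl).trans h74
    refine Tri.seq (tri_scatterP ((g 51 (by decide) rfl rfl rfl).trans h51) g70 g73 hD hM1 hp hDb hpb hst
      (fun j hj => h6 j (hj.trans_le hD)) hTl) ?_
    rintro S₄ k₄ ⟨r1, r2⟩
    refine (tri_advance ((k₄.reg 70 (by decide) rfl).trans g70) ((k₄.reg 72 (by decide) rfl).trans g72)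
      ((k₄.reg 73 (by decide) rfl).trans g73) ((k₄.reg 74 (by decide) rfl).trans g74) ((Nat.le_add_left 2 _).trans hb) hpb hqb
      ((len_natCast_mono (by omega)).trans hst) ((len_natCast_mono (by omega)).trans hpb)).post le_rfl ?_
    rintro S₅ k₅ ⟨r3, r4⟩
    have e5 := k₅.arr 0 (by simp)
    exact ⟨fun i hi => by rw [e5]; exact r1 i hi, fun z hz => by rw [e5, r2 z hz, e3], r3, r4⟩
  · have h1 : 0 ≤ K * (M * b) := Nat.zero_le _
    have h2 : 0 ≤ E := Nat.zero_le _
    nlinarith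

end BitRAM

/-! ### Sizes of the intermediate coefficients -/

namespace TaylorShift

open MvPolynomial SSA

theorem abs_taylor_line_le {n s d T g : ℕ} {f : Fin s → MvPolynomial (Fin n) ℤ} {u : Fin n → ℤ}
    (hu : ∀ k, |u k| < 2 ^ g) (k : Fin n)
    (hk : ∀ j < s * (d + 1) ^ n, |partialShift d f u k j| ≤ 2 ^ (T + k * ((d + 1) * (g + 1))))
    {φ : ℕ} (hφ : φ < s * (d + 1) ^ (n - 1)) (i : ℕ) :
    |taylor (d + 1) (u k) (fun i => partialShift d f u k
      (lineStart ((d + 1) ^ (k : ℕ)) (d + 1) φ + i * (d + 1) ^ (k : ℕ))) i| ≤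
      2 ^ (T + (k + 1) * ((d + 1) * (g + 1))) := by
  have hkn := k.2
  have e1 : s * (d + 1) ^ (n - 1) = s * (d + 1) ^ (n - 1 - k) * (d + 1) ^ (k : ℕ) := by
    rw [mul_assoc, ← pow_add]; congr 2; omega
  have e2 : s * (d + 1) ^ n = s * (d + 1) ^ (n - 1 - k) * ((d + 1) ^ (k : ℕ) * (d + 1)) := by
    rw [mul_assoc, ← pow_succ, ← pow_add]; congr 2; omega
  refine (abs_taylor_le (fun j hj => hk _ ?_) (by positivity) (hu k) i).trans_eq ?_
  · rw [e2]
    exact lineStart_add_lt (by positivity) hj (e1 ▸ hφ)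
  · rw [← pow_add]
    congr 1
    ring

/-- Each variable adds `(d + 1) * (g + 1)` to the exponent, whatever has been done before; so the
bound is linear in `k`. -/
theorem abs_partialShift_le {n s d T g : ℕ} {f : Fin s → MvPolynomial (Fin n) ℤ} {u : Fin n → ℤ}
    (hf : ∀ j k, degreeOf k (f j) ≤ d) (hu : ∀ k, |u k| < 2 ^ g)
    (hT : ∀ j < s * (d + 1) ^ n, |coeffArray d f (j : ℕ)| ≤ 2 ^ T) {k : ℕ} (hk : k ≤ n) :
    ∀ j < s * (d + 1) ^ n, |partialShift d f u k j| ≤ 2 ^ (T + k * ((d + 1) * (g + 1))) := by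
  induction k with
  | zero => simpa [partialShift_zero] using hT
  | succ k ih =>
    intro j hj
    have e1 : s * (d + 1) ^ (n - 1) = s * (d + 1) ^ (n - 1 - k) * (d + 1) ^ k := by
      rw [mul_assoc, ← pow_add]; congr 2; omega
    have e2 : s * (d + 1) ^ n = s * (d + 1) ^ (n - 1 - k) * ((d + 1) ^ k * (d + 1)) := by
      rw [mul_assoc, ← pow_succ, ← pow_add]; congr 2; omega
    have h := partialShift_succ u hf ⟨k, hk⟩ hj
    rw [h]
    refine abs_taylor_line_le hu ⟨k, hk⟩ (ih (by omega)) ?_ _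
    rw [e1]
    exact lineOf_lt (by positivity) (e2 ▸ hj)

end TaylorShift

/-! ### Shifts along all lines and in all variables -/

namespace BitRAM

open SSA

def linesP : Prog := .seq (block [(73, .const 0), (74, .const 0)]) (forLoop 75 57 fiberP)

/-- Shift in one variable. -/
def axisP : Prog :=
  .seq (block [(42, .load 1 (.reg 71))]) (.seq (timesP 72 51 70) (.seq linesP (block [(70, .reg 72)])))

def allAxesP : Prog :=
  .seq (block [(76, .shl (.const 1) (.reg 40)), (70, .const 1)]) (forLoop 71 1 axisP)

@[simp] theorem arrWrites_fiberP (x : ℕ) : fiberP.arrWrites x =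
    (x == 0 || x == 2 || x == 3 || x == 4 || x == 5 || x == 6 || x == 7) := by
  simp only [fiberP, fillP, gatherP, scatterP, arrWrites_seq, arrWrites_block,
    arrWrites_forLoop, arrWrites_storeE, arrWrites_shiftP]
  cases x == 0 <;> cases x == 2 <;> cases x == 3 <;> cases x == 4 <;> cases x == 5 <;>
    cases x == 6 <;> cases x == 7 <;> rfl

@[simp] theorem arrWrites_timesP (r c x a : ℕ) : (timesP r c x).arrWrites a = false := by
  simp [timesP]

/-- Each index lies on exactly one line, so the work on a line leaves the others alone. The
invariant says that the lines before `φ` are shifted and that the others still hold `Y`. -/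
theorem tri_linesP : ∃ K, ∀ (S : State) (κ ω D p r b : ℕ) (u : ℤ) (Y : ℕ → ℤ), 1 ≤ ω →
    S.reg 40 = κ → S.reg 41 = ω → S.reg 42 = u → S.reg 51 = D → S.reg 76 = (2 ^ κ : ℕ) →
    S.reg 70 = p → S.reg 72 = (p * D : ℕ) → S.reg 57 = (r * p : ℕ) →
    D ≤ 2 ^ κ → 0 < p → 0 < D →
    2 ^ ω + 2 ≤ b → len ((2 ^ κ : ℕ) : ℤ) ≤ b → len ((2 * (r * (p * D)) : ℕ) : ℤ) ≤ b →
    |u| ≤ 2 ^ 2 ^ ω → Holds S 0 (r * (p * D)) Y → (∀ j < r * (p * D), |Y j| ≤ 2 ^ 2 ^ ω) →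
    (∀ φ < r * p, ∀ i, |taylor D u (fun i => Y (lineStart p D φ + i * p)) i| < 2 ^ (2 ^ ω - 1)) →
    Tri linesP S (K * ((r * p + 1) * (2 ^ κ * b + 2 ^ (κ + ω + 2) * (κ + ω + 3) ^ 6))) (fun S' =>
      Holds S' 0 (r * (p * D)) (axisShift p D u Y) ∧
      ∀ z : ℤ, (∀ j : ℕ, j < r * (p * D) → z ≠ j) → S'.arr 0 z = S.arr 0 z) := by
  obtain ⟨K, hfib⟩ := tri_fiberP
  refine ⟨100 + (K + 40), ?_⟩
  intro S κ ω D p r b u Y hω h40 h41 h42 h51 h76 h70 h72 h57 hD hp hD0 hb hMb hrb hu hY hYb hT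
  obtain ⟨U, hU⟩ : ∃ U, U = 2 ^ κ * b + 2 ^ (κ + ω + 2) * (κ + ω + 3) ^ 6 := ⟨_, rfl⟩
  have hbU : b ≤ U := by
    rw [hU]
    exact (Nat.le_mul_of_pos_left _ (Nat.two_pow_pos κ)).trans (Nat.le_add_right _ _)
  have hb1 : 1 ≤ b := (Nat.le_add_left 1 (2 ^ ω + 1)).trans hb
  have hFb : len ((r * p : ℕ) : ℤ) ≤ b := by
    refine (len_natCast_mono ?_).trans hrb
    calc r * p = r * (p * 1) := by rw [mul_one]
      _ ≤ r * (p * D) := Nat.mul_le_mul_left _ (Nat.mul_le_mul_left _ hD0)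
      _ ≤ _ := Nat.le_mul_of_pos_left _ (by norm_num)
  rw [← hU]
  refine Tri.le (t := 100 * b + (r * p + 1) * (K * U + 40 * len ((r * p : ℕ) : ℤ))) (Tri.seq
    (Q₁ := fun S' => S'.reg 73 = 0 ∧ S'.reg 74 = 0) (Tri.le (Tri.block_cons (b := b) (.const 0) hb1
      (Tri.block_cons (.const 0) hb1 (Tri.block_nil hb1 ⟨rfl, rfl⟩)))
      (Nat.mul_le_mul_right _ (by decide))) ?_) ?_
  swap
  · have h1 : (r * p + 1) * (K * U + 40 * len ((r * p : ℕ) : ℤ)) ≤ (r * p + 1) * (K * U + 40 * U) := by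
      gcongr
      omega
    have h2 : 1 * U ≤ (r * p + 1) * U := Nat.mul_le_mul_right _ (by omega)
    calc _ ≤ 100 * ((r * p + 1) * U) + (r * p + 1) * (K * U + 40 * U) := by omega
      _ = _ := by ring
  rintro S₁ k₁ ⟨h73, h74⟩
  have e₁ : S₁.arr 0 = S.arr 0 := k₁.arr 0 (by simp)
  refine (Tri.forLoop ((k₁.reg 57 (by decide) rfl).trans h57) (t := K * U) (fun φ S' =>
    S'.reg 73 = (lineStart p D φ : ℕ) ∧ S'.reg 74 = (φ % p : ℕ) ∧
    (∀ j < r * (p * D), S'.arr 0 (j : ℤ) = if lineOf p D j < φ then axisShift p D u Y j else Y j) ∧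
    ∀ z : ℤ, (∀ j : ℕ, j < r * (p * D) → z ≠ j) → S'.arr 0 z = S.arr 0 z) ⟨?_, ?_, ?_, ?_⟩ ?_).mono
    le_rfl ?_
  · simpa [lineStart] using h73
  · simpa using h74
  · intro j hj
    simp only [State.setReg_arr, e₁, Nat.not_lt_zero, if_false]
    exact hY j hj
  · intro z _
    simp only [State.setReg_arr, e₁]
  · rintro φ hφ S' hij k ⟨i73, i74, iY, iz⟩
    have g : ∀ r < 100, r ≠ 73 → r ≠ 74 → linesP.writes r = false → S'.reg r = S.reg r := by
      intro r hr n1 n2 hw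
      have hw2 : (block [(73, Expr.const 0), (74, Expr.const 0)]).writes r = false ∧
          (forLoop 75 57 fiberP).writes r = false := by simpa [linesP, Prog.writes] using hw
      exact (k.reg r hr hw2.2).trans (k₁.reg r hr hw2.1)
    -- After its last entry the address has moved one stride beyond the line. It may leave the
    -- tensors, but it stays within twice their size.
    have hsm : lineStart p D φ + D * p ≤ 2 * (r * (p * D)) := by
      have h1 : φ / p < r := Nat.div_lt_of_lt_mul (by rwa [mul_comm])
      have hm := Nat.mod_lt φ hp
      have h2 : (φ / p + 1) * (p * D) ≤ r * (p * D) := Nat.mul_le_mul_right _ h1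
      have h3 : 1 * (p * D) ≤ r * (p * D) := Nat.mul_le_mul_right _ ((Nat.zero_le _).trans_lt h1)
      have h4 : p * 1 ≤ p * D := Nat.mul_le_mul_left _ hD0
      have h5 : lineStart p D φ + D * p = (φ / p + 1) * (p * D) + φ % p := by rw [lineStart]; ring
      omega
    have hin : ∀ i < D, lineStart p D φ + i * p < r * (p * D) := fun i hi =>
      lineStart_add_lt hp hi hφ
    refine ((hfib S' κ ω D p (lineStart p D φ) (φ % p) b u (fun i => Y (lineStart p D φ + i * p)) hω
      ((g 40 (by decide) (by decide) (by decide) rfl).trans h40)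
      ((g 41 (by decide) (by decide) (by decide) rfl).trans h41)
      ((g 42 (by decide) (by decide) (by decide) rfl).trans h42)
      ((g 51 (by decide) (by decide) (by decide) rfl).trans h51)
      ((g 76 (by decide) (by decide) (by decide) rfl).trans h76)
      ((g 70 (by decide) (by decide) (by decide) rfl).trans h70)
      ((g 72 (by decide) (by decide) (by decide) rfl).trans h72) i73 i74 hD hp hD0 (Nat.mod_lt _ hp) hb hMb
      ((len_natCast_mono hsm).trans hrb) hu ?_ (fun i hi => hYb _ (hin i hi)) (hT φ hφ)).mono
      (Nat.mul_le_mul_left _ hU.ge) ?_)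
    · intro i hi
      rw [iY _ (hin i hi), (lineOf_lineStart_add hp hi).1, if_neg (lt_irrefl _)]
    · rintro S'' ⟨r1, r2, r3, r4⟩
      obtain ⟨q1, q2⟩ := lineStart_succ (D := D) (φ := φ) hp
      refine ⟨?_, ?_, ?_, ?_⟩
      · simp only [State.setReg_reg]
        rw [if_neg (by decide), r3]
        split_ifs with h
        · rw [(q1 h).1]
        · have := (q2 h).1
          zify at this
          push_cast
          linarith
      · simp only [State.setReg_reg]
        rw [if_neg (by decide), r4]
        split_ifs with h
        · rw [(q1 h).2]
        · rw [(q2 h).2]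
          rfl
      · intro j hj
        simp only [State.setReg_arr]
        by_cases h : lineOf p D j = φ
        · have hj' := lineStart_lineOf (D := D) (j := j) hp
          have hmod : j / p % D < D := Nat.mod_lt _ hD0
          rw [if_pos (by omega)]
          have := r1 (j / p % D) hmod
          rw [h] at hj'
          rw [hj'] at this
          rw [this, axisShift, h]
        · rw [r2 j ?_, iY j hj]
          · congr 1
            exact propext ⟨fun h => by omega, fun h => by omega⟩
          · intro i hi hji
            have hji : j = lineStart p D φ + i * p := by exact_mod_cast hji
            rw [hji] at h
            exact h (lineOf_lineStart_add hp hi).1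
      · intro z hz
        simp only [State.setReg_arr]
        rw [r2 z fun i hi => hz _ (hin i hi), iz z hz]
  · rintro S' ⟨⟨-, -, h1, h2⟩, -⟩
    refine ⟨fun j hj => ?_, h2⟩
    rw [h1 j hj, if_pos (lineOf_lt hp hj)]

-- The hypothesis on `2 ^ ω` has two bits to spare, so that after each variable the coefficients are
-- strictly below `2 ^ (2 ^ ω - 1)`, as the extraction of digits requires.
open TaylorShift in
theorem tri_allAxesP : ∃ K, ∀ (S : State) (n s d κ ω b T g : ℕ) (f : Fin s → MvPolynomial (Fin n) ℤ)
    (u : Fin n → ℤ), 1 ≤ ω → 1 ≤ n → S.reg 1 = n →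
    S.reg 40 = κ → S.reg 41 = ω → S.reg 51 = (d + 1 : ℕ) → S.reg 57 = (s * (d + 1) ^ (n - 1) : ℕ) →
    d + 1 ≤ 2 ^ κ → 2 ^ ω + 2 ≤ b → len ((2 ^ κ : ℕ) : ℤ) ≤ b → κ ≤ b → n + 1 ≤ b →
    len ((2 * (s * (d + 1) ^ n) : ℕ) : ℤ) ≤ b → len (((d + 1) ^ n : ℕ) : ℤ) ≤ b →
    T + n * ((d + 1) * (g + 1)) + 2 ≤ 2 ^ ω → S.arr 0 = coeffArray d f → S.arr 1 = shiftArray u →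
    (∀ j k, MvPolynomial.degreeOf k (f j) ≤ d) → (∀ k, |u k| < 2 ^ g) →
    (∀ j < s * (d + 1) ^ n, |coeffArray d f (j : ℕ)| ≤ 2 ^ T) →
    Tri allAxesP S (K * ((n + 1) * ((s * (d + 1) ^ (n - 1) + 1) *
      (2 ^ κ * b + 2 ^ (κ + ω + 2) * (κ + ω + 3) ^ 6)))) (fun S' =>
      S'.arr 0 = coeffArray d fun j => shift u (f j)) := by
  obtain ⟨K, hlines⟩ := tri_linesP
  refine ⟨200 + (600 + K), ?_⟩
  intro S n s d κ ω b T g f u hω hn h1 h40 h41 h51 h57 hκ hb hMb hκb hnb hsb hDb hW a0 a1 hf hu hT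
  obtain ⟨U, hU⟩ : ∃ U, U = 2 ^ κ * b + 2 ^ (κ + ω + 2) * (κ + ω + 3) ^ 6 := ⟨_, rfl⟩
  obtain ⟨F, hF⟩ : ∃ F, F = s * (d + 1) ^ (n - 1) := ⟨_, rfl⟩
  obtain ⟨M, hM⟩ : ∃ M, M = s * (d + 1) ^ n := ⟨_, rfl⟩
  have hb1 : 1 ≤ b := (Nat.le_add_left 1 (2 ^ ω + 1)).trans hb
  have hκU : 2 ^ κ * b ≤ U := by rw [hU]; exact Nat.le_add_right _ _
  have hbU : b ≤ U := (Nat.le_mul_of_pos_left _ (Nat.two_pow_pos κ)).trans hκU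
  have hUF : 1 * U ≤ (F + 1) * U := Nat.mul_le_mul_right _ (by omega)
  have hbound := fun {k} (hk : k ≤ n) => abs_partialShift_le hf hu hT hk
  have hgω : g + 1 ≤ 2 ^ ω := by
    have : 1 * (1 * (g + 1)) ≤ n * ((d + 1) * (g + 1)) :=
      Nat.mul_le_mul hn (Nat.mul_le_mul_right _ (by omega))
    omega
  have hexp : ∀ k ≤ n, T + k * ((d + 1) * (g + 1)) + 2 ≤ 2 ^ ω := fun k hk =>
    (Nat.add_le_add_right (Nat.add_le_add_left (Nat.mul_le_mul_right _ hk) _) _).trans hW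
  rw [← hU, ← hF]
  refine Tri.le (t := 200 * U + (n + 1) * ((200 * b + (100 * ((d + 1 + 1) * b) + (K * ((F + 1) * U) +
    100 * b))) + 40 * len (n : ℤ))) (Tri.seq
    (Q₁ := fun S' => S'.reg 76 = (2 ^ κ : ℕ) ∧ S'.reg 70 = 1) (Tri.le (Tri.block_cons (b := b)
      (.pow2 (.reg h40 ((len_natCast_mono Nat.lt_two_pow_self.le).trans hMb)) hκb) hb1
      (Tri.block_cons (.const 1) hb1 (Tri.block_nil hb1 ⟨rfl, rfl⟩)))
      (Nat.mul_le_mul (by decide) hbU)) ?_) ?_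
  swap
  · have h1 : len (n : ℤ) ≤ b := (len_natCast_le n).trans hnb
    have h2 : (d + 1 + 1) * b ≤ 2 * (2 ^ κ * b) := by
      rw [← mul_assoc]
      exact Nat.mul_le_mul_right _ (by omega)
    have h3 : 1 * ((F + 1) * U) ≤ (n + 1) * ((F + 1) * U) := Nat.mul_le_mul_right _ (by omega)
    calc _ ≤ 200 * ((n + 1) * ((F + 1) * U)) + (n + 1) * (600 * ((F + 1) * U) + K * ((F + 1) * U)) := by
          refine add_le_add (by omega) (Nat.mul_le_mul_left _ ?_)
          omega
      _ = _ := by ring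
  rintro S₁ k₁ ⟨h76, h70⟩
  have g1 := (k₁.reg 1 (by decide) rfl).trans h1
  -- The last clause of the invariant is needed because the final array has to agree with
  -- `coeffArray` at all integers, also outside of the tensors.
  refine (Tri.forLoop g1 (fun k S' => S'.reg 70 = ((d + 1) ^ k : ℕ) ∧ Holds S' 0 M (partialShift d f u k) ∧
    ∀ z : ℤ, (∀ j : ℕ, j < M → z ≠ j) → S'.arr 0 z = 0) ⟨?_, ?_, ?_⟩ ?_).mono le_rfl ?_
  · simpa using h70
  · intro j hj
    rw [partialShift_zero, State.setReg_arr, k₁.arr 0 (by simp), a0]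
  · intro z hz
    rw [State.setReg_arr, k₁.arr 0 (by simp), a0]
    exact coeffArray_eq_zero f (hM ▸ hz)
  · rintro k hk S' hij kk ⟨i70, iH, iz⟩
    have g : ∀ r < 100, r ≠ 76 → r ≠ 70 → allAxesP.writes r = false → S'.reg r = S.reg r := by
      intro r hr n1 n2 hw
      have hw2 : (block [(76, Expr.shl (.const 1) (.reg 40)), (70, .const 1)]).writes r = false ∧
          (forLoop 71 1 axisP).writes r = false := by simpa [allAxesP, Prog.writes] using hw
      exact (kk.reg r hr hw2.2).trans (k₁.reg r hr hw2.1)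
    have g76 := (kk.reg 76 (by decide) rfl).trans h76
    have g40 := (kk.reg 40 (by decide) rfl).trans ((k₁.reg 40 (by decide) rfl).trans h40)
    have g41 := (kk.reg 41 (by decide) rfl).trans ((k₁.reg 41 (by decide) rfl).trans h41)
    have g51 := (kk.reg 51 (by decide) rfl).trans ((k₁.reg 51 (by decide) rfl).trans h51)
    have g57 := (kk.reg 57 (by decide) rfl).trans ((k₁.reg 57 (by decide) rfl).trans h57)
    have ga1 : S'.arr 1 = shiftArray u := by
      rw [kk.arr 1 (by simp [axisP, linesP]), k₁.arr 1 (by simp), a1]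
    have hpn : (d + 1) ^ (k + 1) ≤ (d + 1) ^ n := Nat.pow_le_pow_right (by omega) hk
    have hpk : (d + 1) ^ k ≤ (d + 1) ^ (k + 1) := Nat.pow_le_pow_right (by omega) (by omega)
    have hkb : len (((d + 1) ^ k : ℕ) : ℤ) ≤ b := (len_natCast_mono (hpk.trans hpn)).trans hDb
    have hk1 : (d + 1) * (d + 1) ^ k = (d + 1) ^ (k + 1) := by ring
    have hqb : len (((d + 1) * (d + 1) ^ k : ℕ) : ℤ) ≤ b := by
      rw [hk1]; exact (len_natCast_mono hpn).trans hDb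
    have huk : len (u ⟨k, hk⟩) ≤ b := (len_le_of_abs_lt (hu _)).trans (by omega)
    refine Tri.seq (Q₁ := fun S'' => S''.reg 42 = u ⟨k, hk⟩) (Tri.le ?_ (Nat.mul_le_mul_right _
      (by decide : blockWeight [(42, .load 1 (.reg 71))] ≤ 200))) ?_
    · refine Tri.block_cons (.load (.regN hij (by omega)) ?_ huk) hb1 (Tri.block_nil hb1 rfl)
      rw [ga1]
      exact shiftArray_natCast u ⟨k, hk⟩
    intro S₂ k₂ h42
    refine Tri.seq (tri_timesP (N := d + 1) (y := (d + 1) ^ k) ((k₂.reg 51 (by decide) rfl).trans g51)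
      ((k₂.reg 70 (by decide) rfl).trans i70) hb1 ?_ hkb hqb) ?_
    · exact (len_natCast_mono hκ).trans hMb
    intro S₃ k₃ h72
    have e1 : s * (d + 1) ^ (n - 1) = s * (d + 1) ^ (n - 1 - k) * (d + 1) ^ k := by
      rw [mul_assoc, ← pow_add]; congr 2; omega
    have e2 : s * (d + 1) ^ n = s * (d + 1) ^ (n - 1 - k) * ((d + 1) ^ k * (d + 1)) := by
      rw [mul_assoc, ← pow_succ, ← pow_add]; congr 2; omega
    have iH3 := (iH.keep k₂ (by simp)).keep k₃ (by simp)
    have hb' := hbound hk.le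
    rw [hM, e2] at iH3
    have := hlines S₃ κ ω (d + 1) ((d + 1) ^ k) (s * (d + 1) ^ (n - 1 - k)) b (u ⟨k, hk⟩)
      (partialShift d f u k) hω
      ((k₃.reg 40 (by decide) rfl).trans ((k₂.reg 40 (by decide) rfl).trans g40))
      ((k₃.reg 41 (by decide) rfl).trans ((k₂.reg 41 (by decide) rfl).trans g41))
      ((k₃.reg 42 (by decide) rfl).trans h42)
      ((k₃.reg 51 (by decide) rfl).trans ((k₂.reg 51 (by decide) rfl).trans g51))
      ((k₃.reg 76 (by decide) rfl).trans ((k₂.reg 76 (by decide) rfl).trans g76))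
      ((k₃.reg 70 (by decide) rfl).trans ((k₂.reg 70 (by decide) rfl).trans i70))
      (by rw [h72, mul_comm (d + 1)])
      (by rw [← e1]; exact ((k₃.reg 57 (by decide) rfl).trans ((k₂.reg 57 (by decide) rfl).trans g57)))
      hκ (by positivity) (by omega) hb hMb (by rw [← e2]; exact hsb)
      ((hu _).le.trans (pow_le_pow_right₀ (by norm_num) (by omega))) iH3
      (by
        rw [← e2]
        intro j hj
        exact (hb' j hj).trans (pow_le_pow_right₀ (by norm_num) (by have := hexp k hk.le; omega)))
      (by
        intro φ hφ i
        rw [← e1] at hφ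
        refine (abs_taylor_line_le hu ⟨k, hk⟩ hb' hφ i).trans_lt ?_
        have := hexp (k + 1) hk
        exact pow_lt_pow_right₀ (by norm_num) (by dsimp only; omega))
    rw [← e1, ← e2, ← hF, ← hM, ← hU] at this
    refine Tri.seq this ?_
    rintro S₄ k₄ ⟨r1, r2⟩
    refine Tri.post (Tri.block_cons (b := b) (.reg ((k₄.reg 72 (by decide) rfl).trans h72) hqb) hb1
      (Tri.block_nil hb1 rfl)) (Nat.mul_le_mul_right _ (by decide)) ?_
    rintro S₅ k₅ rfl
    refine ⟨?_, ?_, ?_⟩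
    · simp only [State.setReg_reg]
      rw [hk1]
      rfl
    · intro j hj
      simp only [State.setReg_arr]
      rw [r1 j hj]
      exact (partialShift_succ u hf ⟨k, hk⟩ (hM ▸ hj)).symm
    · intro z hz
      simp only [State.setReg_arr]
      rw [r2 z hz, k₃.arr 0 (by simp), k₂.arr 0 (by simp), iz z hz]
  · rintro S' ⟨⟨-, h2, h3⟩, -⟩
    ext z
    by_cases hz : ∃ j : ℕ, j < M ∧ z = j
    · obtain ⟨j, hj, rfl⟩ := hz
      rw [h2 j hj, partialShift_self]
    · push Not at hz
      rw [h3 z hz, coeffArray_eq_zero _ (hM ▸ hz)]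

end BitRAM

/-! ### The whole program -/

namespace BitRAM

open SSA

/-- Register `51` becomes `d + 1`, register `57` the number of lines in one direction, and register
`58` the number of coefficients. -/
def sizesP : Prog :=
  .seq (block [(51, .add (.reg 2) (.const 1)), (52, .const 1), (53, .sub (.reg 1) (.const 1))])
    (.seq (forLoop 54 53 (.seq (timesP 55 51 52) (block [(52, .reg 55)])))
      (.seq (timesP 57 0 52) (timesP 58 51 57)))

/-- Products are formed by repeated addition with the small factor `d + 1` or `s` as the count, so
about `n * (d + 1) + s` additions suffice although the results are large. -/
theorem tri_sizesP {S : State} {n s d b : ℕ} (hn : 1 ≤ n) (h0 : S.reg 0 = s) (h1 : S.reg 1 = n)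
    (h2 : S.reg 2 = d) (hnb : len (n : ℤ) ≤ b) (hsb : len (s : ℤ) ≤ b)
    (hDb : len (((d + 1) ^ n : ℕ) : ℤ) ≤ b) (hMb : len ((s * (d + 1) ^ n : ℕ) : ℤ) ≤ b) :
    Tri sizesP S (1000 * ((n * (d + 1) + s + 1) * b)) (fun S' => S'.reg 51 = (d + 1 : ℕ) ∧
      S'.reg 57 = (s * (d + 1) ^ (n - 1) : ℕ) ∧ S'.reg 58 = (s * (d + 1) ^ n : ℕ)) := by
  have hb1 : 1 ≤ b := (one_le_len _).trans hnb
  have hpow : ∀ j ≤ n, len (((d + 1) ^ j : ℕ) : ℤ) ≤ b := fun j hj =>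
    (len_natCast_mono (Nat.pow_le_pow_right (by omega) hj)).trans hDb
  have hD : len ((d + 1 : ℕ) : ℤ) ≤ b := by simpa using hpow 1 hn
  have hF : len ((s * (d + 1) ^ (n - 1) : ℕ) : ℤ) ≤ b :=
    (len_natCast_mono (Nat.mul_le_mul_left _ (Nat.pow_le_pow_right (by omega) (by omega)))).trans hMb
  have eM : (d + 1) * (s * (d + 1) ^ (n - 1)) = s * (d + 1) ^ n := by
    obtain ⟨m, rfl⟩ : ∃ m, n = m + 1 := ⟨n - 1, by omega⟩
    rw [Nat.add_sub_cancel]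
    ring
  refine Tri.le (t := 100 * b + ((n - 1 + 1) * ((100 * ((d + 1 + 1) * b) + 50 * b) +
    40 * len ((n - 1 : ℕ) : ℤ)) + (100 * ((s + 1) * b) + 100 * ((d + 1 + 1) * b)))) ?_ ?_
  swap
  · have h3 : len ((n - 1 : ℕ) : ℤ) ≤ b := (len_natCast_mono (by omega)).trans hnb
    have h4 : (d + 1) * b ≤ n * ((d + 1) * b) := Nat.le_mul_of_pos_left _ hn
    have h5 : 1 * b ≤ (d + 1) * b := Nat.mul_le_mul_right _ (by omega)
    rw [Nat.sub_add_cancel hn]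
    calc _ ≤ 100 * b + (n * ((100 * ((d + 1 + 1) * b) + 50 * b) + 40 * b) +
          (100 * ((s + 1) * b) + 100 * ((d + 1 + 1) * b))) := by gcongr
      _ ≤ 100 * b + (n * (400 * ((d + 1) * b)) + (100 * ((s + 1) * b) + 200 * ((d + 1) * b))) := by
          refine Nat.add_le_add_left (add_le_add (Nat.mul_le_mul_left _ ?_) ?_) _
          · rw [add_mul (d + 1)]
            omega
          · rw [add_mul (d + 1)]
            omega
      _ ≤ 1000 * (n * ((d + 1) * b) + (s + 1) * b) := by
          have : n * (400 * ((d + 1) * b)) = 400 * (n * ((d + 1) * b)) := by ring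
          omega
      _ = _ := by ring
  refine Tri.seq (Q₁ := fun S' => S'.reg 51 = (d + 1 : ℕ) ∧ S'.reg 52 = 1 ∧ S'.reg 53 = (n - 1 : ℕ))
    (Tri.le ?_ (Nat.mul_le_mul_right _ (by decide : blockWeight [(51, .add (.reg 2) (.const 1)),
      (52, .const 1), (53, .sub (.reg 1) (.const 1))] ≤ 100))) ?_
  · refine Tri.block_cons (.addN (.reg h2 ((len_natCast_mono (Nat.le_succ d)).trans hD)) .one) hb1 ?_
    refine Tri.block_cons (.const 1) hb1 ?_
    refine Tri.block_cons (.subN (.reg h1 hnb) .one hn) hb1 ?_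
    exact Tri.block_nil hb1 ⟨rfl, rfl, rfl⟩
  rintro S₁ k₁ ⟨h51, h52, h53⟩
  refine Tri.seq (Q₁ := fun S' => S'.reg 52 = ((d + 1) ^ (n - 1) : ℕ)) (Tri.mono (Tri.forLoop h53
    (t := 100 * ((d + 1 + 1) * b) + 50 * b) (fun j S' => S'.reg 52 = ((d + 1) ^ j : ℕ))
    (by simpa using h52) ?_) le_rfl fun _ h => h.1) ?_
  · intro j hj S' hij k hI
    refine Tri.seq (tri_timesP (N := d + 1) (y := (d + 1) ^ j) ((k.reg 51 (by decide) rfl).trans h51) hI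
      hb1 hD (hpow j (by omega)) (by rw [← pow_succ']; exact hpow (j + 1) (by omega))) ?_
    intro S₂ k₂ h55
    refine Tri.le (Tri.block_cons (b := b) (.reg h55 ?_) hb1 (Tri.block_nil hb1 ?_))
      (Nat.mul_le_mul_right _ (by decide))
    · rw [← pow_succ']; exact hpow (j + 1) (by omega)
    · simp only [State.setReg_reg]
      rw [pow_succ']
      rfl
  intro S₂ k₂ h52
  have g0 := (k₂.reg 0 (by decide) rfl).trans ((k₁.reg 0 (by decide) rfl).trans h0)
  have g51 := (k₂.reg 51 (by decide) rfl).trans h51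
  refine Tri.seq (tri_timesP g0 h52 hb1 hsb (hpow _ (by omega)) hF) ?_
  intro S₃ k₃ h57
  have g51 := (k₃.reg 51 (by decide) rfl).trans g51
  refine (tri_timesP (N := d + 1) (y := s * (d + 1) ^ (n - 1)) g51 h57 hb1 hD hF (by rwa [eM])).post
    le_rfl ?_
  intro S₄ k₄ h58
  exact ⟨(k₄.reg 51 (by decide) rfl).trans g51, (k₄.reg 57 (by decide) rfl).trans h57, eM ▸ h58⟩

/-- Compute a power of two that exceeds the bitsize of the entries of an array. -/
def boundP (a cnt r : ℕ) : Prog :=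
  .seq (maxP a cnt) (searchP r 60 (.shl (.const 1) (.reg r)))

/-- The bound `τ` is unknown to the program, which searches the least `e` with `m < 2 ^ 2 ^ e` for
the maximum `m`. Unless `e = 0`, the failure of `e - 1` gives `2 ^ (e - 1) < τ`, so `2 ^ e`
overshoots by a factor of two at most. -/
theorem tri_boundP {S : State} {a cnt r N τ b A : ℕ} {X : ℕ → ℤ} (hN : S.reg cnt = N)
    (hX : Holds S a N X) (hXb : ∀ j < N, |X j| < 2 ^ τ) (hb : 2 * τ + 2 ≤ b)
    (hNb : len (N : ℤ) ≤ b) (hA : ∀ a, 2 ^ (a - 1) < τ → a ≤ A)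
    (hcnt : cnt < 100 := by decide) (hc60 : cnt ≠ 60 := by decide) (hc61 : cnt ≠ 61 := by decide)
    (hw2 : (block (maxBody a)).writes cnt = false := by rfl)
    (hok : (Expr.shr (.reg 60) (.shl (.const 1) (.reg r))).ok = true := by rfl)
    (hr : r < 100 := by decide) (hxr : 60 ≠ r := by decide)
    (hwx : (block [(r, .add (.reg r) (.const 1))]).writes 60 = false := by rfl) :
    Tri (boundP a cnt r) S (1000 * ((N + 1) * b) + 1000 * ((A + 1) * b)) (fun S' =>
      ∃ e : ℕ, S'.reg r = e ∧ 2 ^ e ≤ 2 * τ + 1 ∧ e + 1 ≤ b ∧ ∀ j < N, |X j| < 2 ^ 2 ^ e) := by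
  refine Tri.seq (tri_maxP hN hX hXb (by omega) hNb hcnt hc60 hc61 hw2) ?_
  rintro S₁ k₁ ⟨m, h60, hm, hmX⟩
  have hpre : ∀ e, (e = 0 ∨ 2 ^ 2 ^ (e - 1) ≤ m) → 2 ^ e ≤ 2 * τ + 1 ∧ e ≤ A := by
    intro e he
    rcases Nat.eq_zero_or_pos e with h | h
    · subst h
      simp
    · have h1 := he.resolve_left h.ne'
      have h2 : 2 ^ (e - 1) < τ := (Nat.pow_lt_pow_iff_right (by norm_num)).1 (h1.trans_lt hm)
      refine ⟨?_, hA e h2⟩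
      have : 2 ^ e = 2 * 2 ^ (e - 1) := by rw [← pow_succ']; congr 1; omega
      omega
  refine (tri_searchP (A := A) (b := b) (fun e => 2 ^ e) (fun e => Nat.lt_two_pow_self.le) h60
    ((len_le_of_lt_two_pow hm).trans (by omega)) ?_ ?_ hok ?_ hr (by decide) hxr hwx).mono le_rfl ?_
  · intro e he
    have := hpre e he
    omega
  · intro S' e h he
    have : e < 2 ^ e := Nat.lt_two_pow_self
    exact .pow2 (.regN h (by omega)) (by omega)
  · simp [Expr.weight, Expr.growth, show len 1 = 2 by decide]
  · rintro S' ⟨e, h1, h2, h3⟩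
    have h4 := (hpre e h3).1
    have : e < 2 ^ e := Nat.lt_two_pow_self
    refine ⟨e, h1, h4, by omega, fun j hj => (hmX j hj).trans_lt ?_⟩
    exact_mod_cast h2

/-- Compute the logarithm of the number of bits that intermediate results may have, and the
logarithm of the number of coefficients in one direction. -/
def widthP : Prog :=
  .seq (block [(64, .shl (.const 1) (.reg 63)), (66, .add (.shl (.const 1) (.reg 65)) (.const 1))])
    (.seq (timesP 67 51 66) (.seq (timesP 68 1 67)
      (.seq (block [(69, .add (.add (.reg 64) (.reg 68)) (.const 2))])
        (.seq (searchP 41 69 (.reg 41)) (searchP 40 2 (.reg 40))))))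

/-- The number whose logarithm is searched is the bound of `abs_partialShift_le` for `T = 2 ^ p` and
`g = 2 ^ q` after all `n` variables, plus two spare bits. Rounding up to powers of two costs a
factor of two in each of `2 ^ ω` and `2 ^ κ`. -/
theorem tri_widthP {S : State} {n d p q b A : ℕ} (h1 : S.reg 1 = n) (h2 : S.reg 2 = d)
    (h51 : S.reg 51 = (d + 1 : ℕ)) (h63 : S.reg 63 = p) (h65 : S.reg 65 = q) (hn : 1 ≤ n)
    (hp : p + 1 ≤ b) (hq : q + 1 ≤ b)
    (hb : 2 * (2 ^ p + n * ((d + 1) * (2 ^ q + 1)) + 2) + 1 ≤ b)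
    (hA : ∀ a, 2 ^ (a - 1) ≤ 2 ^ p + n * ((d + 1) * (2 ^ q + 1)) + 2 → a ≤ A) :
    Tri widthP S (3000 * ((n + d + A + 2) * b)) (fun S' => ∃ κ ω : ℕ, S'.reg 40 = κ ∧
      S'.reg 41 = ω ∧ 1 ≤ ω ∧ 2 ^ p + n * ((d + 1) * (2 ^ q + 1)) + 2 ≤ 2 ^ ω ∧
      2 ^ ω ≤ 2 * (2 ^ p + n * ((d + 1) * (2 ^ q + 1)) + 2) ∧ d + 1 ≤ 2 ^ κ ∧
      2 ^ κ ≤ 2 * (d + 1) ∧ κ ≤ A ∧ ω ≤ A) := by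
  obtain ⟨W, hW⟩ : ∃ W, W = 2 ^ p + n * ((d + 1) * (2 ^ q + 1)) + 2 := ⟨_, rfl⟩
  rw [← hW] at hb hA ⊢
  have hb1 : 1 ≤ b := by omega
  have hE : (d + 1) * (2 ^ q + 1) ≤ n * ((d + 1) * (2 ^ q + 1)) := Nat.le_mul_of_pos_left _ hn
  have hn1 : n ≤ n * ((d + 1) * (2 ^ q + 1)) :=
    Nat.le_mul_of_pos_right _ (Nat.mul_pos (Nat.succ_pos _) (Nat.succ_pos _))
  have hd1 : d + 1 ≤ (d + 1) * (2 ^ q + 1) := Nat.le_mul_of_pos_right _ (Nat.succ_pos _)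
  have hq1 : 2 ^ q + 1 ≤ (d + 1) * (2 ^ q + 1) := Nat.le_mul_of_pos_left _ (Nat.succ_pos _)
  have hp0 := Nat.two_pow_pos p
  have hy1 : n * ((d + 1) * (2 ^ q + 1)) ≤ W := by linarith
  have hy2 : (d + 1) * (2 ^ q + 1) ≤ W := hE.trans hy1
  have hy3 : d + 1 ≤ W := hd1.trans hy2
  have hy4 : 2 ^ q + 1 ≤ W := hq1.trans hy2
  have hy5 : 2 ^ p ≤ W := by linarith
  have hy6 : n ≤ W := hn1.trans hy1
  have hlen : ∀ {x : ℕ}, x ≤ W → len (x : ℤ) ≤ b := fun {x} hx => (len_natCast_le x).trans (by omega)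
  have step : ∀ {x a : ℕ}, x ≤ W → (a = 0 ∨ 2 ^ (a - 1) ≤ x) → 2 ^ a ≤ 2 * x + 1 ∧ a + 1 ≤ b ∧ a ≤ A := by
    intro x a hx ha
    rcases Nat.eq_zero_or_pos a with h | h
    · subst h
      simp
      omega
    · have h1 := ha.resolve_left h.ne'
      have h2 : 2 ^ a = 2 * 2 ^ (a - 1) := by rw [← pow_succ']; congr 1; omega
      have h3 : a < 2 ^ a := Nat.lt_two_pow_self
      exact ⟨by omega, by omega, hA a (h1.trans hx)⟩
  refine Tri.le (t := 100 * b + (100 * ((d + 1 + 1) * b) + (100 * ((n + 1) * b) + (100 * b +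
    (1000 * ((A + 1) * b) + 1000 * ((A + 1) * b)))))) ?_ ?_
  swap
  · simp only [add_mul]
    omega
  refine Tri.seq (Q₁ := fun S' => S'.reg 64 = (2 ^ p : ℕ) ∧ S'.reg 66 = (2 ^ q + 1 : ℕ))
    (Tri.le ?_ (Nat.mul_le_mul_right _ (by decide : blockWeight [(64, .shl (.const 1) (.reg 63)),
      (66, .add (.shl (.const 1) (.reg 65)) (.const 1))] ≤ 100))) ?_
  · refine Tri.block_cons (.pow2 (.regN h63 hp) (by omega)) hb1 ?_
    refine Tri.block_cons (.addN (.pow2 (n := q) (.regN h65 hq) (by omega)) .one) hb1 ?_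
    exact Tri.block_nil hb1 ⟨rfl, rfl⟩
  rintro S₁ k₁ ⟨h64, h66⟩
  refine Tri.seq (tri_timesP (N := d + 1) (y := 2 ^ q + 1) ((k₁.reg 51 (by decide) rfl).trans h51) h66
    hb1 (hlen hy3) (hlen hy4) (hlen hy2)) ?_
  intro S₂ k₂ h67
  refine Tri.seq (tri_timesP (N := n) (y := (d + 1) * (2 ^ q + 1))
    ((k₂.reg 1 (by decide) rfl).trans ((k₁.reg 1 (by decide) rfl).trans h1)) h67
    hb1 (hlen hy6) (hlen hy2) (hlen hy1)) ?_
  intro S₃ k₃ h68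
  have g64 := (k₃.reg 64 (by decide) rfl).trans ((k₂.reg 64 (by decide) rfl).trans h64)
  have g2 := (k₃.reg 2 (by decide) rfl).trans ((k₂.reg 2 (by decide) rfl).trans
    ((k₁.reg 2 (by decide) rfl).trans h2))
  refine Tri.seq (Q₁ := fun S' => S'.reg 69 = (W : ℤ)) (Tri.le ?_ (Nat.mul_le_mul_right _
    (by decide : blockWeight [(69, .add (.add (.reg 64) (.reg 68)) (.const 2))] ≤ 100))) ?_
  · refine Tri.block_cons (.addN (.addN (.reg g64 (hlen hy5)) (.reg h68 (hlen hy1))) .two)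
      hb1 (Tri.block_nil hb1 ?_)
    rw [hW]
    rfl
  intro S₄ k₄ h69
  have g2 := (k₄.reg 2 (by decide) rfl).trans g2
  refine Tri.seq (tri_searchP (A := A) (b := b) (fun e => e) (fun e => le_rfl) h69 (hlen le_rfl)
    (fun e he => (step le_rfl he).2) fun S' e h he => .regN h he) ?_
  rintro S₅ k₅ ⟨ω, h41, hω1, hω2⟩
  have g2 := (k₅.reg 2 (by decide) rfl).trans g2
  refine (tri_searchP (A := A) (b := b) (fun e => e) (fun e => le_rfl) g2 (hlen (by omega))
    (fun e he => (step (x := d) (by omega) he).2) fun S' e h he => .regN h he).post le_rfl ?_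
  rintro S₆ k₆ ⟨κ, h40, hκ1, hκ2⟩
  have s1 := step le_rfl hω2
  have s2 := step (show d ≤ W by omega) hκ2
  have hω0 : ω ≠ 0 := by
    rintro rfl
    simp at hω1
    omega
  have e2 : 2 ^ ω = 2 * 2 ^ (ω - 1) := by rw [← pow_succ']; congr 1; omega
  exact ⟨κ, ω, h40, (k₆.reg 41 (by decide) rfl).trans h41, by omega, hω1.le, by omega, hκ1,
    by omega, s2.2.2, s1.2.2⟩

/-- Shift polynomials in several variables. -/
def taylorShiftP : Prog :=
  .seq sizesP (.seq (boundP 0 58 63) (.seq (boundP 1 1 65) (.seq widthP allAxesP)))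

end BitRAM

/-! ### Running time of the whole program -/

namespace BitRAM

open SSA TaylorShift

theorem tri_taylorShiftP : ∃ K, ∀ (S : State) (n s d τ σ b A : ℕ)
    (f : Fin s → MvPolynomial (Fin n) ℤ) (u : Fin n → ℤ), 1 ≤ n → S.reg 0 = s → S.reg 1 = n →
    S.reg 2 = d → S.arr 0 = coeffArray d f → S.arr 1 = shiftArray u →
    (∀ j k, MvPolynomial.degreeOf k (f j) ≤ d) → (∀ j, polyBitsize (f j) ≤ τ) →
    (∀ k, intBitsize (u k) ≤ σ) → 40 * (τ + n * ((d + 1) * σ)) ≤ b →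
    len ((2 * (s * (d + 1) ^ n) : ℕ) : ℤ) ≤ b → len (((d + 1) ^ n : ℕ) : ℤ) ≤ b →
    (∀ a, 2 ^ (a - 1) ≤ 14 * (τ + n * ((d + 1) * σ)) → a ≤ A) →
    Tri taylorShiftP S (K * ((n + 1) * ((s * (d + 1) ^ (n - 1) + 1) * ((d + 1) * (b *
      (2 * A + 3) ^ 6))))) (fun S' => S'.arr 0 = coeffArray d fun j => shift u (f j)) := by
  obtain ⟨K, hK⟩ := tri_allAxesP
  refine ⟨8000 + K * 114, ?_⟩
  intro S n s d τ σ b A f u hn h0 h1 h2 a0 a1 hd hf hu hb hMb hDb hA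
  obtain ⟨V, hV⟩ : ∃ V, V = τ + n * ((d + 1) * σ) := ⟨_, rfl⟩
  obtain ⟨F, hF⟩ : ∃ F, F = s * (d + 1) ^ (n - 1) := ⟨_, rfl⟩
  obtain ⟨M, hM⟩ : ∃ M, M = s * (d + 1) ^ n := ⟨_, rfl⟩
  obtain ⟨Z, hZ⟩ : ∃ Z, Z = (n + 1) * ((F + 1) * ((d + 1) * (b * (2 * A + 3) ^ 6))) := ⟨_, rfl⟩
  rw [← hV] at hb hA
  rw [← hF, ← hZ]
  have hσ : 1 ≤ σ := (le_max_left 1 _).trans (hu ⟨0, hn⟩)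
  have e1 : (d + 1) * 1 ≤ (d + 1) * σ := Nat.mul_le_mul_left _ hσ
  have e2 : (d + 1) * σ ≤ n * ((d + 1) * σ) := Nat.le_mul_of_pos_left _ hn
  have e3 : n * 1 ≤ n * ((d + 1) * σ) := Nat.mul_le_mul_left _ (by omega)
  have e4 : 1 * σ ≤ (d + 1) * σ := Nat.mul_le_mul_right _ (by omega)
  have hMF : F * (d + 1) = M := by
    rw [hF, hM, mul_assoc, ← pow_succ, Nat.sub_add_cancel hn]
  have hsM : s ≤ M := hM ▸ Nat.le_mul_of_pos_right _ (by positivity)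
  have hMb' : len (M : ℤ) ≤ b := by
    refine (len_natCast_mono ?_).trans hMb
    omega
  have hsb : len (s : ℤ) ≤ b := (len_natCast_mono hsM).trans hMb'
  have hlen : ∀ {x : ℕ}, x + 1 ≤ b → len (x : ℤ) ≤ b := fun {x} hx => (len_natCast_le x).trans hx
  have hY : 1 ≤ (2 * A + 3) ^ 6 := Nat.one_le_pow _ _ (by omega)
  have hY' : 2 * A + 3 ≤ (2 * A + 3) ^ 6 := Nat.le_self_pow (by norm_num) _
  have cost : ∀ {x y : ℕ}, x ≤ (n + 1) * ((F + 1) * (d + 1)) → y ≤ (2 * A + 3) ^ 6 →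
      x * y * b ≤ Z := fun {x y} hx hy => by
    calc _ ≤ (n + 1) * ((F + 1) * (d + 1)) * (2 * A + 3) ^ 6 * b := by gcongr
      _ = Z := by rw [hZ]; ring
  have c0 : (F + 1) * (d + 1) ≤ (n + 1) * ((F + 1) * (d + 1)) := Nat.le_mul_of_pos_left _ (by omega)
  have c1 : (n + 1) * (d + 1) ≤ (n + 1) * ((F + 1) * (d + 1)) :=
    Nat.mul_le_mul_left _ (Nat.le_mul_of_pos_left _ (by omega))
  have c2 : n * (d + 1) + s + 1 ≤ (n + 1) * ((F + 1) * (d + 1)) := by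
    have h : (n + 1) * ((F + 1) * (d + 1)) = n * (d + 1) + (d + 1) + (n + 1) * M := by
      rw [← hMF]; ring
    have : 1 * M ≤ (n + 1) * M := Nat.mul_le_mul_right _ (by omega)
    omega
  have c3 : M + 1 ≤ (F + 1) * (d + 1) := by rw [add_mul, hMF]; omega
  have c4 : (n + d + 1) ≤ (n + 1) * (d + 1) := by
    have : (n + 1) * (d + 1) = n * d + (n + d + 1) := by ring
    omega
  have hA1 : (A + 1) * b ≤ Z := by
    simpa using cost (x := 1) (y := A + 1) (by omega) (by omega)
  refine Tri.le (t := 1000 * ((n * (d + 1) + s + 1) * b) + ((1000 * ((M + 1) * b) +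
    1000 * ((A + 1) * b)) + ((1000 * ((n + 1) * b) + 1000 * ((A + 1) * b)) +
    (3000 * ((n + d + A + 2) * b) + K * (114 * Z))))) ?_ ?_
  swap
  · have k1 : (n * (d + 1) + s + 1) * b ≤ Z := by simpa using cost c2 hY
    have k2 : (M + 1) * b ≤ Z := by simpa using cost (c3.trans c0) hY
    have k3 : (n + 1) * b ≤ Z := by simpa using cost (x := n + 1) (by omega) hY
    have k4 : (n + d + A + 2) * b ≤ Z := by
      refine (Nat.mul_le_mul_right _ ?_).trans (cost (x := n + d + 1) (by omega) hY')
      have : (n + d + 1) * (2 * A + 3) = 2 * ((n + d) * A) + 3 * (n + d) + 2 * A + 3 := by ring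
      omega
    calc _ ≤ 8000 * Z + K * (114 * Z) := by omega
      _ = _ := by ring
  refine Tri.seq (tri_sizesP hn h0 h1 h2 (hlen (by omega)) hsb hDb (hM ▸ hMb')) ?_
  rintro S₁ k₁ ⟨h51, h57, h58⟩
  rw [← hM] at h58
  have a0 := (k₁.arr 0 (by rfl)).trans a0
  have a1 := (k₁.arr 1 (by rfl)).trans a1
  have h1 := (k₁.reg 1 (by decide) rfl).trans h1
  have h2 := (k₁.reg 2 (by decide) rfl).trans h2
  refine Tri.seq (tri_boundP (τ := τ) (A := A) (X := fun j => coeffArray d f j) h58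
    (fun j _ => by rw [a0]) (fun j _ => abs_coeffArray_lt hf j) (by omega) hMb'
    (fun a ha => hA a (by omega))) ?_
  rintro S₂ k₂ ⟨p, h63, hp1, hp2, hp3⟩
  have a0 := (k₂.arr 0 (by rfl)).trans a0
  have a1 := (k₂.arr 1 (by rfl)).trans a1
  have h1 := (k₂.reg 1 (by decide) rfl).trans h1
  have h2 := (k₂.reg 2 (by decide) rfl).trans h2
  have h51 := (k₂.reg 51 (by decide) rfl).trans h51
  have h57 := (k₂.reg 57 (by decide) rfl).trans h57
  refine Tri.seq (tri_boundP (τ := σ) (A := A) (X := fun j => shiftArray u j) h1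
    (fun j _ => by rw [a1]) (fun j _ => abs_shiftArray_lt hu j) (by omega) (hlen (by omega))
    (fun a ha => hA a (by omega))) ?_
  rintro S₃ k₃ ⟨q, h65, hq1, hq2, hq3⟩
  have a0 := (k₃.arr 0 (by rfl)).trans a0
  have a1 := (k₃.arr 1 (by rfl)).trans a1
  have h1 := (k₃.reg 1 (by decide) rfl).trans h1
  have h2 := (k₃.reg 2 (by decide) rfl).trans h2
  have h51 := (k₃.reg 51 (by decide) rfl).trans h51
  have h57 := (k₃.reg 57 (by decide) rfl).trans h57
  have h63 := (k₃.reg 63 (by decide) rfl).trans h63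
  obtain ⟨W, hW⟩ : ∃ W, W = 2 ^ p + n * ((d + 1) * (2 ^ q + 1)) + 2 := ⟨_, rfl⟩
  -- Here `2 ^ p ≤ 2 * τ + 1` and `2 ^ q + 1 ≤ 2 * σ + 2 ≤ 4 * σ`, so `W` is at most `2 * τ + 4 * n
  -- * (d + 1) * σ + 3`. Consequently `2 ^ ω ≤ 14 * V`, the number that occurs in `hA`.
  have hWV : W ≤ 7 * V := by
    have : n * ((d + 1) * (2 ^ q + 1)) ≤ n * ((d + 1) * (4 * σ)) :=
      Nat.mul_le_mul_left _ (Nat.mul_le_mul_left _ (by omega))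
    have : n * ((d + 1) * (4 * σ)) = 4 * (n * ((d + 1) * σ)) := by ring
    omega
  refine Tri.seq (tri_widthP (A := A) (b := b) h1 h2 h51 h63 h65 hn hp2 hq2
    (by rw [← hW]; omega) (fun a ha => hA a (by rw [← hW] at ha; omega))) ?_
  rintro S₄ k₄ ⟨κ, ω, h40, h41, hω, hω1, hω2, hκ1, hκ2, hκA, hωA⟩
  have a0 := (k₄.arr 0 (by rfl)).trans a0
  have a1 := (k₄.arr 1 (by rfl)).trans a1
  have h1 := (k₄.reg 1 (by decide) rfl).trans h1
  have h51 := (k₄.reg 51 (by decide) rfl).trans h51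
  have h57 := (k₄.reg 57 (by decide) rfl).trans h57
  have hκκ : κ < 2 ^ κ := Nat.lt_two_pow_self
  rw [← hW] at hω2
  refine (hK S₄ n s d κ ω b (2 ^ p) (2 ^ q) f u hω hn h1 h40 h41 h51 h57 hκ1 (by omega)
    (hlen (by omega)) (by omega) (by omega) hMb hDb hω1 a0 a1 hd
    (fun k => by rw [← shiftArray_natCast u k]; exact hq3 k k.2)
    (fun j hj => (hp3 j (hM ▸ hj)).le)).mono (Nat.mul_le_mul_left _ ?_) fun _ h => h
  rw [← hF, hZ]
  -- The constant is `2 + 2 * 14 * 4`, from `2 ^ κ ≤ 2 * (d + 1)` and `2 ^ ω ≤ 14 * b`.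
  have key : 2 ^ κ * b + 2 ^ (κ + ω + 2) * (κ + ω + 3) ^ 6 ≤
      114 * ((d + 1) * (b * (2 * A + 3) ^ 6)) := by
    have hω3 : 2 ^ ω ≤ 14 * b := by omega
    calc _ = 2 ^ κ * (b * 1) + 2 ^ κ * 2 ^ ω * 4 * (κ + ω + 3) ^ 6 := by rw [pow_add, pow_add]; ring
      _ ≤ 2 * (d + 1) * (b * (2 * A + 3) ^ 6) +
          2 * (d + 1) * (14 * b) * 4 * (2 * A + 3) ^ 6 := by
        gcongr
        omega
      _ = _ := by ring
  calc _ ≤ (n + 1) * ((F + 1) * (114 * ((d + 1) * (b * (2 * A + 3) ^ 6)))) := by gcongr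
    _ = _ := by ring

end BitRAM

/-! ### The bound in terms of the input sizes and their logarithm -/

theorem Nat.le_of_two_pow_pred_le_pow {v a k : ℕ} (h : 2 ^ (a - 1) ≤ v ^ k) :
    a ≤ k * (Nat.log 2 v + 1) + 1 := by
  have h1 : v ^ k ≤ 2 ^ (k * (Nat.log 2 v + 1)) := by
    rw [mul_comm, pow_mul]
    exact Nat.pow_le_pow_left (Nat.lt_pow_succ_log_self (by norm_num) v).le _
  have := (Nat.pow_le_pow_iff_right (by norm_num)).1 (h.trans h1)
  omega

namespace BitRAM

open TaylorShift

theorem exists_exec_taylorShiftP : ∃ K₀, ∀ (K n d s τ σ : ℕ) (f : Fin s → MvPolynomial (Fin n) ℤ)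
    (u : Fin n → ℤ), 1 ≤ n → s ≤ K * n → (∀ j k, MvPolynomial.degreeOf k (f j) ≤ d) →
    (∀ j, polyBitsize (f j) ≤ τ) → (∀ k, intBitsize (u k) ≤ σ) →
    ∃ (S : State) (t : ℕ), Exec taylorShiftP (inputState d f u) S t ∧
      S.arr 0 = coeffArray d (fun j => shift u (f j)) ∧
      t ≤ K₀ * ((K + 1) * (K + 40)) * (n ^ 2 * (d + 1) ^ n * τ + (d + 1) ^ (n + 1) * n ^ 3 * σ) *
        Nat.log 2 (n + d + τ + σ + 2) ^ 6 := by
  obtain ⟨K₀, hK⟩ := tri_taylorShiftP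
  refine ⟨K₀ * (2 * 37 ^ 6), ?_⟩
  intro K n d s τ σ f u hn hs hd hf hu
  obtain ⟨v, hv⟩ : ∃ v, v = n + d + τ + σ + 2 := ⟨_, rfl⟩
  obtain ⟨V, hV⟩ : ∃ V, V = τ + n * ((d + 1) * σ) := ⟨_, rfl⟩
  have hσ : 1 ≤ σ := (le_max_left 1 _).trans (hu ⟨0, hn⟩)
  have hnd : n * (d + 1) ≤ V := by
    have : n * ((d + 1) * 1) ≤ n * ((d + 1) * σ) :=
      Nat.mul_le_mul_left _ (Nat.mul_le_mul_left _ hσ)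
    rw [mul_one] at this
    omega
  have hV1 : 1 ≤ V := (Nat.mul_le_mul hn (Nat.succ_pos d)).trans hnd
  have hL : 1 ≤ Nat.log 2 v := Nat.log_pos (by norm_num) (by omega)
  -- A crude bound is enough, because only the logarithm of `V` enters: `V ≤ v + v ^ 3`, and
  -- constants are absorbed by `2 ≤ v`.
  have hVv : 14 * V ≤ v ^ 8 := by
    have h2 : 2 ≤ v := by omega
    have h4 : V ≤ v + v * (v * v) := by
      rw [hV]
      exact add_le_add (by omega) (Nat.mul_le_mul (by omega) (Nat.mul_le_mul (by omega) (by omega)))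
    have h5 : 2 ^ 4 ≤ v ^ 4 := Nat.pow_le_pow_left h2 4
    have h6 : 2 * v ^ 3 ≤ v ^ 4 := by
      rw [pow_succ' v 3]
      exact Nat.mul_le_mul_right _ h2
    have h7 : v ≤ v ^ 3 := Nat.le_self_pow (by norm_num) _
    have h8 : v * (v * v) = v ^ 3 := by ring
    calc 14 * V ≤ 2 ^ 4 * v ^ 4 := Nat.mul_le_mul (by norm_num) (by omega)
      _ ≤ v ^ 4 * v ^ 4 := Nat.mul_le_mul_right _ h5
      _ = _ := by ring
  have hD : (d + 1) ^ n ≤ 2 ^ (n * d) := by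
    rw [mul_comm, pow_mul]
    exact Nat.pow_le_pow_left Nat.lt_two_pow_self _
  have hKV : K * 1 ≤ K * V := Nat.mul_le_mul_left _ hV1
  have hM : 2 * (s * (d + 1) ^ n) < 2 ^ (K + n * (d + 1) + 1) := by
    have h1 : s < 2 ^ K * 2 ^ n :=
      hs.trans_lt (Nat.mul_lt_mul'' Nat.lt_two_pow_self Nat.lt_two_pow_self)
    calc 2 * (s * (d + 1) ^ n) ≤ 2 * (s * 2 ^ (n * d)) := by gcongr
      _ < 2 * (2 ^ K * 2 ^ n * 2 ^ (n * d)) :=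
        Nat.mul_lt_mul_of_pos_left (Nat.mul_lt_mul_of_pos_right h1 (by positivity)) (by norm_num)
      _ = _ := by rw [← pow_add, ← pow_add, ← pow_succ']; congr 1; ring
  -- The length bound `(K + 40) * V` covers the values, for which `40 * V` is enough, and the
  -- addresses: `s ≤ K * n < 2 ^ K * 2 ^ n` and `(d + 1) ^ n ≤ 2 ^ (n * d)`. So `K` affects the
  -- constant but not the program. By `14 * V ≤ v ^ 8` the searches take at most `8 * (log v + 1) +
  -- 1 ≤ 16 * log v + 1` rounds.
  obtain ⟨M', S', t, e, ht, hS, hQ⟩ := hK (inputState d f u) n s d τ σ ((K + 40) * V)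
    (16 * Nat.log 2 v + 1) f u hn rfl rfl rfl rfl rfl hd hf hu
    (by rw [← hV]; exact Nat.mul_le_mul_right _ (by omega))
    ((len_le_of_lt_two_pow hM).trans (by rw [add_mul]; omega))
    ((len_le_of_lt_two_pow (hD.trans_lt (Nat.pow_lt_pow_right (by norm_num)
      (Nat.lt_succ_self _)))).trans (by rw [add_mul]; rw [mul_add] at hnd; omega))
    (fun a ha => (Nat.le_of_two_pow_pred_le_pow (ha.trans (hV ▸ hVv))).trans (by omega))
    _ (Sim.refl _)
  refine ⟨M', t, e, by rw [hS.2]; exact hQ, ht.trans ?_⟩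
  rw [← hv]
  have hF : (s * (d + 1) ^ (n - 1) + 1) * (d + 1) ≤ (K + 1) * n * (d + 1) ^ n := by
    have e1 : (d + 1) ^ n = (d + 1) ^ (n - 1) * (d + 1) := by
      rw [← pow_succ, Nat.sub_add_cancel hn]
    have e2 : 1 ≤ (d + 1) ^ (n - 1) := Nat.one_le_pow _ _ (Nat.succ_pos _)
    calc _ ≤ (K * n * (d + 1) ^ (n - 1) + n * (d + 1) ^ (n - 1)) * (d + 1) := by
          gcongr
          exact Nat.mul_le_mul hn e2
      _ = _ := by rw [e1]; ring
  -- The constant `37` comes from `2 * (16 * L + 1) + 3 = 32 * L + 5 ≤ 37 * L` for the logarithm `L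
  -- ≥ 1`.
  calc _ = K₀ * ((n + 1) * ((s * (d + 1) ^ (n - 1) + 1) * (d + 1) * ((K + 40) * V *
        (2 * (16 * Nat.log 2 v + 1) + 3) ^ 6))) := by ring
    _ ≤ K₀ * ((2 * n) * ((K + 1) * n * (d + 1) ^ n * ((K + 40) * V *
        (37 * Nat.log 2 v) ^ 6))) := by
      gcongr
      · omega
      · omega
    _ = _ := by rw [hV]; ring

end BitRAM

theorem mainTheorem10 :
    ∃ P : BitRAM.Prog, ∀ K : ℕ, ∃ C c : ℕ,
      ∀ (n d s τ σ : ℕ) (f : Fin s → MvPolynomial (Fin n) ℤ) (u : Fin n → ℤ),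
        1 ≤ n → s ≤ K * n →
        (∀ j k, MvPolynomial.degreeOf k (f j) ≤ d) →
        (∀ j, TaylorShift.polyBitsize (f j) ≤ τ) →
        (∀ k, TaylorShift.intBitsize (u k) ≤ σ) →
        ∃ (S : BitRAM.State) (t : ℕ),
          BitRAM.Exec P (TaylorShift.inputState d f u) S t ∧
          S.arr 0 = TaylorShift.coeffArray d (fun j => TaylorShift.shift u (f j)) ∧
          t ≤ C * (n ^ 2 * (d + 1) ^ n * τ + (d + 1) ^ (n + 1) * n ^ 3 * σ) *
            Nat.log 2 (n + d + τ + σ + 2) ^ c ∧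
          ∀ A : ℕ, (d + 1) ^ n ≤ A * d ^ n →
            t ≤ C * A * (n ^ 2 * d ^ n * τ + d ^ (n + 1) * n ^ 3 * σ) *
              Nat.log 2 (n + d + τ + σ + 2) ^ c := by
  obtain ⟨K₀, hK⟩ := BitRAM.exists_exec_taylorShiftP
  refine ⟨BitRAM.taylorShiftP, fun K => ⟨2 * (K₀ * ((K + 1) * (K + 40))), 6, ?_⟩⟩
  intro n d s τ σ f u hn hs hd hf hu
  obtain ⟨S, t, e, hS, ht⟩ := hK K n d s τ σ f u hn hs hd hf hu
  refine ⟨S, t, e, hS, ht.trans ?_, fun A hA => ht.trans ?_⟩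
  · exact Nat.mul_le_mul_right _ (Nat.mul_le_mul_right _ (Nat.le_mul_of_pos_left _ two_pos))
  · have hd1 : 1 ≤ d := by
      rcases Nat.eq_zero_or_pos d with rfl | h
      · simp [Nat.ne_of_gt hn] at hA
      · exact h
    -- The surplus factor `d + 1` of the second summand is at most `2 * d`. Its `2` is the `2` in
    -- the constant `C`; the first summand is doubled only to match.
    calc _ ≤ K₀ * ((K + 1) * (K + 40)) * (n ^ 2 * (2 * (A * d ^ n)) * τ +
          (A * d ^ n) * (2 * d) * n ^ 3 * σ) * Nat.log 2 (n + d + τ + σ + 2) ^ 6 := by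
          rw [pow_succ (d + 1)]
          gcongr
          · exact hA.trans (Nat.le_mul_of_pos_left _ (by norm_num))
          · omega
      _ = _ := by ring
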